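/- **Conventions.** Let $k$ be a field. A *2-vector space* is a $k$-linear category that is $k$-linearly equivalent to $(\mathrm{Vect}_k^{fd})^n$ for some $n\ge 0$. A *graded 2-vector space* is a sequence $C=(C_n)_{n\ge 0}$ of 2-vector spaces; its underlying category $\bigoplus_n C_n$ has as objects the families $(X_n)$ with almost all $X_n$ zero. A $k$-multilinear functor $G$ in the variables $C_1,\dots,C_r$ has *bounded degree* if there is a constant $B$ such that every degree in which $G(X_1,\dots,X_r)$ is nonzero differs by at most $B$ from a sum $n_1+\dots+n_r$ with $(X_i)_{n_i}\neq 0$; it has *degree zero* if one can take $B=0$. Let $\mathrm{FinSet}_*$ be the category of pointed finite sets. $\mathrm{FinSet}^{\sqcup}\to\mathrm{FinSet}_*$ is the category whose objects over $I$ are families $(S_i)$ of finite sets indexed by the elements $i\neq *$ of $I$; a morphism $(S_i)\to(T_j)$ over $\varphi:I\to J$ is a collection of maps $S_i\to T_{\varphi(i)}$ for all $i$ with $\varphi(i)\ne *$. $2\text{-}\mathrm{Vect}_{gr}^{\otimes}\to \mathrm{FinSet}_*$ is the bicategory whose objects over $I$ are families $(C_i)$ of graded 2-vector spaces indexed by the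 elements $i\ne *$ of $I$; a 1-morphism $(C_i)\to(D_j)$ over $\varphi$ is a collection of $k$-multilinear functors $\prod_{\varphi(i)=j}C_i\to D_j$ of bounded degree, one for each $j\neq *$; 2-morphisms are collections of natural transformations between 1-morphisms over the same $\varphi$. A 1-morphism $f:A\to B$ over $\varphi: I\to J$ is *coCartesian* if for each $Z$ over $L$ composition with $f$ gives an equivalence from $\mathrm{Hom}(B,Z)$ to the pseudo-pullback of $\mathrm{Hom}(A,Z)\to\mathrm{Hom}(I,L)\leftarrow\mathrm{Hom}(J,L)$. A square of 1-morphisms $g:A\to B$, $f:A\to C$, $h:B\to D$, $i:C\to D$ with a 2-morphism $\alpha:h g\Rightarrow i f$ satisfies the *right Beck–Chevalley condition* if its right mate $g f^R\Rightarrow h^R i$ is invertible, where $f^R,h^R$ are right adjoints of $f,h$. An *SSH category* is a pseudofunctor $\mathcal H:\mathrm{FinSet}^{\sqcup}\to 2\text{-}\mathrm{Vect}_{gr}^{\otimes}$ over $\mathrm{FinSet}_*$ (up to natural isomorphism) that takes morphisms to 1-morphisms of degree zero, takes coCartesian morphisms to coCartesian 1-morphisms, and takes Cartesian squares of finite sets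 (over $\{*,1\}$) to squares that satisfy the right Beck–Chevalley condition. **Notation.** Write $\mathbf n=\{1,\dots,n\}$, $\mathcal C=\mathcal H(\mathbf 1)$, and let $m:\mathcal H(\mathbf 2)\to\mathcal H(\mathbf 1)$ be the image of $\mathbf 2\to\mathbf 1$. Let $\bar m,\ m^2:\mathcal H(\mathbf 4)\to\mathcal H(\mathbf 2)$ be the images of the maps $\mathbf 4\to\mathbf 2$ given by $1,3\mapsto 1;\ 2,4\mapsto 2$ and by $1,2\mapsto 1;\ 3,4\mapsto 2$ respectively. Let $c:(\mathbf 1,\mathbf 1)\to\mathbf 2$ be the morphism over $\{*,1,2\}\to\{*,1\}$, $1,2\mapsto 1$, given by $1\mapsto 1$ and $1\mapsto 2$, and $\bar c:(\mathbf 2,\mathbf 2)\to\mathbf 4$ the one given by $1\mapsto1,\,2\mapsto 3$ on the first entry and $1\mapsto 2,\,2\mapsto 4$ on the second. For an object $\Phi$ of $\mathcal H(S)$, $(\Phi,\mathrm{Id}):\mathcal H(S)\to\mathcal H((S,S))$ is the 1-morphism with entries the constant functor $\Phi$ and the identity, where both entries of $\mathcal H((S,S))$ are identified with $\mathcal H(S)$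 through the images of the two maps $(S,S)\to(S)$ that forget an entry. Let $\Delta^l\dashv m\dashv\Delta^r$ and $m^2\dashv(\Delta^r)^2$. For an object $F$ of $\mathcal C$ put $i_F=\mathcal H(c)\circ(F,\mathrm{Id}):\mathcal C\to\mathcal H(\mathbf 2)$ and, for $\Phi=\Delta^l(F)$, $i_\Phi=\mathcal H(\bar c)\circ(\Phi,\mathrm{Id}):\mathcal H(\mathbf 2)\to\mathcal H(\mathbf 4)$; let $j^r_F,\ j^r_\Phi$ be their right adjoints, and put $$\Delta^r_F=j^r_F\circ\Delta^r,\qquad(\Delta^r)^2_\Phi=j^r_\Phi\circ(\Delta^r)^2 .$$ These are right adjoint to $m_F=m\circ i_F$ and $m^2_\Phi=m^2\circ i_\Phi$. **Theorem.** Let $\mathcal H$ be an SSH category and let $F$ be an object of $\mathcal C$. Then all the 1-morphisms above, including the adjoints in $2\text{-}\mathrm{Vect}_{gr}^\otimes$, exist. For every choice of them there is a unique 2-morphism $$\tau=(\eta,\mathrm{Id}):(F,\mathrm{Id})\circ m\Rightarrow(m,m)\circ(\Delta^l(F),\mathrm{Id})$$ whose first entry is the unit $\eta:F\to m\Delta^l(F)$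 and whose second entry is the identity of $m$. Let $\beta: i_F\circ m\Rightarrow\bar m\circ i_{\Delta^l(F)}$ be the pasting of $\tau$ with the image under $\mathcal H$ of the commutative square formed by $(\mathbf 2,\mathbf 2)\to(\mathbf 1,\mathbf 1)$, $\bar c$, $c$ and $\mathbf 4\to\mathbf 2$ ($1,3\mapsto1$; $2,4\mapsto2$), and let $\alpha: m_F\circ m\Rightarrow m\circ m^2_{\Delta^l(F)}$ be the pasting of $\beta$ with the image of the Cartesian square formed by the two maps $\mathbf 4\to\mathbf 2$ above and $\mathbf 2\to\mathbf 1$. Then both squares $\beta$ and $\alpha$ satisfy the right Beck–Chevalley condition. In particular the right mate $m\circ(\Delta^r)^2_{\Delta^l(F)}\Rightarrow\Delta^r_F\circ m$ of $\alpha$ is invertible, and its inverse is a canonical 2-isomorphism $$\Delta^r_F\circ m\;\cong\; m\circ(\Delta^r)^2_{\Delta^l(F)} .$$ -/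

import Mathlib

open CategoryTheory Bicategory

universe u v w

namespace SelfAdjointHopf

/-! ### Pointed finite sets -/

/-- A pointed finite set. -/
structure FinPt : Type 1 where
  carrier : Type
  [finite : Finite carrier]
  pt : carrier

namespace FinPt

attribute [instance] FinPt.finite

/-- The complement of the base point. -/
abbrev Nonbase (I : FinPt) : Type := {i : I.carrier // i ≠ I.pt}

/-- Maps of pointed sets. -/
@[ext]
structure Hom (I J : FinPt) : Type where
  toFun : I.carrier → J.carrier
  map_pt : toFun I.pt = J.pt

instance : Category FinPt where
  Hom := Hom
  id I := ⟨id, rfl⟩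
  comp f g := ⟨g.toFun ∘ f.toFun, by simp [f.map_pt, g.map_pt]⟩

@[ext]
theorem hom_ext {I J : FinPt} {f g : I ⟶ J} (h : ∀ i, f.toFun i = g.toFun i) : f = g :=
  Hom.ext (funext h)

/-- The pointed set `{*, 1, …, n}`, realized as `Fin (n + 1)` with base point `0`. -/
def std (n : ℕ) : FinPt := ⟨Fin (n + 1), 0⟩

/-- The fibre of a pointed map over an element other than the base point. -/
abbrev Fiber {I J : FinPt} (φ : I ⟶ J) (j : J.Nonbase) : Type :=
  {i : I.Nonbase // φ.toFun i.1 = j.1}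

end FinPt

/-! ### The category `FinSet^⊔` over pointed finite sets -/

/-- An object over `I`: a collection of finite sets indexed by the elements of `I` other than the
base point (the component at the base point is a one-point set and carries no information). -/
structure FinSetSqcup : Type 1 where
  base : FinPt
  fam : base.Nonbase → FintypeCat.{0}

namespace FinSetSqcup

/-- A morphism over `φ : I ⟶ J`: maps `S_i ⟶ T_{φ i}` (no information when `φ i` is the
base point). -/
@[ext]
structure Hom (X Y : FinSetSqcup) : Type where
  base : X.base ⟶ Y.base
  map : ∀ (i : X.base.Nonbase) (h : base.toFun i.1 ≠ Y.base.pt),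
    X.fam i ⟶ Y.fam ⟨base.toFun i.1, h⟩

instance : Category FinSetSqcup where
  Hom := Hom
  id X := ⟨𝟙 _, fun _ _ => 𝟙 _⟩
  comp {X Y Z} f g := ⟨f.base ≫ g.base, fun i h =>
    f.map i (fun e => h (by
      change g.base.toFun (f.base.toFun i.1) = _
      rw [e, g.base.map_pt])) ≫ g.map ⟨f.base.toFun i.1, _⟩ h⟩

/-- The projection to pointed finite sets. -/
def proj : FinSetSqcup ⥤ FinPt where
  obj X := X.base
  map f := f.base

/-- The list `(S, …, S)` of length `n`. -/
def list (n : ℕ) (S : FintypeCat.{0}) : FinSetSqcup := ⟨FinPt.std n, fun _ => S⟩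

/-- The map `(f, …, f) : (S, …, S) ⟶ (T, …, T)` over the identity. -/
def diag (n : ℕ) {S T : FintypeCat.{0}} (f : S ⟶ T) : list n S ⟶ list n T :=
  ⟨𝟙 _, fun _ _ => f⟩

/-- The map `(S, S) ⟶ (T)` over the active map `{*, 1, 2} ⟶ {*, 1}` given by two maps
`S ⟶ T`. -/
def cop {S T : FintypeCat.{0}} (f₁ f₂ : S ⟶ T) : list 2 S ⟶ list 1 T :=
  ⟨⟨(![0, 1, 1] : Fin 3 → Fin 2), rfl⟩, fun i _ => (![f₁, f₁, f₂] : Fin 3 → (S ⟶ T)) i.1⟩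

/-- The map `(S, S) ⟶ (S)` which forgets the second entry. -/
def fstEntry (S : FintypeCat.{0}) : list 2 S ⟶ list 1 S :=
  ⟨⟨(![0, 1, 0] : Fin 3 → Fin 2), rfl⟩, fun _ _ => 𝟙 S⟩

/-- The map `(S, S) ⟶ (S)` which forgets the first entry. -/
def sndEntry (S : FintypeCat.{0}) : list 2 S ⟶ list 1 S :=
  ⟨⟨(![0, 0, 1] : Fin 3 → Fin 2), rfl⟩, fun _ _ => 𝟙 S⟩

end FinSetSqcup

/-! ### Graded 2-vector spaces -/

/-- A 2-vector space over `k`: a `k`-linear category which is (`k`-linearly) equivalent to a finite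
sum of copies of the category of finite dimensional vector spaces. -/
structure TwoVect (k : Type u) [Field k] where
  carrier : Type w
  [category : Category.{v} carrier]
  [preadditive : Preadditive carrier]
  [linear : Linear k carrier]
  exists_equivalence : ∃ (n : ℕ) (e : carrier ≌ (Fin n → FGModuleCat.{u} k)),
    ∀ i, (e.functor ⋙ Pi.eval _ i).Additive ∧ (e.functor ⋙ Pi.eval _ i).Linear k

attribute [instance] TwoVect.category TwoVect.preadditive TwoVect.linear

/-- A graded 2-vector space: a sequence of 2-vector spaces. -/
abbrev TwoVectGr (k : Type u) [Field k] := ℕ → TwoVect.{u, v, w} k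

variable {k : Type u} [Field k]

/-- The underlying category `⨁ₙ Cₙ` of a graded 2-vector space: its objects are the families of
objects of the `Cₙ` almost all of which are zero. -/
structure Tot (C : TwoVectGr.{u, v, w} k) where
  obj : ∀ n, (C n).carrier
  finite : {n | ¬ Limits.IsZero (obj n)}.Finite

namespace Tot

variable {C : TwoVectGr.{u, v, w} k}

instance : Category (Tot C) where
  Hom X Y := ∀ n, X.obj n ⟶ Y.obj n
  id X n := 𝟙 (X.obj n)
  comp f g n := f n ≫ g n

instance (X Y : Tot C) : AddCommGroup (X ⟶ Y) :=
  inferInstanceAs (AddCommGroup (∀ n, X.obj n ⟶ Y.obj n))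

instance (X Y : Tot C) : Module k (X ⟶ Y) :=
  inferInstanceAs (Module k (∀ n, X.obj n ⟶ Y.obj n))

/-- The set of degrees in which an object does not vanish. -/
def supp (X : Tot C) : Set ℕ := {n | ¬ Limits.IsZero (X.obj n)}

end Tot

/-- A functor in several variables is `k`-multilinear when it is so on morphisms. -/
def IsMultilinear {ι : Type} {C : ι → TwoVectGr.{u, v, w} k} {D : TwoVectGr.{u, v, w} k}
    (G : (∀ i, Tot (C i)) ⥤ Tot D) : Prop :=
  ∀ X Y : (∀ i, Tot (C i)), ∃ M : MultilinearMap k (fun i => X i ⟶ Y i) (G.obj X ⟶ G.obj Y),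
    ∀ f : X ⟶ Y, M f = G.map f

/-- A functor in several variables has bounded degree when, for some bound `B`, every
nonvanishing degree of `G (X_i)` differs by at most `B` from a sum of nonvanishing
degrees of the `X_i`. -/
def IsBounded {ι : Type} {C : ι → TwoVectGr.{u, v, w} k} {D : TwoVectGr.{u, v, w} k}
    (G : (∀ i, Tot (C i)) ⥤ Tot D) : Prop :=
  ∃ B : ℕ, ∀ X, ∀ m ∈ (G.obj X).supp, ∃ n : ι → ℕ, (∀ i, n i ∈ (X i).supp) ∧
    |(m : ℤ) - ∑ᶠ i, (n i : ℤ)| ≤ B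

/-- A functor in several variables has degree zero when every nonvanishing degree of `G (X_i)` is
a sum of nonvanishing degrees of the `X_i`. -/
def IsDegreeZero {ι : Type} {C : ι → TwoVectGr.{u, v, w} k} {D : TwoVectGr.{u, v, w} k}
    (G : (∀ i, Tot (C i)) ⥤ Tot D) : Prop :=
  ∀ X, ∀ m ∈ (G.obj X).supp, ∃ n : ι → ℕ, (∀ i, n i ∈ (X i).supp) ∧ m = ∑ᶠ i, n i

/-- The `k`-multilinear functors of bounded degree in the variables `C i`. They are automatically
exact in each variable, as all the categories are semisimple. For an empty set of variables, this
is an object of the target. -/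
structure MultiFun {ι : Type} (C : ι → TwoVectGr.{u, v, w} k) (D : TwoVectGr.{u, v, w} k) where
  functor : (∀ i, Tot (C i)) ⥤ Tot D
  multilinear : IsMultilinear functor
  bounded : IsBounded functor

/-! ### The bicategory `2-Vect_gr^⊗` over pointed finite sets -/

/-- An object over `I`: a collection of graded 2-vector spaces indexed by the elements of `I`
other than the base point (the component at the base point is the zero category and carries no
information). -/
structure TwoVectTensor (k : Type u) [Field k] where
  base : FinPt
  fam : base.Nonbase → TwoVectGr.{u, v, w} k

namespace TwoVectTensor

/-- A 1-morphism over `φ : I ⟶ J`: functors `∏_{φ i = j} C_i ⥤ D_j` for all `j`. -/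
structure Hom (A B : TwoVectTensor.{u, v, w} k) where
  base : A.base ⟶ B.base
  comp : ∀ j : B.base.Nonbase, MultiFun (fun i : FinPt.Fiber base j => A.fam i.1) (B.fam j)

/-- For two equal maps of pointed sets, the identification of the products over their fibres. -/
abbrev reindex (A : TwoVectTensor.{u, v, w} k) {J : FinPt} {φ ψ : A.base ⟶ J} (h : φ = ψ)
    (j : J.Nonbase) :
    (∀ i : FinPt.Fiber φ j, Tot (A.fam i.1)) ⥤ (∀ i : FinPt.Fiber ψ j, Tot (A.fam i.1)) where
  obj X i := X ⟨i.1, by rw [h]; exact i.2⟩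
  map f i := f ⟨i.1, by rw [h]; exact i.2⟩

/-- A 2-morphism between 1-morphisms over the same map of pointed sets: natural transformations
between the components. -/
@[ext]
structure Hom₂ {A B : TwoVectTensor.{u, v, w} k} (F G : Hom A B) where
  base_eq : F.base = G.base
  app : ∀ j, (F.comp j).functor ⟶ reindex A base_eq j ⋙ (G.comp j).functor

theorem fiber_id_eq {I : FinPt} {j : I.Nonbase} (i : FinPt.Fiber (𝟙 I) j) : i = ⟨j, rfl⟩ :=
  Subtype.ext (Subtype.ext i.2)

/-- The identity of `A`: its components are the evaluations `∏_{i = j} A_i ⥤ A_j`. -/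
def idHom (A : TwoVectTensor.{u, v, w} k) : Hom A A where
  base := 𝟙 _
  comp j :=
    { functor :=
        { obj := fun X => X ⟨j, rfl⟩
          map := fun f => f ⟨j, rfl⟩ }
      multilinear := by
        intro X Y
        refine ⟨⟨fun f => f ⟨j, rfl⟩, ?_, ?_⟩, fun f => rfl⟩
        · intro _ f i a b
          obtain rfl := fiber_id_eq i
          simp
        · intro _ f i c a
          obtain rfl := fiber_id_eq i
          simp
      bounded := by
        refine ⟨0, fun X m hm => ⟨fun _ => m, fun i => ?_, ?_⟩⟩
        · obtain rfl := fiber_id_eq i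
          exact hm
        · let _ : Unique (FinPt.Fiber (𝟙 A.base) j) := ⟨⟨⟨j, rfl⟩⟩, fiber_id_eq⟩
          rw [finsum_unique]
          simp }

/-- The components of a composition of 1-morphisms: substitution of functors in several
variables. -/
def compFunctor {A B C : TwoVectTensor.{u, v, w} k} (F : Hom A B) (G : Hom B C)
    (l : C.base.Nonbase) :
    (∀ i : FinPt.Fiber (F.base ≫ G.base) l, Tot (A.fam i.1)) ⥤ Tot (C.fam l) where
  obj X := (G.comp l).functor.obj fun j => (F.comp j.1).functor.obj fun i =>
    X ⟨i.1, (congrArg G.base.toFun i.2).trans j.2⟩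
  map f := (G.comp l).functor.map fun j => (F.comp j.1).functor.map fun i =>
    f ⟨i.1, (congrArg G.base.toFun i.2).trans j.2⟩
  map_id X := by
    refine Eq.trans ?_ ((G.comp l).functor.map_id _)
    congr 1; funext j
    exact (F.comp j.1).functor.map_id _
  map_comp f g := by
    refine Eq.trans ?_ ((G.comp l).functor.map_comp _ _)
    congr 1; funext j
    exact (F.comp j.1).functor.map_comp _ _

theorem compFunctor_map_update {A B C : TwoVectTensor.{u, v, w} k} (F : Hom A B) (G : Hom B C)
    (l : C.base.Nonbase) [DecidableEq (FinPt.Fiber (F.base ≫ G.base) l)]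
    [DecidableEq (FinPt.Fiber G.base l)] [∀ j, DecidableEq (FinPt.Fiber F.base j)]
    {X Y : ∀ i : FinPt.Fiber (F.base ≫ G.base) l, Tot (A.fam i.1)}
    (f : ∀ i, X i ⟶ Y i) (i : FinPt.Fiber (F.base ≫ G.base) l) (j : FinPt.Fiber G.base l)
    (h : F.base.toFun i.1.1 = j.1.1) (a : X i ⟶ Y i) :
    (compFunctor F G l).map (X := X) (Y := Y) (Function.update f i a) =
      (G.comp l).functor.map (Function.update
        (fun j => (F.comp j.1).functor.map fun i =>
          f ⟨i.1, (congrArg G.base.toFun i.2).trans j.2⟩) j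
        ((F.comp j.1).functor.map (Function.update
          (fun i => f ⟨i.1, (congrArg G.base.toFun i.2).trans j.2⟩) ⟨i.1, h⟩ a))) := by
  refine congrArg (G.comp l).functor.map (funext fun j' => ?_)
  by_cases hj : j' = j
  · subst hj
    rw [Function.update_self]
    refine congrArg (F.comp j'.1).functor.map (funext fun i' => ?_)
    by_cases hi : i' = ⟨i.1, h⟩
    · subst hi
      refine (Function.update_self i a f).trans ?_
      symm
      exact Function.update_self _ _ _
    · rw [Function.update_of_ne hi]
      refine Function.update_of_ne (fun e => hi ?_) _ _
      exact Subtype.ext (congrArg (fun x : FinPt.Fiber (F.base ≫ G.base) l => x.1) e)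
  · rw [Function.update_of_ne hj]
    refine congrArg (F.comp j'.1).functor.map (funext fun i' => ?_)
    refine Function.update_of_ne (fun e => hj ?_) _ _
    have e' : i'.1 = i.1 := congrArg (fun x : FinPt.Fiber (F.base ≫ G.base) l => x.1) e
    refine Subtype.ext (Subtype.ext ?_)
    rw [← i'.2, ← h, e']

theorem compFunctor_multilinear {A B C : TwoVectTensor.{u, v, w} k} (F : Hom A B) (G : Hom B C)
    (l : C.base.Nonbase) : IsMultilinear (compFunctor F G l) := by
  classical
  intro X Y
  have key : ∀ i : FinPt.Fiber (F.base ≫ G.base) l, ∃ j : FinPt.Fiber G.base l,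
      F.base.toFun i.1.1 = j.1.1 := fun i =>
    ⟨⟨⟨F.base.toFun i.1.1, fun e => l.2
      (i.2.symm.trans ((congrArg G.base.toFun e).trans G.base.map_pt))⟩, i.2⟩, rfl⟩
  obtain ⟨M, hM⟩ := (G.comp l).multilinear
    (fun j => (F.comp j.1).functor.obj fun i => X ⟨i.1, (congrArg G.base.toFun i.2).trans j.2⟩)
    (fun j => (F.comp j.1).functor.obj fun i => Y ⟨i.1, (congrArg G.base.toFun i.2).trans j.2⟩)
  refine ⟨⟨fun f => (compFunctor F G l).map (X := X) (Y := Y) f, ?_, ?_⟩, fun f => rfl⟩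
  · intro hd f i a b
    obtain ⟨j, h⟩ := key i
    obtain ⟨N, hN⟩ := (F.comp j.1).multilinear
      (fun i => X ⟨i.1, (congrArg G.base.toFun i.2).trans j.2⟩)
      (fun i => Y ⟨i.1, (congrArg G.base.toFun i.2).trans j.2⟩)
    refine (compFunctor_map_update F G l f i j h _).trans (Eq.trans ?_ (congrArg₂ (· + ·)
      (compFunctor_map_update F G l f i j h a) (compFunctor_map_update F G l f i j h b)).symm)
    rw [← hM, ← hM, ← hM, ← hN, ← hN, ← hN, N.map_update_add, M.map_update_add]
    rfl
  · intro hd f i c a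
    obtain ⟨j, h⟩ := key i
    obtain ⟨N, hN⟩ := (F.comp j.1).multilinear
      (fun i => X ⟨i.1, (congrArg G.base.toFun i.2).trans j.2⟩)
      (fun i => Y ⟨i.1, (congrArg G.base.toFun i.2).trans j.2⟩)
    refine (compFunctor_map_update F G l f i j h _).trans (Eq.trans ?_ (congrArg (c • ·)
      (compFunctor_map_update F G l f i j h a)).symm)
    rw [← hM, ← hM, ← hN, ← hN, N.map_update_smul, M.map_update_smul]
    rfl

theorem compFunctor_bounded {A B C : TwoVectTensor.{u, v, w} k} (F : Hom A B) (G : Hom B C)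
    (l : C.base.Nonbase) : IsBounded (compFunctor F G l) := by
  classical
  obtain ⟨b, hb⟩ := (G.comp l).bounded
  choose c hc using fun j : B.base.Nonbase => (F.comp j).bounded
  have key : ∀ i : FinPt.Fiber (F.base ≫ G.base) l, F.base.toFun i.1.1 ≠ B.base.pt := fun i e =>
    l.2 (i.2.symm.trans ((congrArg G.base.toFun e).trans G.base.map_pt))
  let e : FinPt.Fiber (F.base ≫ G.base) l ≃
      Σ j : FinPt.Fiber G.base l, FinPt.Fiber F.base j.1 :=
    { toFun := fun i => ⟨⟨⟨F.base.toFun i.1.1, key i⟩, i.2⟩, ⟨i.1, rfl⟩⟩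
      invFun := fun x => ⟨x.2.1, (congrArg G.base.toFun x.2.2).trans x.1.2⟩
      left_inv := fun i => rfl
      right_inv := by
        rintro ⟨⟨⟨j, hj⟩, hl⟩, ⟨i, hi⟩⟩
        dsimp only at hi
        subst hi
        rfl }
  let _ : Fintype (FinPt.Fiber G.base l) := Fintype.ofFinite _
  let _ : ∀ j, Fintype (FinPt.Fiber F.base j) := fun j => Fintype.ofFinite _
  let _ : Fintype (FinPt.Fiber (F.base ≫ G.base) l) := Fintype.ofFinite _
  refine ⟨b + ∑ j : FinPt.Fiber G.base l, c j.1, fun X m hm => ?_⟩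
  obtain ⟨n, hn, hmn⟩ := hb _ m hm
  choose p hp hnp using fun j : FinPt.Fiber G.base l => hc j.1 _ (n j) (hn j)
  refine ⟨fun i => p (e i).1 (e i).2, fun i => hp (e i).1 (e i).2, ?_⟩
  rw [finsum_eq_sum_of_fintype] at hmn ⊢
  have h1 : ∑ i, (p (e i).1 (e i).2 : ℤ) = ∑ j, ∑ i, (p j i : ℤ) := by
    rw [Equiv.sum_comp e (fun x => (p x.1 x.2 : ℤ)), Fintype.sum_sigma]
  have h2 : |∑ j, (n j : ℤ) - ∑ j, ∑ i, (p j i : ℤ)| ≤ ∑ j : FinPt.Fiber G.base l, (c j.1 : ℤ) := by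
    rw [← Finset.sum_sub_distrib]
    refine (Finset.abs_sum_le_sum_abs _ _).trans (Finset.sum_le_sum fun j _ => ?_)
    have := hnp j
    rwa [finsum_eq_sum_of_fintype] at this
  rw [h1]
  push_cast
  calc _ = |((m : ℤ) - ∑ j, (n j : ℤ)) + (∑ j, (n j : ℤ) - ∑ j, ∑ i, (p j i : ℤ))| := by
        congr 1; ring
    _ ≤ _ := (abs_add_le _ _).trans (add_le_add hmn h2)

/-- Composition of 1-morphisms. -/
def compHom {A B C : TwoVectTensor.{u, v, w} k} (F : Hom A B) (G : Hom B C) : Hom A C where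
  base := F.base ≫ G.base
  comp l := ⟨compFunctor F G l, compFunctor_multilinear F G l, compFunctor_bounded F G l⟩

instance : CategoryStruct (TwoVectTensor.{u, v, w} k) where
  Hom := Hom
  id := idHom
  comp := compHom

instance homCategory (A B : TwoVectTensor.{u, v, w} k) : Category (A ⟶ B) where
  Hom F G := Hom₂ F G
  id F := ⟨rfl, fun j => 𝟙 _⟩
  comp α β := ⟨α.base_eq.trans β.base_eq, fun j => 
    { app := fun X => (α.app j).app X ≫ (β.app j).app ((reindex A α.base_eq j).obj X)
      naturality := fun X Y f => by
        have h1 := (α.app j).naturality f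
        have h2 := (β.app j).naturality ((reindex A α.base_eq j).map f)
        dsimp at h1 h2 ⊢
        rw [reassoc_of% h1, h2, Category.assoc] }⟩
  id_comp α := by
    refine Hom₂.ext ?_
    funext j; ext X
    exact Category.id_comp _
  comp_id α := by
    refine Hom₂.ext ?_
    funext j; ext X
    exact Category.comp_id _
  assoc α β γ := by
    refine Hom₂.ext ?_
    funext j; ext X
    exact Category.assoc _ _ _

@[ext]
theorem hom₂_ext {A B : TwoVectTensor.{u, v, w} k} {F G : A ⟶ B} {α β : F ⟶ G}
    (h : ∀ j X, (α.app j).app X = (β.app j).app X) : α = β := by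
  refine Hom₂.ext ?_
  funext j; ext X; exact h j X

/-- A 2-isomorphism given by the equality of the underlying maps and isomorphisms of components. -/
def isoMk {A B : TwoVectTensor.{u, v, w} k} {F G : A ⟶ B} (h : F.base = G.base)
    (e : ∀ j, (F.comp j).functor ≅ reindex A h j ⋙ (G.comp j).functor) : F ≅ G where
  hom := ⟨h, fun j => (e j).hom⟩
  inv := ⟨h.symm, fun j => 
    { app := fun X => (e j).inv.app ((reindex A h.symm j).obj X)
      naturality := fun X Y f => (e j).inv.naturality ((reindex A h.symm j).map f) }⟩
  hom_inv_id := by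
    ext j X : 2
    exact (e j).hom_inv_id_app X
  inv_hom_id := by
    ext j X : 2
    exact (e j).inv_hom_id_app ((reindex A h.symm j).obj X)

instance : Bicategory (TwoVectTensor.{u, v, w} k) where
  homCategory := homCategory
  whiskerLeft {A B C} F {G G'} η := ⟨congrArg (F.base ≫ ·) η.base_eq, fun l =>
    { app := fun X => (η.app l).app fun j => (F.comp j.1).functor.obj fun i =>
        X ⟨i.1, (congrArg G.base.toFun i.2).trans j.2⟩
      naturality := fun X Y f => (η.app l).naturality (fun j => (F.comp j.1).functor.map fun i =>
        f ⟨i.1, (congrArg G.base.toFun i.2).trans j.2⟩) }⟩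
  whiskerRight {A B C} {F F'} η G := ⟨congrArg (· ≫ G.base) η.base_eq, fun l =>
    { app := fun X => (G.comp l).functor.map fun j => (η.app j.1).app fun i =>
        X ⟨i.1, (congrArg G.base.toFun i.2).trans j.2⟩
      naturality := fun X Y f => by
        refine ((G.comp l).functor.map_comp _ _).symm.trans
          (Eq.trans ?_ ((G.comp l).functor.map_comp _ _))
        congr 1; funext j
        exact (η.app j.1).naturality fun i =>
          f ⟨i.1, (congrArg G.base.toFun i.2).trans j.2⟩ }⟩
  associator F G K := isoMk rfl fun l => Iso.refl _
  leftUnitor F := isoMk rfl fun l => Iso.refl _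
  rightUnitor F := isoMk rfl fun l => Iso.refl _
  whiskerLeft_id := by
    intros
    ext l X : 2
    rfl
  whiskerLeft_comp := by
    intros
    ext l X : 2
    rfl
  id_whiskerLeft := by
    intros
    ext l X : 2
    exact ((Category.id_comp _).trans (Category.comp_id _)).symm
  comp_whiskerLeft := by
    intros
    ext l X : 2
    exact ((Category.id_comp _).trans (Category.comp_id _)).symm
  id_whiskerRight F G := by
    ext l X : 2
    exact (G.comp l).functor.map_id _
  comp_whiskerRight η θ G := by
    ext l X : 2
    exact (G.comp l).functor.map_comp _ _
  whiskerRight_id := by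
    intros
    ext l X : 2
    exact ((Category.id_comp _).trans (Category.comp_id _)).symm
  whiskerRight_comp := by
    intros
    ext l X : 2
    exact ((Category.id_comp _).trans (Category.comp_id _)).symm
  whisker_assoc := by
    intros
    ext l X : 2
    exact ((Category.id_comp _).trans (Category.comp_id _)).symm
  whisker_exchange := by
    intro A B C F F' G G' η θ
    ext l X : 2
    exact ((θ.app l).naturality fun j => (η.app j.1).app fun i =>
      X ⟨i.1, (congrArg G.base.toFun i.2).trans j.2⟩).symm
  pentagon F G K L := by
    ext l X : 2
    refine congrArg (· ≫ _) ?_ |>.trans (congrArg (𝟙 _ ≫ ·) (Category.comp_id _))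
    exact (L.comp l).functor.map_id _
  triangle F G := by
    ext l X : 2
    exact (Category.comp_id _).trans ((G.comp l).functor.map_id _).symm

/-! ### CoCartesian 1-morphisms -/

/-- The projection to pointed finite sets, on categories of 1-morphisms. -/
def projHom (A B : TwoVectTensor.{u, v, w} k) : (A ⟶ B) ⥤ Discrete (A.base ⟶ B.base) where
  obj F := ⟨F.base⟩
  map α := Discrete.eqToHom α.base_eq

/-- Precomposition with a map of pointed finite sets. -/
def precompBase {I J : FinPt} (φ : I ⟶ J) (L : FinPt) : Discrete (J ⟶ L) ⥤ Discrete (I ⟶ L) :=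
  Discrete.functor fun ψ => ⟨φ ≫ ψ⟩

/-- The comparison functor from the category of 1-morphisms `B ⟶ Z` to the pseudo pullback
of the categories of 1-morphisms `A ⟶ Z` and of maps of pointed sets from the base
of `B` to the base of `Z`, over the maps from the base of `A` to the base of `Z`. -/
def comparison {A B : TwoVectTensor.{u, v, w} k} (F : A ⟶ B) (Z : TwoVectTensor.{u, v, w} k) :
    (B ⟶ Z) ⥤ Limits.CategoricalPullback (projHom A Z) (precompBase F.base Z.base) where
  obj G := ⟨F ≫ G, ⟨G.base⟩, Iso.refl _⟩
  map α := ⟨F ◁ α, Discrete.eqToHom α.base_eq, Subsingleton.elim _ _⟩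

/-- `F` is a coCartesian lift of its image in pointed finite sets. -/
def IsCoCartesian {A B : TwoVectTensor.{u, v, w} k} (F : A ⟶ B) : Prop :=
  ∀ Z : TwoVectTensor.{u, v, w} k, (comparison F Z).IsEquivalence

/-! ### The empty list, and objects as 1-morphisms out of it -/

/-- The empty list. -/
def nil : TwoVectTensor.{u, v, w} k :=
  ⟨FinPt.std 0, fun i => (i.2 (Subsingleton.elim (α := Fin 1) _ _)).elim⟩

theorem nil_false (j : (nil : TwoVectTensor.{u, v, w} k).base.Nonbase) : False :=
  j.2 (Subsingleton.elim (α := Fin 1) _ _)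

/-- The 1-morphism from a list to the empty list. -/
def toNil (A : TwoVectTensor.{u, v, w} k) : A ⟶ nil :=
  Hom.mk (B := nil) ⟨fun _ => nil.base.pt, rfl⟩ fun j => (nil_false j).elim

/-- Any two 1-morphisms to the empty list are uniquely isomorphic. -/
def toNilIso {A B : TwoVectTensor.{u, v, w} k} (F : A ⟶ B) : F ≫ toNil B ≅ toNil A :=
  isoMk rfl fun j => (nil_false j).elim

/-- The 1-morphism from the empty list given by a collection of objects. -/
def point (A : TwoVectTensor.{u, v, w} k) (X : ∀ j, Tot (A.fam j)) : nil ⟶ A :=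
  Hom.mk (A := nil) ⟨fun _ => A.base.pt, rfl⟩ fun j =>
    { functor := (Functor.const _).obj (X j)
      multilinear := fun Y Z => by
        have : IsEmpty (FinPt.Fiber (I := (nil : TwoVectTensor.{u, v, w} k).base)
          ⟨fun _ => A.base.pt, rfl⟩ j) := ⟨fun i => nil_false i.1⟩
        exact ⟨MultilinearMap.constOfIsEmpty k _ (𝟙 (X j)), fun f => rfl⟩
      bounded := by
        have : IsEmpty (FinPt.Fiber (I := (nil : TwoVectTensor.{u, v, w} k).base)
          ⟨fun _ => A.base.pt, rfl⟩ j) := ⟨fun i => nil_false i.1⟩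
        obtain ⟨B, hB⟩ := (X j).finite.bddAbove
        refine ⟨B, fun Y m hm => ⟨fun _ => 0, fun i => isEmptyElim i, ?_⟩⟩
        have h : m ≤ B := hB hm
        simpa using h }

end TwoVectTensor

/-! ### The Beck–Chevalley condition -/

/-- A square
```
A --g--> B
|f       |h
v        v
C --i--> D
```
with a 2-morphism `α : g ≫ h ⟶ f ≫ i` satisfies the (right) Beck–Chevalley condition if its right
mate `f_R ≫ g ⟶ i ≫ h_R` is invertible, for right adjoints `f_R`, `h_R` of `f`, `h`. -/
def RightBeckChevalley {𝒞 : Type*} [Bicategory 𝒞] {A B C D : 𝒞} {g : A ⟶ B} {f : A ⟶ C}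
    {h : B ⟶ D} {i : C ⟶ D} (α : g ≫ h ⟶ f ≫ i) : Prop :=
  ∀ (fR : C ⟶ A) (hR : D ⟶ B) (adjf : Bicategory.Adjunction f fR)
    (adjh : Bicategory.Adjunction h hR), IsIso (mateEquiv adjf adjh α)

/-! ### Symmetric self-adjoint Hopf categories -/

open FinSetSqcup in
/-- A symmetric self-adjoint Hopf category: a morphism `H` of fibrations over pointed finite sets
from `FinSet^⊔` to `2-Vect_gr^⊗`, which takes morphisms to 1-morphisms of degree zero, is
coCartesian, and takes Cartesian squares in the fibre over `{*, 1}` to squares that satisfy the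
Beck–Chevalley condition. -/
structure SSH (k : Type u) [Field k] where
  H : Pseudofunctor (LocallyDiscrete FinSetSqcup) (TwoVectTensor.{u, v, w} k)
  baseIso : ∀ X : FinSetSqcup, (H.obj ⟨X⟩).base ≅ X.base
  baseIso_naturality : ∀ {X Y : FinSetSqcup} (f : X ⟶ Y),
    (H.map f.toLoc).base ≫ (baseIso Y).hom = (baseIso X).hom ≫ f.base
  degreeZero : ∀ {X Y : FinSetSqcup} (f : X ⟶ Y) (j : (H.obj ⟨Y⟩).base.Nonbase),
    IsDegreeZero ((H.map f.toLoc).comp j).functor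
  coCartesian : ∀ {X Y : FinSetSqcup} (f : X ⟶ Y), proj.IsStronglyCocartesian f.base f →
    TwoVectTensor.IsCoCartesian (H.map f.toLoc)
  beckChevalley : ∀ {S T R U : FintypeCat.{0}} {a : S ⟶ T} {c : S ⟶ R} {b : T ⟶ U} {d : R ⟶ U}
    (_ : IsPullback a c b d)
    (sq : CommSq (diag 1 a) (diag 1 c) (diag 1 b) (diag 1 d)),
    RightBeckChevalley (H.isoMapOfCommSq sq.toLoc).hom

namespace SSH

open FinSetSqcup TwoVectTensor

/-- The set `{1, …, n}`, realized as `{0, …, n - 1}`. -/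
abbrev fset (n : ℕ) : FintypeCat.{0} := FintypeCat.of (Fin n)

/-- The map `{1, 2} ⟶ {1}`. -/
def fold : fset 2 ⟶ fset 1 := FintypeCat.homMk fun _ => 0

/-- The map `1 ↦ 1, 2 ↦ 2, 3 ↦ 1, 4 ↦ 2`. -/
def foldBar : fset 4 ⟶ fset 2 := FintypeCat.homMk (![0, 1, 0, 1] : Fin 4 → Fin 2)

/-- The map `1 ↦ 1, 2 ↦ 1, 3 ↦ 2, 4 ↦ 2`. -/
def foldSq : fset 4 ⟶ fset 2 := FintypeCat.homMk (![0, 0, 1, 1] : Fin 4 → Fin 2)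

/-- The morphism `({1}, {2}) ⟶ {1, 2}`. -/
def c : list 2 (fset 1) ⟶ list 1 (fset 2) :=
  cop (FintypeCat.homMk fun _ => (0 : Fin 2)) (FintypeCat.homMk fun _ => (1 : Fin 2))

/-- The morphism `({1, 2}, {1, 2}) ⟶ {1, 2, 3, 4}` given by `1 ↦ 1, 2 ↦ 3` and `1 ↦ 2, 2 ↦ 4`. -/
def cBar : list 2 (fset 2) ⟶ list 1 (fset 4) :=
  cop (FintypeCat.homMk (![0, 2] : Fin 2 → Fin 4)) (FintypeCat.homMk (![1, 3] : Fin 2 → Fin 4))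

theorem commSq_c : CommSq (diag 2 fold) cBar c (diag 1 foldBar) := by
  refine ⟨Hom.ext rfl (heq_of_eq ?_)⟩
  funext i h
  obtain ⟨i, hi⟩ := i
  change Fin 3 at i
  fin_cases i
  · exact (hi rfl).elim
  all_goals
    refine FintypeCat.hom_ext _ _ fun x => ?_
    change Fin 2 at x
    fin_cases x <;> rfl

theorem commSq_fold : CommSq (diag 1 foldBar) (diag 1 foldSq) (diag 1 fold) (diag 1 fold) :=
  ⟨rfl⟩

theorem commSq_fstEntry {S T : FintypeCat.{0}} (f : S ⟶ T) :
    CommSq (diag 2 f) (fstEntry S) (fstEntry T) (diag 1 f) :=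
  ⟨rfl⟩

theorem commSq_sndEntry {S T : FintypeCat.{0}} (f : S ⟶ T) :
    CommSq (diag 2 f) (sndEntry S) (sndEntry T) (diag 1 f) :=
  ⟨rfl⟩

variable (𝓗 : SSH.{u, v, w} k)

/-- The image under `𝓗` of the list `(S, …, S)`. -/
abbrev ob (n : ℕ) (S : FintypeCat.{0}) : TwoVectTensor.{u, v, w} k := 𝓗.H.obj ⟨list n S⟩

/-- The only element of the base of `𝓗(S)` other than the base point. -/
def one (S : FintypeCat.{0}) : (𝓗.ob 1 S).base.Nonbase :=
  ⟨(𝓗.baseIso (list 1 S)).inv.toFun (1 : Fin 2), fun h => by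
    have h1 := congrArg (fun f => f.toFun (1 : Fin 2)) (𝓗.baseIso (list 1 S)).inv_hom_id
    change (𝓗.baseIso (list 1 S)).hom.toFun ((𝓗.baseIso (list 1 S)).inv.toFun (1 : Fin 2)) =
      (1 : Fin 2) at h1
    rw [h, (𝓗.baseIso (list 1 S)).hom.map_pt] at h1
    exact absurd h1 (by change ¬ ((0 : Fin 2) = 1); decide)⟩

theorem eq_one (S : FintypeCat.{0}) (j : (𝓗.ob 1 S).base.Nonbase) : j = 𝓗.one S := by
  have h1 := congrArg (fun f => f.toFun j.1) (𝓗.baseIso (list 1 S)).hom_inv_id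
  change (𝓗.baseIso (list 1 S)).inv.toFun ((𝓗.baseIso (list 1 S)).hom.toFun j.1) = j.1 at h1
  refine Subtype.ext (h1.symm.trans (congrArg _ ?_))
  have h2 : ((𝓗.baseIso (list 1 S)).hom.toFun j.1 : Fin 2) ≠ (0 : Fin 2) := fun e => j.2 (by
    rw [← h1]
    exact (congrArg (𝓗.baseIso (list 1 S)).inv.toFun e).trans (𝓗.baseIso (list 1 S)).inv.map_pt)
  exact (Fin.eq_one_of_ne_zero _ h2)

/-- The graded 2-vector space `𝓗(S)`. -/
abbrev cat (S : FintypeCat.{0}) : TwoVectGr.{u, v, w} k := (𝓗.ob 1 S).fam (𝓗.one S)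

/-- The category `𝒞` on which `𝓗` gives a structure of self-adjoint Hopf category. -/
abbrev C : TwoVectGr.{u, v, w} k := 𝓗.cat (fset 1)

/-- An object of `𝓗(S)`, as a 1-morphism from the empty list. -/
def pt {S : FintypeCat.{0}} (X : Tot (𝓗.cat S)) : nil ⟶ 𝓗.ob 1 S :=
  point _ fun j => (𝓗.eq_one S j).symm ▸ X

/-- The multiplication `m : 𝒞^{⊗2} ⟶ 𝒞`. -/
abbrev m : 𝓗.ob 1 (fset 2) ⟶ 𝓗.ob 1 (fset 1) := 𝓗.H.map (diag 1 fold).toLoc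

/-- The 1-morphism `m̄ : 𝒞^{⊗4} ⟶ 𝒞^{⊗2}`. -/
abbrev mBar : 𝓗.ob 1 (fset 4) ⟶ 𝓗.ob 1 (fset 2) := 𝓗.H.map (diag 1 foldBar).toLoc

/-- The 1-morphism `m² : 𝒞^{⊗4} ⟶ 𝒞^{⊗2}`. -/
abbrev mSq : 𝓗.ob 1 (fset 4) ⟶ 𝓗.ob 1 (fset 2) := 𝓗.H.map (diag 1 foldSq).toLoc

/-- The 1-morphism `(m, m) : (𝒞^{⊗2}, 𝒞^{⊗2}) ⟶ (𝒞, 𝒞)`. -/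
abbrev mm : 𝓗.ob 2 (fset 2) ⟶ 𝓗.ob 2 (fset 1) := 𝓗.H.map (diag 2 fold).toLoc

/-- For an object `Φ` of `𝓗(S)`, the 1-morphism `(Φ, Id) : 𝓗(S) ⟶ 𝓗((S, S))`, with the
identifications of its two entries. As `𝓗` is only defined up to equivalence, the entries of the
list `𝓗((S, S))` are identified with `𝓗(S)` through the images of the two maps
`(S, S) ⟶ (S)`. -/
structure Insertion {S : FintypeCat.{0}} (Φ : nil ⟶ 𝓗.ob 1 S) where
  hom : 𝓗.ob 1 S ⟶ 𝓗.ob 2 S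
  fst : hom ≫ 𝓗.H.map (fstEntry S).toLoc ≅ toNil _ ≫ Φ
  snd : hom ≫ 𝓗.H.map (sndEntry S).toLoc ≅ 𝟙 _

/-- The adjoints `Δˡ ⊣ m ⊣ Δʳ` and `m² ⊣ (Δʳ)²`, the 1-morphisms `i_F = 𝓗(c) ∘ (F, Id)` and
`i_{Δˡ(F)} = 𝓗(c̄) ∘ (Δˡ(F), Id)`, and their right adjoints `jʳ_F` and `jʳ_{Δˡ(F)}`. All of
these are unique up to canonical isomorphism. -/
structure HeisenbergData (F : Tot 𝓗.C) where
  Δl : 𝓗.ob 1 (fset 1) ⟶ 𝓗.ob 1 (fset 2)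
  adjl : Bicategory.Adjunction Δl 𝓗.m
  Δr : 𝓗.ob 1 (fset 1) ⟶ 𝓗.ob 1 (fset 2)
  adjr : Bicategory.Adjunction 𝓗.m Δr
  ΔrSq : 𝓗.ob 1 (fset 2) ⟶ 𝓗.ob 1 (fset 4)
  adjrSq : Bicategory.Adjunction 𝓗.mSq ΔrSq
  ins : 𝓗.Insertion (𝓗.pt F)
  insΔ : 𝓗.Insertion (𝓗.pt F ≫ Δl)
  j : 𝓗.ob 1 (fset 2) ⟶ 𝓗.ob 1 (fset 1)
  adjj : Bicategory.Adjunction (ins.hom ≫ 𝓗.H.map c.toLoc) j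
  jΔ : 𝓗.ob 1 (fset 4) ⟶ 𝓗.ob 1 (fset 2)
  adjjΔ : Bicategory.Adjunction (insΔ.hom ≫ 𝓗.H.map cBar.toLoc) jΔ

namespace HeisenbergData

variable {𝓗} {F : Tot 𝓗.C} (D : 𝓗.HeisenbergData F)

/-- `i_F : 𝒞 ⟶ 𝒞^{⊗2}`, `X ↦ F ⊠ X`. -/
abbrev i : 𝓗.ob 1 (fset 1) ⟶ 𝓗.ob 1 (fset 2) := D.ins.hom ≫ 𝓗.H.map c.toLoc

/-- `i_Φ : 𝒞^{⊗2} ⟶ 𝒞^{⊗4}`, `X ↦ 𝓗(c̄)(Φ, X)`, for `Φ = Δˡ(F)`. -/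
abbrev iΔ : 𝓗.ob 1 (fset 2) ⟶ 𝓗.ob 1 (fset 4) := D.insΔ.hom ≫ 𝓗.H.map cBar.toLoc

/-- `m_F = m ∘ i_F`. -/
abbrev mF : 𝓗.ob 1 (fset 1) ⟶ 𝓗.ob 1 (fset 1) := D.i ≫ 𝓗.m

/-- `m²_Φ = m² ∘ i_Φ` for `Φ = Δˡ(F)`. -/
abbrev mSqΔ : 𝓗.ob 1 (fset 2) ⟶ 𝓗.ob 1 (fset 2) := D.iΔ ≫ 𝓗.mSq

/-- `Δʳ_F = jʳ_F ∘ Δʳ`. -/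
abbrev ΔrF : 𝓗.ob 1 (fset 1) ⟶ 𝓗.ob 1 (fset 1) := D.Δr ≫ D.j

/-- `(Δʳ)²_Φ = jʳ_Φ ∘ (Δʳ)²` for `Φ = Δˡ(F)`. -/
abbrev ΔrSqΔ : 𝓗.ob 1 (fset 2) ⟶ 𝓗.ob 1 (fset 2) := D.ΔrSq ≫ D.jΔ

/-- The condition that `τ : (F, Id) ∘ m ⟶ (m, m) ∘ (Δˡ(F), Id)` is the 2-morphism `(η, Id)`: on the
first entry it is the unit `η : F ⟶ m Δˡ(F)`, on the second entry it is the identity of `m`. -/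
def IsUnitSquare (τ : 𝓗.m ≫ D.ins.hom ⟶ D.insΔ.hom ≫ 𝓗.mm) : Prop :=
  (τ ▷ 𝓗.H.map (fstEntry (fset 1)).toLoc ⊗≫
      D.insΔ.hom ◁ (𝓗.H.isoMapOfCommSq (commSq_fstEntry fold).toLoc).hom ⊗≫
      D.insΔ.fst.hom ▷ 𝓗.m =
    𝟙 _ ⊗≫ 𝓗.m ◁ D.ins.fst.hom ⊗≫ (toNilIso 𝓗.m).hom ▷ 𝓗.pt F ⊗≫
      (toNil _ ≫ 𝓗.pt F) ◁ D.adjl.unit ⊗≫ 𝟙 _) ∧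
  (τ ▷ 𝓗.H.map (sndEntry (fset 1)).toLoc ⊗≫
      D.insΔ.hom ◁ (𝓗.H.isoMapOfCommSq (commSq_sndEntry fold).toLoc).hom ⊗≫
      D.insΔ.snd.hom ▷ 𝓗.m =
    𝟙 _ ⊗≫ 𝓗.m ◁ D.ins.snd.hom ⊗≫ 𝟙 _)

/-- The square `β`: the pasting of a 2-morphism `τ` with the image of the Cartesian square
`((2, 2), (1, 1), 4, 2)`. -/
def β (τ : 𝓗.m ≫ D.ins.hom ⟶ D.insΔ.hom ≫ 𝓗.mm) : 𝓗.m ≫ D.i ⟶ D.iΔ ≫ 𝓗.mBar :=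
  𝟙 _ ⊗≫ τ ▷ 𝓗.H.map c.toLoc ⊗≫
    D.insΔ.hom ◁ (𝓗.H.isoMapOfCommSq commSq_c.toLoc).hom ⊗≫ 𝟙 _

/-- The square `α`: the pasting of `β` with the image of the Cartesian square `(4, 2, 2, 1)` of
finite sets. -/
def α (τ : 𝓗.m ≫ D.ins.hom ⟶ D.insΔ.hom ≫ 𝓗.mm) : 𝓗.m ≫ D.mF ⟶ D.mSqΔ ≫ 𝓗.m :=
  𝟙 _ ⊗≫ D.β τ ▷ 𝓗.m ⊗≫ D.iΔ ◁ (𝓗.H.isoMapOfCommSq commSq_fold.toLoc).hom ⊗≫ 𝟙 _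

/-- The right mate of `α` for the adjunctions `m²_Φ ⊣ (Δʳ)²_Φ` and `m_F ⊣ Δʳ_F`. -/
def mate (τ : 𝓗.m ≫ D.ins.hom ⟶ D.insΔ.hom ≫ 𝓗.mm) : D.ΔrSqΔ ≫ 𝓗.m ⟶ 𝓗.m ≫ D.ΔrF :=
  mateEquiv (D.adjjΔ.comp D.adjrSq) (D.adjj.comp D.adjr) (D.α τ)

end HeisenbergData

end SSH

end SelfAdjointHopf

/-! Right Beck–Chevalley can be tested on the other mate. If in a square `g ≫ h ⟶ f ≫ i` the sides
`g` and `i` have left adjoints, then the right mate is conjugate to the left mate, so it is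
invertible as soon as the left mate is (`rightBeckChevalley_of_isIso_leftMate`). For `β` these sides
are `m` and `mBar`. Since `β` is a vertical pasting of `τ` with the image of the square formed by
`c` and `cBar`, and left mates respect pasting (`leftMate_vcomp`), the two pieces can be treated
separately.

In the second piece the sides without adjoints are images of `c` and `cBar`, which are coCartesian
and lie over surjections. Whiskering with such 1-morphisms is bijective on 2-morphisms, and a Yoneda
argument makes the left mate invertible (`isIso_leftMate`, `isIso_leftMate_of_isCoCartesian`).

The left mate of `τ` is tested on the two entries (`Complementary.isIso`). The projections to the
entries are coCartesian as well, so the previous argument reduces the test to the left mates of the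
entries of `τ`. For the entry `η` the unit cancels against a counit by a triangle identity
(`isIso_leftMate_unit`); for the entry `Id` the mate is again an identity up to unitors.

Finally `α` is a horizontal pasting of `β` with the image of a Cartesian square of finite sets. The
latter satisfies Beck–Chevalley by the definition of `SSH`, and the mate of a horizontal pasting is
the composite of the mates.

Existence rests on semisimplicity. A linear functor of bounded degree between graded 2-vector spaces
has both adjoints, because each representing object is a finite sum of simple objects, and the
adjoints are again linear of bounded degree. A 1-morphism over a bijection is a family of such
functors. The 1-morphism `(F, Id)` and the 2-morphism `τ` come from the fact that a coCartesian
1-morphism over an inert map has equivalences as components (`Inert.exists_inverse`), so that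
1-morphisms and 2-morphisms into `𝓗((S, S))` can be prescribed entry by entry. -/

namespace SelfAdjointHopf

/-! ### Mates and the Beck–Chevalley condition in a bicategory -/

section Mates

variable {𝒞 : Type*} [Bicategory 𝒞]

/-- The left mate of a square `σ : r₁ ≫ g ⟶ h ≫ r₂`, followed by transposition along `l₁ ⊣ r₁`. -/
theorem homEquiv₁_leftMate {a b c d : 𝒞} {l₁ : a ⟶ b} {r₁ : b ⟶ a} (adj₁ : l₁ ⊣ r₁)
    {l₂ : c ⟶ d} {r₂ : d ⟶ c} (adj₂ : l₂ ⊣ r₂) {g : a ⟶ c} {h : b ⟶ d}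
    (σ : r₁ ≫ g ⟶ h ≫ r₂) {x : c ⟶ d} (f : x ⟶ l₂) :
    adj₁.homEquiv₁ (g ◁ f ≫ (mateEquiv adj₁ adj₂).symm σ) =
      (α_ _ _ _).inv ≫ σ ▷ x ≫ (α_ _ _ _).hom ≫
        h ◁ (r₂ ◁ f ≫ adj₂.counit) ≫ (ρ_ h).hom := by
  -- The left mate is obtained by transposing along `adj₂` and then along `adj₁`; applying
  -- `adj₁.homEquiv₁` undoes the second transposition.
  have h1 : (mateEquiv adj₁ adj₂).symm σ =
      adj₁.homEquiv₁.symm ((α_ _ _ _).inv ≫ adj₂.homEquiv₂.symm σ) := by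
    rw [mateEquiv_symm_apply', Adjunction.homEquiv₁_symm_apply, Adjunction.homEquiv₂_symm_apply]
    bicategory
  have h2 : ∀ y : g ≫ l₂ ⟶ l₁ ≫ h, adj₁.homEquiv₁ (g ◁ f ≫ y) =
      r₁ ◁ g ◁ f ≫ adj₁.homEquiv₁ y := by
    intro y
    simp only [Adjunction.homEquiv₁_apply, whiskerLeft_comp, Category.assoc]
  rw [h2, h1, Equiv.apply_symm_apply, Adjunction.homEquiv₂_symm_apply]
  calc
    _ = (α_ _ _ _).inv ≫ ((r₁ ≫ g) ◁ f ≫ σ ▷ l₂) ≫ (α_ _ _ _).hom ≫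
        h ◁ adj₂.counit ≫ (ρ_ h).hom := by bicategory
    _ = _ := by
      rw [whisker_exchange]
      bicategory

/-- In an invertible square of 1-morphisms `σ : R ≫ q ≅ p ≫ R'` in which whiskering with `p` and `q`
is bijective, and `L ≫ p` factors through `q`, the left mate is invertible. -/
theorem isIso_leftMate {a b c d : 𝒞} {L : a ⟶ b} {R : b ⟶ a} (adj : L ⊣ R)
    {L' : c ⟶ d} {R' : d ⟶ c} (adj' : L' ⊣ R') {q : a ⟶ c} {p : b ⟶ d}
    (σ : R ≫ q ⟶ p ≫ R') [IsIso σ]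
    (hq : ∀ x y : c ⟶ d, Function.Bijective (fun f : x ⟶ y => q ◁ f))
    (hp : ∀ x y : d ⟶ d, Function.Bijective (fun f : x ⟶ y => p ◁ f))
    (P : c ⟶ d) (θ : q ≫ P ≅ L ≫ p) :
    IsIso ((mateEquiv adj adj').symm σ) := by
  -- This map is the chain `Hom(x, L') ≅ Hom(R' ≫ x, 𝟙) ≅ Hom(p ≫ R' ≫ x, p) ≅ Hom(R ≫ q ≫ x, p) ≅
  -- Hom(q ≫ x, L ≫ p)`, given by `adj'`, `hp`, `σ` and `adj` in turn.
  have key : ∀ x : c ⟶ d, Function.Bijective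
      (fun f : x ⟶ L' => q ◁ f ≫ (mateEquiv adj adj').symm σ) := by
    intro x
    let e₁ : (x ⟶ L') ≃ (R' ≫ x ⟶ 𝟙 d) :=
      (Iso.homCongr (Iso.refl x) (ρ_ L').symm).trans adj'.homEquiv₁
    let e₂ : (p ≫ R' ≫ x ⟶ p ≫ 𝟙 d) ≃ (q ≫ x ⟶ L ≫ p) :=
      (Iso.homCongr ((asIso ((α_ R q x).inv ≫ σ ▷ x ≫ (α_ p R' x).hom)).symm) (ρ_ p)).trans
        adj.homEquiv₁.symm
    convert e₂.bijective.comp ((hp _ _).comp e₁.bijective) using 1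
    funext f
    refine (adj.homEquiv₁.symm_apply_apply _).symm.trans ?_
    refine congrArg adj.homEquiv₁.symm ?_
    rw [homEquiv₁_leftMate]
    have : e₁ f = R' ◁ f ≫ adj'.counit := by
      simp only [e₁, Equiv.trans_apply, Iso.homCongr_apply, Adjunction.homEquiv₁_apply]
      simp
    simp only [Iso.homCongr_apply, Function.comp_apply, this, Iso.symm_inv, asIso_hom,
      Category.assoc]
  -- Surjectivity at `x = P` factors `θ` through the mate and gives a one-sided inverse. By `hq` the
  -- other composite is `q ◁ e` for some `e`, and injectivity at `x = L'` forces `e = 𝟙`.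
  obtain ⟨f, hf⟩ := (key P).2 θ.hom
  dsimp only at hf
  have h1 : (θ.inv ≫ q ◁ f) ≫ (mateEquiv adj adj').symm σ = 𝟙 _ := by
    rw [Category.assoc, hf, Iso.inv_hom_id]
  obtain ⟨e, he⟩ := (hq _ _).2 ((mateEquiv adj adj').symm σ ≫ θ.inv ≫ q ◁ f)
  dsimp only at he
  have h2 : e = 𝟙 _ := by
    refine (key L').1 ?_
    dsimp only
    rw [he, Category.assoc, h1, Category.comp_id, whiskerLeft_id, Category.id_comp]
  rw [h2, whiskerLeft_id] at he
  exact ⟨⟨θ.inv ≫ q ◁ f, he.symm, h1⟩⟩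

/-- A square whose left mate is invertible satisfies the right Beck–Chevalley condition. -/
theorem rightBeckChevalley_of_isIso_leftMate {a b c d : 𝒞} {g : a ⟶ b} {f : a ⟶ c} {h : b ⟶ d}
    {i : c ⟶ d} (β : g ≫ h ⟶ f ≫ i) {lg : b ⟶ a} {li : d ⟶ c} (adjg : lg ⊣ g) (adji : li ⊣ i)
    (H : IsIso ((mateEquiv adjg adji).symm β)) : RightBeckChevalley β := by
  intro fR hR adjf adjh
  -- Write `β` as the mate of its left mate; taking mates twice is conjugation, which preserves
  -- isomorphisms.
  rw [← (mateEquiv adjg adji).apply_symm_apply β, Bicategory.iterated_mateEquiv_conjugateEquiv]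
  infer_instance

/-- The right Beck–Chevalley condition does not depend on the choice of right adjoints. -/
theorem rightBeckChevalley_of_isIso_mateEquiv {a b c d : 𝒞} {g : a ⟶ b} {f : a ⟶ c} {h : b ⟶ d}
    {i : c ⟶ d} (β : g ≫ h ⟶ f ≫ i) {fR : c ⟶ a} {hR : d ⟶ b} (adjf : f ⊣ fR) (adjh : h ⊣ hR)
    (H : IsIso (mateEquiv adjf adjh β)) : RightBeckChevalley β := by
  intro fR' hR' adjf' adjh'
  -- Pasting with the conjugate of an identity exchanges one right adjoint for another, and this
  -- conjugate is invertible.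
  have h1 := mateEquiv_conjugateEquiv_vcomp adjf adjh adjh' β (𝟙 _)
  have h2 := conjugateEquiv_mateEquiv_vcomp adjf' adjf adjh' (𝟙 _) β
  simp only [leftAdjointSquareConjugate.vcomp, rightAdjointSquareConjugate.vcomp,
    leftAdjointConjugateSquare.vcomp, rightAdjointConjugateSquare.vcomp, whiskerLeft_id,
    id_whiskerRight, Category.id_comp, Category.comp_id] at h1 h2
  rw [h2, h1]
  infer_instance

/-- The left mate of a pasting is the pasting of the left mates. -/
theorem leftMate_vcomp {a b c d e f : 𝒞} {g₁ : a ⟶ c} {g₂ : c ⟶ e} {h₁ : b ⟶ d} {h₂ : d ⟶ f}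
    {l₁ : a ⟶ b} {r₁ : b ⟶ a} {l₂ : c ⟶ d} {r₂ : d ⟶ c} {l₃ : e ⟶ f} {r₃ : f ⟶ e}
    (adj₁ : l₁ ⊣ r₁) (adj₂ : l₂ ⊣ r₂) (adj₃ : l₃ ⊣ r₃)
    (σ : r₁ ≫ g₁ ⟶ h₁ ≫ r₂) (τ : r₂ ≫ g₂ ⟶ h₂ ≫ r₃) :
    (mateEquiv adj₁ adj₃).symm (rightAdjointSquare.vcomp σ τ) =
      leftAdjointSquare.vcomp ((mateEquiv adj₁ adj₂).symm σ) ((mateEquiv adj₂ adj₃).symm τ) := by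
  rw [Equiv.symm_apply_eq, mateEquiv_vcomp adj₁ adj₂ adj₃, Equiv.apply_symm_apply,
    Equiv.apply_symm_apply]

/-- Left mates are natural in the two 1-morphisms that are not adjoints. -/
theorem leftMate_comp {a b c d : 𝒞} {g g' : a ⟶ c} {h h' : b ⟶ d}
    {l₁ : a ⟶ b} {r₁ : b ⟶ a} {l₂ : c ⟶ d} {r₂ : d ⟶ c} (adj₁ : l₁ ⊣ r₁) (adj₂ : l₂ ⊣ r₂)
    (u : g ⟶ g') (σ : r₁ ≫ g' ⟶ h' ≫ r₂) (v : h' ⟶ h) :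
    (mateEquiv adj₁ adj₂).symm (r₁ ◁ u ≫ σ ≫ v ▷ r₂) =
      u ▷ l₂ ≫ (mateEquiv adj₁ adj₂).symm σ ≫ l₁ ◁ v := by
  simp only [mateEquiv_symm_apply']
  calc
    _ = 𝟙 _ ⊗≫ (adj₁.unit ▷ g ≫ (l₁ ≫ r₁) ◁ u) ▷ l₂ ⊗≫ l₁ ◁ σ ▷ l₂ ⊗≫
        l₁ ◁ (v ▷ (r₂ ≫ l₂) ≫ h ◁ adj₂.counit) ⊗≫ 𝟙 _ := by bicategory
    _ = _ := by
      rw [← whisker_exchange, ← whisker_exchange]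
      bicategory

/-- The square which is the unit of `l ⊣ r` up to a 2-morphism `ν : r ≫ t ⟶ t'` has an invertible
left mate as soon as the left transpose of `ν` is invertible. -/
theorem isIso_leftMate_unit {b c z : 𝒞} {l : b ⟶ c} {r : c ⟶ b} (adj : l ⊣ r) {t : b ⟶ z}
    {t' : c ⟶ z} (ν : r ≫ t ⟶ t') (x : z ⟶ b) (hν : IsIso (adj.homEquiv₁.symm ν)) :
    IsIso ((mateEquiv adj adj).symm (𝟙 (r ≫ t ≫ x) ⊗≫ ν ▷ x ⊗≫ (t' ≫ x) ◁ adj.unit ⊗≫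
      𝟙 ((t' ≫ x ≫ l) ≫ r))) := by
  have : (mateEquiv adj adj).symm (𝟙 (r ≫ t ≫ x) ⊗≫ ν ▷ x ⊗≫ (t' ≫ x) ◁ adj.unit ⊗≫
      𝟙 ((t' ≫ x ≫ l) ≫ r)) =
      (α_ _ _ _).hom ≫ adj.homEquiv₁.symm ν ▷ (x ≫ l) ≫ (α_ _ _ _).hom := by
    rw [mateEquiv_symm_apply', Adjunction.homEquiv₁_symm_apply]
    calc
      _ = 𝟙 _ ⊗≫ adj.unit ▷ t ▷ x ▷ l ⊗≫ l ◁ ν ▷ x ▷ l ⊗≫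
          (l ≫ t' ≫ x) ◁ leftZigzag adj.unit adj.counit ⊗≫ 𝟙 _ := by bicategory
      _ = _ := by
        -- The unit contained in the square cancels against the counit introduced by the mate.
        rw [adj.left_triangle]
        bicategory
  rw [this]
  infer_instance

/-- Identity squares correspond to each other under mates, up to unitors. This settles the second
entry of `τ`. -/
theorem isIso_leftMate_unitors {b c : 𝒞} {l : b ⟶ c} {r : c ⟶ b} (adj : l ⊣ r) :
    IsIso ((mateEquiv adj adj).symm ((ρ_ r).hom ≫ (λ_ r).inv)) := by
  rw [← mateEquiv_leftUnitor_hom_rightUnitor_inv, Equiv.symm_apply_apply]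
  infer_instance

/-- If the left mates of a pasting and of its second square are invertible, so is the left mate of
the first square, up to whiskering. -/
theorem isIso_whiskerRight_leftMate {a b c d e f : 𝒞} {g₁ : a ⟶ c} {g₂ : c ⟶ e} {h₁ : b ⟶ d}
    {h₂ : d ⟶ f} {l₁ : a ⟶ b} {r₁ : b ⟶ a} {l₂ : c ⟶ d} {r₂ : d ⟶ c} {l₃ : e ⟶ f} {r₃ : f ⟶ e}
    (adj₁ : l₁ ⊣ r₁) (adj₂ : l₂ ⊣ r₂) (adj₃ : l₃ ⊣ r₃)
    (σ : r₁ ≫ g₁ ⟶ h₁ ≫ r₂) (τ : r₂ ≫ g₂ ⟶ h₂ ≫ r₃)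
    (hτ : IsIso ((mateEquiv adj₂ adj₃).symm τ))
    (hστ : IsIso ((mateEquiv adj₁ adj₃).symm (rightAdjointSquare.vcomp σ τ))) :
    IsIso ((mateEquiv adj₁ adj₂).symm σ ▷ h₂) := by
  rw [leftMate_vcomp adj₁ adj₂ adj₃, leftAdjointSquare.vcomp] at hστ
  simpa only [isIso_comp_left_iff, isIso_comp_right_iff] using hστ

end Mates

/-! ### Semisimple linear categories -/

section Semisimple

/-- A system of objects `e a` with `Hom (e a, e b) = 0` for `a ≠ b` and `End (e a)` spanned by the
identity, such that the finite direct sums of the `e a` exist and every object is a retract of one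
of these. -/
structure SimpleBasis (k : Type*) [Field k] (𝒯 : Type*) [Category 𝒯] [Preadditive 𝒯] [Linear k 𝒯]
    (N : Type) where
  e : N → 𝒯
  hom_eq_zero : ∀ {a b : N} (f : e a ⟶ e b), a ≠ b → f = 0
  exists_smul : ∀ {a : N} (f : e a ⟶ e a), ∃ c : k, f = c • 𝟙 (e a)
  exists_decomposition : ∀ X : 𝒯, ∃ (T : Type) (_ : Fintype T) (i : T → N)
    (p : ∀ t, X ⟶ e (i t)) (q : ∀ t, e (i t) ⟶ X), ∑ t, p t ≫ q t = 𝟙 X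
  exists_sum : ∀ (T : Type) [Fintype T] (i : T → N), ∃ (Z : 𝒯) (ι : ∀ t, e (i t) ⟶ Z)
    (π : ∀ t, Z ⟶ e (i t)), (∀ t, ι t ≫ π t = 𝟙 _) ∧ (∀ s t, s ≠ t → ι s ≫ π t = 0) ∧
      ∑ t, π t ≫ ι t = 𝟙 Z

namespace SimpleBasis

variable {k : Type*} [Field k] {𝒯 : Type*} [Category 𝒯] [Preadditive 𝒯] [Linear k 𝒯] {N : Type}

/-- By decomposing source and target, a morphism is determined by finitely many components between
simple objects, and the spaces of these are spanned by at most one element. -/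
theorem finite_hom (S : SimpleBasis k 𝒯 N) (X Y : 𝒯) : Module.Finite k (X ⟶ Y) := by
  have h1 : ∀ a b, Module.Finite k (S.e a ⟶ S.e b) := by
    intro a b
    by_cases h : a = b
    · subst h
      refine Module.Finite.of_surjective (LinearMap.toSpanSingleton k _ (𝟙 (S.e a))) fun f => ?_
      obtain ⟨c, rfl⟩ := S.exists_smul f
      exact ⟨c, rfl⟩
    · have : Subsingleton (S.e a ⟶ S.e b) :=
        ⟨fun f g => (S.hom_eq_zero f h).trans (S.hom_eq_zero g h).symm⟩
      infer_instance
  have h2 : ∀ a, Module.Finite k (S.e a ⟶ Y) := by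
    intro a
    obtain ⟨T, _, i, p, q, h⟩ := S.exists_decomposition Y
    refine Module.Finite.of_injective
      (LinearMap.pi fun t => Linear.rightComp k (S.e a) (p t)) fun f g hfg => ?_
    have h3 : ∀ t, f ≫ p t = g ≫ p t := fun t => congrFun hfg t
    rw [← Category.comp_id f, ← Category.comp_id g, ← h, Preadditive.comp_sum,
      Preadditive.comp_sum]
    simp only [← Category.assoc, h3]
  obtain ⟨T, _, i, p, q, h⟩ := S.exists_decomposition X
  refine Module.Finite.of_injective
    (LinearMap.pi fun t => Linear.leftComp k Y (q t)) fun f g hfg => ?_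
  have h3 : ∀ t, q t ≫ f = q t ≫ g := fun t => congrFun hfg t
  rw [← Category.id_comp f, ← Category.id_comp g, ← h, Preadditive.sum_comp,
    Preadditive.sum_comp]
  simp only [Category.assoc, h3]

variable (S : SimpleBasis k 𝒯 N) {𝒟 : Type*} [Category 𝒟] [Preadditive 𝒟] [Linear k 𝒟]
  (U : 𝒯 ⥤ 𝒟) [U.Additive] [U.Linear k]

/-- The representing object of `Hom(U -, Y)` is the sum of the `e a ⊗ Hom(U (e a), Y)`, with the
tautological evaluation as `ev`; `hY` makes this sum finite. Universality is checked on simple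
objects and then extended to all `X` by decomposition. -/
theorem exists_couniversal [∀ X Y : 𝒟, Module.Finite k (X ⟶ Y)] (Y : 𝒟)
    (hY : {a | ∃ f : U.obj (S.e a) ⟶ Y, f ≠ 0}.Finite) :
    ∃ (Z : 𝒯) (ev : U.obj Z ⟶ Y), ∀ (X : 𝒯) (g : U.obj X ⟶ Y), ∃! h : X ⟶ Z, U.map h ≫ ev = g := by
  classical
  let A := {a // ∃ f : U.obj (S.e a) ⟶ Y, f ≠ 0}
  let _ : Fintype A := hY.fintype
  let b (a : A) := Module.finBasis k (U.obj (S.e a.1) ⟶ Y)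
  obtain ⟨Z, ι, π, h1, h2, h3⟩ := S.exists_sum
    (Σ a : A, Fin (Module.finrank k (U.obj (S.e a.1) ⟶ Y))) fun t => t.1.1
  let ev : U.obj Z ⟶ Y := ∑ t, U.map (π t) ≫ b t.1 t.2
  have hev : ∀ t, U.map (ι t) ≫ ev = b t.1 t.2 := by
    intro t
    simp only [ev, Preadditive.comp_sum]
    rw [Finset.sum_eq_single t]
    · rw [← Category.assoc, ← U.map_comp, h1, U.map_id, Category.id_comp]
    · intro s _ hs
      rw [← Category.assoc, ← U.map_comp, h2 _ _ hs.symm, U.map_zero, Limits.zero_comp]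
    · simp
  have surj : ∀ (a : N) (g : U.obj (S.e a) ⟶ Y), ∃ h : S.e a ⟶ Z, U.map h ≫ ev = g := by
    intro a g
    by_cases hg : g = 0
    · exact ⟨0, by simp [hg]⟩
    let a' : A := ⟨a, g, hg⟩
    refine ⟨∑ s, (b a').repr g s • ι ⟨a', s⟩, ?_⟩
    rw [U.map_sum, Preadditive.sum_comp]
    refine Eq.trans (Finset.sum_congr rfl fun s _ => ?_) ((b a').sum_repr g)
    rw [Functor.map_smul, Linear.smul_comp, hev]
  have inj : ∀ (a : N) (h : S.e a ⟶ Z), U.map h ≫ ev = 0 → h = 0 := by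
    intro a h hh
    suffices H : ∀ t, h ≫ π t = 0 by
      rw [← Category.comp_id h, ← h3, Preadditive.comp_sum]
      simp [← Category.assoc, H]
    -- Only summands with the same index `a` receive nonzero maps from `S.e a`, and there the
    -- coefficients vanish because the maps `b a' s` are linearly independent.
    by_cases ha : ∃ f : U.obj (S.e a) ⟶ Y, f ≠ 0
    · let a' : A := ⟨a, ha⟩
      choose c hc using fun s => S.exists_smul (h ≫ π ⟨a', s⟩)
      have hsum : h = ∑ s, c s • ι ⟨a', s⟩ := by
        rw [← Category.comp_id h, ← h3, Preadditive.comp_sum, Fintype.sum_sigma]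
        rw [Finset.sum_eq_single a']
        · refine Finset.sum_congr rfl fun s _ => ?_
          rw [← Category.assoc, hc, Linear.smul_comp, Category.id_comp]
        · intro x _ hx
          refine Finset.sum_eq_zero fun s _ => ?_
          rw [← Category.assoc, S.hom_eq_zero (h ≫ π ⟨x, s⟩) (fun e => hx (Subtype.ext e.symm)),
            Limits.zero_comp]
        · simp
      have h4 : ∑ s, c s • b a' s = 0 := by
        rw [← hh, hsum, U.map_sum, Preadditive.sum_comp]
        refine Finset.sum_congr rfl fun s _ => ?_
        rw [Functor.map_smul, Linear.smul_comp, hev]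
      have h5 := Fintype.linearIndependent_iff.1 (b a').linearIndependent c h4
      rintro ⟨x, s⟩
      by_cases hx : x = a'
      · subst hx
        rw [hc, h5, zero_smul]
      · exact S.hom_eq_zero _ fun e => hx (Subtype.ext e.symm)
    · exact fun t => S.hom_eq_zero _ fun e => ha (e ▸ t.1.2)
  refine ⟨Z, ev, fun X g => ?_⟩
  obtain ⟨T, _, i, p, q, h⟩ := S.exists_decomposition X
  choose l hl using fun t => surj (i t) (U.map (q t) ≫ g)
  refine ⟨∑ t, p t ≫ l t, ?_, fun l' hl' => ?_⟩
  · simp only [U.map_sum, Preadditive.sum_comp, U.map_comp, Category.assoc, hl]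
    simp only [← Category.assoc, ← U.map_comp]
    rw [← Preadditive.sum_comp, ← U.map_sum, h, U.map_id, Category.id_comp]
  · rw [← Category.id_comp l', ← h, Preadditive.sum_comp]
    refine Finset.sum_congr rfl fun t _ => ?_
    rw [Category.assoc]
    refine congrArg (p t ≫ ·) (sub_eq_zero.1 (inj _ _ ?_))
    rw [U.map_sub, Preadditive.sub_comp, hl, U.map_comp, Category.assoc, hl', sub_self]

/-- Dual to `exists_couniversal`, with one copy of `e a` for each member of a basis of `Hom(Y, U (e
a))`. -/
theorem exists_universal [∀ X Y : 𝒟, Module.Finite k (X ⟶ Y)] (Y : 𝒟)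
    (hY : {a | ∃ f : Y ⟶ U.obj (S.e a), f ≠ 0}.Finite) :
    ∃ (Z : 𝒯) (η : Y ⟶ U.obj Z), ∀ (X : 𝒯) (g : Y ⟶ U.obj X), ∃! h : Z ⟶ X, η ≫ U.map h = g := by
  classical
  let A := {a // ∃ f : Y ⟶ U.obj (S.e a), f ≠ 0}
  let _ : Fintype A := hY.fintype
  let b (a : A) := Module.finBasis k (Y ⟶ U.obj (S.e a.1))
  obtain ⟨Z, ι, π, h1, h2, h3⟩ := S.exists_sum
    (Σ a : A, Fin (Module.finrank k (Y ⟶ U.obj (S.e a.1)))) fun t => t.1.1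
  let η : Y ⟶ U.obj Z := ∑ t, b t.1 t.2 ≫ U.map (ι t)
  have hη : ∀ t, η ≫ U.map (π t) = b t.1 t.2 := by
    intro t
    simp only [η, Preadditive.sum_comp]
    rw [Finset.sum_eq_single t]
    · rw [Category.assoc, ← U.map_comp, h1, U.map_id, Category.comp_id]
    · intro s _ hs
      rw [Category.assoc, ← U.map_comp, h2 _ _ hs, U.map_zero, Limits.comp_zero]
    · simp
  have surj : ∀ (a : N) (g : Y ⟶ U.obj (S.e a)), ∃ h : Z ⟶ S.e a, η ≫ U.map h = g := by
    intro a g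
    by_cases hg : g = 0
    · exact ⟨0, by simp [hg]⟩
    let a' : A := ⟨a, g, hg⟩
    refine ⟨∑ s, (b a').repr g s • π ⟨a', s⟩, ?_⟩
    rw [U.map_sum, Preadditive.comp_sum]
    refine Eq.trans (Finset.sum_congr rfl fun s _ => ?_) ((b a').sum_repr g)
    rw [Functor.map_smul, Linear.comp_smul, hη]
  have inj : ∀ (a : N) (h : Z ⟶ S.e a), η ≫ U.map h = 0 → h = 0 := by
    intro a h hh
    suffices H : ∀ t, ι t ≫ h = 0 by
      rw [← Category.id_comp h, ← h3, Preadditive.sum_comp]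
      simp [H]
    by_cases ha : ∃ f : Y ⟶ U.obj (S.e a), f ≠ 0
    · let a' : A := ⟨a, ha⟩
      choose c hc using fun s => S.exists_smul (ι ⟨a', s⟩ ≫ h)
      have hsum : h = ∑ s, c s • π ⟨a', s⟩ := by
        rw [← Category.id_comp h, ← h3, Preadditive.sum_comp, Fintype.sum_sigma]
        rw [Finset.sum_eq_single a']
        · refine Finset.sum_congr rfl fun s _ => ?_
          rw [Category.assoc, hc, Linear.comp_smul, Category.comp_id]
        · intro x _ hx
          refine Finset.sum_eq_zero fun s _ => ?_
          rw [Category.assoc, S.hom_eq_zero (ι ⟨x, s⟩ ≫ h) (fun e => hx (Subtype.ext e)),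
            Limits.comp_zero]
        · simp
      have h4 : ∑ s, c s • b a' s = 0 := by
        rw [← hh, hsum, U.map_sum, Preadditive.comp_sum]
        refine Finset.sum_congr rfl fun s _ => ?_
        rw [Functor.map_smul, Linear.comp_smul, hη]
      have h5 := Fintype.linearIndependent_iff.1 (b a').linearIndependent c h4
      rintro ⟨x, s⟩
      by_cases hx : x = a'
      · subst hx
        rw [hc, h5, zero_smul]
      · exact S.hom_eq_zero _ fun e => hx (Subtype.ext e)
    · exact fun t => S.hom_eq_zero _ fun e => ha (e ▸ t.1.2)
  refine ⟨Z, η, fun X g => ?_⟩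
  obtain ⟨T, _, i, p, q, h⟩ := S.exists_decomposition X
  choose l hl using fun t => surj (i t) (g ≫ U.map (p t))
  refine ⟨∑ t, l t ≫ q t, ?_, fun l' hl' => ?_⟩
  · simp only [U.map_sum, Preadditive.comp_sum, U.map_comp]
    simp only [← Category.assoc, hl]
    simp only [Category.assoc, ← U.map_comp]
    rw [← Preadditive.comp_sum, ← U.map_sum, h, U.map_id, Category.comp_id]
  · rw [← Category.comp_id l', ← h, Preadditive.comp_sum]
    refine Finset.sum_congr rfl fun t _ => ?_
    rw [← Category.assoc]
    refine congrArg (· ≫ q t) (sub_eq_zero.1 (inj _ _ ?_))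
    rw [U.map_sub, Preadditive.comp_sub, hl, U.map_comp, ← Category.assoc, hl', sub_self]

/-- The couniversal arrows are terminal in the categories of costructured arrows, which is what a
right adjoint amounts to. -/
theorem isLeftAdjoint [∀ X Y : 𝒟, Module.Finite k (X ⟶ Y)]
    (hU : ∀ Y, {a | ∃ f : U.obj (S.e a) ⟶ Y, f ≠ 0}.Finite) : U.IsLeftAdjoint := by
  have : ∀ Y, Limits.HasTerminal (CostructuredArrow U Y) := fun Y => by
    obtain ⟨Z, ev, h⟩ := S.exists_couniversal U Y (hU Y)
    have : ∀ W : CostructuredArrow U Y, Nonempty (Unique (W ⟶ CostructuredArrow.mk ev)) := fun W => by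
      obtain ⟨l, hl, hl'⟩ := h W.left W.hom
      exact ⟨⟨⟨CostructuredArrow.homMk l hl⟩, fun f => by
        ext
        exact hl' _ (CostructuredArrow.w f)⟩⟩
    have := fun W => (this W).some
    exact Limits.hasTerminal_of_unique (CostructuredArrow.mk ev)
  exact isLeftAdjoint_of_costructuredArrowTerminals U

theorem isRightAdjoint [∀ X Y : 𝒟, Module.Finite k (X ⟶ Y)]
    (hU : ∀ Y, {a | ∃ f : Y ⟶ U.obj (S.e a), f ≠ 0}.Finite) : U.IsRightAdjoint := by
  have : ∀ Y, Limits.HasInitial (StructuredArrow Y U) := fun Y => by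
    obtain ⟨Z, η, h⟩ := S.exists_universal U Y (hU Y)
    have : ∀ W : StructuredArrow Y U, Nonempty (Unique (StructuredArrow.mk η ⟶ W)) := fun W => by
      obtain ⟨l, hl, hl'⟩ := h W.right W.hom
      exact ⟨⟨⟨StructuredArrow.homMk l hl⟩, fun f => by
        ext
        exact hl' _ (StructuredArrow.w f)⟩⟩
    have := fun W => (this W).some
    exact Limits.hasInitial_of_unique (StructuredArrow.mk η)
  exact isRightAdjointOfStructuredArrowInitials U

end SimpleBasis

/-- A description of the morphisms of a `k`-linear category as families of linear maps, such that
the families of dimensions that occur are those of finite support. -/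
structure LinearModel (k : Type u) [Field k] (𝒯 : Type*) [Category 𝒯] [Preadditive 𝒯] [Linear k 𝒯]
    (N : Type) where
  V : 𝒯 → N → Type u
  [addCommGroup : ∀ X a, AddCommGroup (V X a)]
  [module : ∀ X a, Module k (V X a)]
  [finite : ∀ X a, Module.Finite k (V X a)]
  φ : ∀ {X Y : 𝒯}, (X ⟶ Y) ≃ₗ[k] ∀ a, V X a →ₗ[k] V Y a
  φ_id : ∀ X a, φ (𝟙 X) a = LinearMap.id
  φ_comp : ∀ {X Y Z : 𝒯} (f : X ⟶ Y) (g : Y ⟶ Z) a, φ (f ≫ g) a = φ g a ∘ₗ φ f a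
  finite_support : ∀ X, {a | Module.finrank k (V X a) ≠ 0}.Finite
  exists_finrank_eq : ∀ d : N → ℕ, {a | d a ≠ 0}.Finite → ∃ X, ∀ a, Module.finrank k (V X a) = d a

attribute [instance] LinearModel.addCommGroup LinearModel.module LinearModel.finite

/-! ### Simple objects from a linear model -/

namespace LinearModel

variable {k : Type u} [Field k] {𝒯 : Type*} [Category 𝒯] [Preadditive 𝒯] [Linear k 𝒯] {N : Type}
  (M : LinearModel k 𝒯 N)

/-- The object stands for the sum of one line at `i t` for each `t`. Coordinates indexed by the
fibres of `i` make explicit inclusions and projections possible. -/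
theorem exists_free {T : Type} [Finite T] (i : T → N) :
    ∃ X, Nonempty (∀ a, M.V X a ≃ₗ[k] ({t // i t = a} → k)) := by
  obtain ⟨X, hX⟩ := M.exists_finrank_eq (fun a => Nat.card {t // i t = a}) <| by
    refine (Set.finite_range i).subset fun a ha => ?_
    by_contra h
    exact ha (@Nat.card_of_isEmpty _ ⟨fun t => h ⟨t.1, t.2⟩⟩)
  refine ⟨X, ⟨fun a => LinearEquiv.ofFinrankEq _ _ ?_⟩⟩
  let _ : Fintype {t // i t = a} := Fintype.ofFinite _
  rw [hX, Module.finrank_fintype_fun_eq_card, Nat.card_eq_fintype_card]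

theorem hom_ext {X Y : 𝒯} {f g : X ⟶ Y} (h : ∀ a, M.φ f a = M.φ g a) : f = g :=
  M.φ.injective (funext h)

/-- The object whose model is one-dimensional at `a` and zero elsewhere. -/
noncomputable def simple (a : N) : 𝒯 := (M.exists_free fun _ : Unit => a).choose

/-- The coordinates form the fibre over `b` of the constant map at `a`: one point if `a = b`, none
otherwise. Both cases are thus covered without a case distinction. -/
noncomputable def simpleEquiv (a b : N) : M.V (M.simple a) b ≃ₗ[k] ({_t : Unit // a = b} → k) :=
  (M.exists_free fun _ : Unit => a).choose_spec.some b

theorem subsingleton_simple {a b : N} (h : a ≠ b) : Subsingleton (M.V (M.simple a) b) :=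
  have : IsEmpty {_t : Unit // a = b} := ⟨fun t => h t.2⟩
  (M.simpleEquiv a b).toEquiv.subsingleton

/-- The inclusion of the summand `t` fills in the coordinate `t` and the projection reads it off, so
all three identities are statements about coordinate vectors. -/
theorem exists_sum_of_equiv {T : Type} [Fintype T] (i : T → N) (Z : 𝒯)
    (E : ∀ a, M.V Z a ≃ₗ[k] ({t // i t = a} → k)) :
    ∃ (ι : ∀ t, M.simple (i t) ⟶ Z) (π : ∀ t, Z ⟶ M.simple (i t)),
      (∀ t, ι t ≫ π t = 𝟙 _) ∧ (∀ s t, s ≠ t → ι s ≫ π t = 0) ∧ ∑ t, π t ≫ ι t = 𝟙 Z := by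
  classical
  let ι (t : T) : M.simple (i t) ⟶ Z := M.φ.symm fun a =>
    (E a).symm.toLinearMap ∘ₗ (LinearMap.pi fun s : {s // i s = a} =>
      if h : t = s.1 then LinearMap.proj ⟨(), by rw [h]; exact s.2⟩ else 0) ∘ₗ
        (M.simpleEquiv (i t) a).toLinearMap
  let π (t : T) : Z ⟶ M.simple (i t) := M.φ.symm fun a =>
    (M.simpleEquiv (i t) a).symm.toLinearMap ∘ₗ
      (LinearMap.pi fun h : {_t : Unit // i t = a} => LinearMap.proj ⟨t, h.2⟩) ∘ₗ
        (E a).toLinearMap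
  refine ⟨ι, π, fun t => M.hom_ext fun a => ?_, fun s t hst => M.hom_ext fun a => ?_,
    M.hom_ext fun a => ?_⟩
  · ext x
    rw [M.φ_comp, M.φ_id]
    simp only [ι, π, LinearEquiv.apply_symm_apply, LinearMap.comp_apply, LinearEquiv.coe_coe,
      LinearMap.id_apply]
    rw [LinearEquiv.symm_apply_eq]
    funext h
    simp
  · ext x
    rw [M.φ_comp, map_zero]
    simp only [ι, π, LinearEquiv.apply_symm_apply, LinearMap.comp_apply, LinearEquiv.coe_coe,
      Pi.zero_apply, LinearMap.zero_apply]
    rw [LinearEquiv.symm_apply_eq]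
    funext h
    simp [hst]
  · ext x
    rw [map_sum, M.φ_id, Finset.sum_apply, LinearMap.sum_apply]
    simp only [M.φ_comp, ι, π, LinearEquiv.apply_symm_apply, LinearMap.comp_apply,
      LinearEquiv.coe_coe, LinearMap.id_apply]
    rw [← map_sum, LinearEquiv.symm_apply_eq]
    funext s
    rw [Finset.sum_apply, Finset.sum_eq_single s.1]
    · simp
    · intro t _ ht
      simp [ht]
    · simp

/-- The simple objects of a category with a linear model. -/
noncomputable def simpleBasis : SimpleBasis k 𝒯 N where
  e := M.simple
  hom_eq_zero {a b} f h := M.hom_ext fun c => by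
    by_cases hc : a = c
    · have := M.subsingleton_simple (a := b) (b := c) fun e => h (hc.trans e.symm)
      exact Subsingleton.elim _ _
    · have := M.subsingleton_simple hc
      exact Subsingleton.elim _ _
  exists_smul {a} f := by
    let y := (M.simpleEquiv a a).symm fun _ => 1
    refine ⟨M.simpleEquiv a a (M.φ f a y) ⟨(), rfl⟩, M.hom_ext fun c => ?_⟩
    by_cases hc : a = c
    · subst hc
      ext x
      rw [map_smul, Pi.smul_apply, M.φ_id]
      have hx : x = M.simpleEquiv a a x ⟨(), rfl⟩ • y := by
        rw [← (M.simpleEquiv a a).injective.eq_iff]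
        funext t
        simp only [y, map_smul, LinearEquiv.apply_symm_apply, Pi.smul_apply, smul_eq_mul, mul_one]
      rw [← (M.simpleEquiv a a).injective.eq_iff]
      funext t
      rw [hx, map_smul, map_smul, LinearMap.smul_apply, LinearMap.id_apply, map_smul, map_smul]
      simp only [y, LinearEquiv.apply_symm_apply, Pi.smul_apply, smul_eq_mul, mul_one]
      exact mul_comm _ _
    · have := M.subsingleton_simple hc
      exact Subsingleton.elim _ _
  exists_decomposition X := by
    classical
    let A := {a // Module.finrank k (M.V X a) ≠ 0}
    let _ : Fintype A := (M.finite_support X).fintype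
    -- One index for each dimension of each nonzero `V X a`, so that the fibre of `i` over any `a`
    -- has as many elements as `V X a` has dimensions, including none.
    let i : (Σ a : A, Fin (Module.finrank k (M.V X a.1))) → N := fun t => t.1.1
    have E : ∀ a, Nonempty (M.V X a ≃ₗ[k] ({t // i t = a} → k)) := fun a => by
      refine ⟨LinearEquiv.ofFinrankEq _ _ ?_⟩
      rw [Module.finrank_fintype_fun_eq_card]
      by_cases ha : Module.finrank k (M.V X a) = 0
      · have : IsEmpty {t // i t = a} := ⟨fun t => t.1.1.2
          ((congrArg (fun a => Module.finrank k (M.V X a)) t.2).trans ha)⟩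
        rw [ha, Fintype.card_eq_zero]
      · rw [← Fintype.card_fin (Module.finrank k (M.V X a))]
        refine Fintype.card_congr
          { toFun := fun s => ⟨⟨⟨a, ha⟩, s⟩, rfl⟩
            invFun := fun t => t.1.2.cast (congrArg (fun a => Module.finrank k (M.V X a)) t.2)
            left_inv := fun s => rfl
            right_inv := ?_ }
        rintro ⟨⟨⟨b, hb⟩, s⟩, h⟩
        dsimp only [i] at h
        subst h
        rfl
    obtain ⟨ι, π, -, -, h⟩ := M.exists_sum_of_equiv i X fun a => (E a).some
    exact ⟨_, inferInstance, i, π, ι, h⟩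
  exists_sum T _ i := by
    obtain ⟨Z, ⟨E⟩⟩ := M.exists_free i
    exact ⟨Z, M.exists_sum_of_equiv i Z E⟩

end LinearModel

end Semisimple
end SelfAdjointHopf

namespace SelfAdjointHopf
variable {k : Type u} [Field k]

/-! ### Linear functors between graded 2-vector spaces -/

namespace Tot

instance (C : TwoVectGr.{u, v, w} k) : Preadditive (Tot C) where
  add_comp _ _ _ f g h := funext fun n => Preadditive.add_comp _ _ _ (f n) (g n) (h n)
  comp_add _ _ _ f g h := funext fun n => Preadditive.comp_add _ _ _ (f n) (g n) (h n)

instance (C : TwoVectGr.{u, v, w} k) : Linear k (Tot C) where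
  smul_comp _ _ _ c f g := funext fun n => Linear.smul_comp _ _ _ c (f n) (g n)
  comp_smul _ _ _ f c g := funext fun n => Linear.comp_smul _ _ _ (f n) c (g n)

variable {C D : TwoVectGr.{u, v, w} k}

theorem mem_supp_of_ne_zero {X Y : Tot C} {f : X ⟶ Y} (hf : f ≠ 0) :
    ∃ n, n ∈ X.supp ∧ n ∈ Y.supp := by
  by_contra! h
  refine hf (funext fun n => ?_)
  by_cases hn : n ∈ X.supp
  · exact (not_not.1 (h n hn)).eq_of_tgt _ _
  · exact (not_not.1 hn).eq_of_src _ _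

theorem finite_sigma_fst (r : ℕ → ℕ) {s : Set ℕ} (hs : s.Finite) :
    {a : Σ n, Fin (r n) | a.1 ∈ s}.Finite :=
  hs.preimage' fun n _ => (Set.finite_range (Sigma.mk (β := fun n => Fin (r n)) n)).subset <| by
    rintro ⟨_, i⟩ rfl
    exact ⟨i, rfl⟩

/-- The model takes the entries of the images under the chosen equivalences in each degree. The last
clause ties dimensions in the model to `supp`, and so gives access to degrees. -/
theorem exists_linearModel (C : TwoVectGr.{u, v, w} k) :
    ∃ (r : ℕ → ℕ) (M : LinearModel k (Tot C) (Σ n, Fin (r n))), ∀ (X : Tot C) (n : ℕ),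
      (∀ i, Module.finrank k (M.V X ⟨n, i⟩) = 0) → Limits.IsZero (X.obj n) := by
  choose r E hE using fun n => (C n).exists_equivalence
  have hadd : ∀ n {X Y : (C n).carrier} (f g : X ⟶ Y) i, (E n).functor.map (f + g) i =
      (E n).functor.map f i + (E n).functor.map g i := fun n X Y f g i =>
    (hE n i).1.map_add (f := f) (g := g)
  have hsmul : ∀ n {X Y : (C n).carrier} (c : k) (f : X ⟶ Y) i, (E n).functor.map (c • f) i =
      c • (E n).functor.map f i := fun n X Y c f i =>
    have := (hE n i).1
    (hE n i).2.map_smul f c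
  have hzero : ∀ (X : Tot C) (n : ℕ),
      (∀ i, Module.finrank k ((E n).functor.obj (X.obj n) i) = 0) →
        Limits.IsZero (X.obj n) := by
    intro X n h
    rw [Limits.IsZero.iff_id_eq_zero]
    refine (E n).functor.map_injective (funext fun i => ?_)
    have := Module.finrank_zero_iff.1 (h i)
    ext x
    exact Subsingleton.elim (α := (E n).functor.obj (X.obj n) i) _ _
  refine ⟨r,
    { V := fun X a => (E a.1).functor.obj (X.obj a.1) a.2
      φ := fun {X Y} =>
        { toFun := fun f a => ((E a.1).functor.map (f a.1) a.2).hom.hom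
          map_add' := fun f g => funext fun a => by
            refine Eq.trans ?_ (congrArg (fun x => x.hom.hom) (hadd a.1 (f a.1) (g a.1) a.2))
            rfl
          map_smul' := fun c f => funext fun a => by
            refine Eq.trans ?_ (congrArg (fun x => x.hom.hom) (hsmul a.1 c (f a.1) a.2))
            rfl
          invFun := fun g n => (E n).functor.preimage fun i => FGModuleCat.ofHom (g ⟨n, i⟩)
          left_inv := fun f => funext fun n => (E n).functor.preimage_map (f n)
          right_inv := fun g => funext fun a => by
            dsimp only
            rw [Functor.map_preimage]
            rfl }
      φ_id := fun X a => by
        change ((E a.1).functor.map (𝟙 (X.obj a.1)) a.2).hom.hom = _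
        rw [CategoryTheory.Functor.map_id]
        rfl
      φ_comp := fun {X Y Z} f g a => by
        change ((E a.1).functor.map (f a.1 ≫ g a.1) a.2).hom.hom = _
        rw [Functor.map_comp]
        rfl
      finite_support := fun X => by
        refine (finite_sigma_fst r X.finite).subset fun a ha hz => ha ?_
        have h1 : (E a.1).functor.map (𝟙 (X.obj a.1)) a.2 =
            (E a.1).functor.map (0 : X.obj a.1 ⟶ X.obj a.1) a.2 :=
          congrFun (congrArg (E a.1).functor.map (hz.eq_of_src _ _)) a.2
        have h2 : (E a.1).functor.map (0 : X.obj a.1 ⟶ X.obj a.1) a.2 = 0 := by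
          have := hsmul a.1 (0 : k) (0 : X.obj a.1 ⟶ X.obj a.1) a.2
          rwa [zero_smul, zero_smul] at this
        rw [h2, CategoryTheory.Functor.map_id] at h1
        rw [Module.finrank_zero_iff]
        refine subsingleton_of_forall_eq 0 fun x => ?_
        exact congrArg (fun f => f.hom.hom x) h1
      exists_finrank_eq := fun d hd => by
        let W (n : ℕ) : Fin (r n) → FGModuleCat.{u} k :=
          fun i => FGModuleCat.of k (Fin (d ⟨n, i⟩) → k)
        have hW : ∀ n i, Module.finrank k ((E n).functor.obj ((E n).inverse.obj (W n)) i) =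
            d ⟨n, i⟩ := fun n i => by
          let e : (E n).functor.obj ((E n).inverse.obj (W n)) i ≅ W n i :=
            (Pi.eval _ i).mapIso ((E n).counitIso.app (W n))
          rw [(FGModuleCat.isoToLinearEquiv e).finrank_eq]
          simp [W]
        refine ⟨⟨fun n => (E n).inverse.obj (W n), ?_⟩, fun a => hW a.1 a.2⟩
        refine (hd.image Sigma.fst).subset fun n hn => ?_
        by_contra hn'
        refine hn ?_
        rw [Limits.IsZero.iff_id_eq_zero]
        refine (E n).functor.map_injective (funext fun i => ?_)
        have h0 : Module.finrank k ((E n).functor.obj ((E n).inverse.obj (W n)) i) = 0 := by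
          rw [hW]
          by_contra h
          exact hn' ⟨_, h, rfl⟩
        have := Module.finrank_zero_iff.1 h0
        ext x
        exact Subsingleton.elim (α := (E n).functor.obj ((E n).inverse.obj (W n)) i) _ _ }, ?_⟩
  exact hzero

/-- The model of a simple object vanishes outside its own index, hence outside one degree. This
turns bounds on degrees into finiteness of sets of simple objects. -/
theorem exists_simpleBasis (C : TwoVectGr.{u, v, w} k) :
    ∃ (r : ℕ → ℕ) (S : SimpleBasis k (Tot C) (Σ n, Fin (r n))), ∀ a, (S.e a).supp ⊆ {a.1} := by
  obtain ⟨r, M, hM⟩ := exists_linearModel C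
  refine ⟨r, M.simpleBasis, fun a n hn => ?_⟩
  by_contra h
  refine hn (hM _ n fun i => ?_)
  rw [Module.finrank_zero_iff]
  exact M.subsingleton_simple fun e => h (congrArg Sigma.fst e).symm

instance (X Y : Tot C) : Module.Finite k (X ⟶ Y) :=
  have ⟨_, S, _⟩ := exists_simpleBasis C
  S.finite_hom X Y

theorem exists_isZero (C : TwoVectGr.{u, v, w} k) : ∃ X : Tot C, X.supp = ∅ := by
  obtain ⟨r, M, hM⟩ := exists_linearModel C
  obtain ⟨X, hX⟩ := M.exists_finrank_eq (fun _ => 0) (by simp)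
  refine ⟨X, Set.eq_empty_of_forall_notMem fun n hn => hn (hM X n fun i => hX _)⟩

/-- The homogeneous part of an object. -/
theorem exists_homogeneous (X : Tot C) (n : ℕ) : ∃ (Y : Tot C) (i : Y ⟶ X) (p : X ⟶ Y),
    Y.supp ⊆ {n} ∧ (n ∈ X.supp → i ≠ 0 ∧ p ≠ 0) := by
  classical
  obtain ⟨Z, hZ⟩ := exists_isZero C
  have hZ' : ∀ m, Limits.IsZero (Z.obj m) := fun m => by
    have : m ∉ Z.supp := by simp [hZ]
    exact not_not.1 this
  let Y : Tot C := ⟨Function.update Z.obj n (X.obj n), by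
    refine (Set.finite_singleton n).subset fun m hm => ?_
    by_contra h
    rw [Set.mem_singleton_iff] at h
    simp only [Set.mem_ofPred_eq, Function.update_of_ne h] at hm
    exact hm (hZ' m)⟩
  have hY : Y.obj n = X.obj n := Function.update_self n _ _
  have hY' : ∀ m, m ≠ n → Limits.IsZero (Y.obj m) := fun m hm => by
    have : Y.obj m = Z.obj m := Function.update_of_ne hm _ _
    rw [this]
    exact hZ' m
  -- In degree `n` the objects agree only by a propositional equality, so the inclusion and the
  -- projection are casts there and zero elsewhere.
  refine ⟨Y, fun m => if h : m = n then eqToHom (by rw [h, hY]) else 0,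
    fun m => if h : m = n then eqToHom (by rw [h, hY]) else 0, fun m hm => ?_, fun hn => ⟨?_, ?_⟩⟩
  · by_contra h
    exact hm (hY' m h)
  all_goals
    intro h
    have h1 := congrFun h n
    simp only [dif_pos] at h1
    refine hn ((Limits.IsZero.iff_id_eq_zero _).2 ?_)
  · calc 𝟙 (X.obj n) = eqToHom hY.symm ≫ eqToHom hY := by simp
      _ = eqToHom hY.symm ≫ 0 := congrArg _ h1
      _ = 0 := Limits.comp_zero
  · calc 𝟙 (X.obj n) = eqToHom hY.symm ≫ eqToHom hY := by simp
      _ = 0 ≫ eqToHom hY := congrArg (· ≫ eqToHom hY) h1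
      _ = 0 := Limits.zero_comp

/-- A functor in one variable has bounded degree when, for some bound `B`, every nonvanishing degree
of `G X` differs by at most `B` from a nonvanishing degree of `X`. -/
def IsBoundedFunctor (G : Tot C ⥤ Tot D) : Prop :=
  ∃ B : ℕ, ∀ X, ∀ m ∈ (G.obj X).supp, ∃ n ∈ X.supp, |(m : ℤ) - n| ≤ B

theorem finite_abs_sub_le (s : Set ℕ) (hs : s.Finite) (B : ℕ) :
    {n : ℕ | ∃ m ∈ s, |(m : ℤ) - n| ≤ B}.Finite := by
  obtain ⟨b, hb⟩ := hs.bddAbove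
  refine (Set.finite_Iic (b + B)).subset ?_
  rintro n ⟨m, hm, h⟩
  have := hb hm
  rw [abs_le] at h
  simp only [Set.mem_Iic]
  omega

/-! ### Adjoints of functors of bounded degree -/

variable (G : Tot C ⥤ Tot D) [G.Additive]

/-- A nonzero map from `G (e a)` to `Y` needs a common degree, so the degree of `e a` is within `B`
of one of the finitely many degrees of `Y`. Each degree has finitely many simple objects, which
gives the finiteness required by `SimpleBasis.isLeftAdjoint`. -/
theorem isLeftAdjoint_of_isBounded [G.Linear k] (hG : IsBoundedFunctor G) : G.IsLeftAdjoint := by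
  obtain ⟨r, S, hS⟩ := exists_simpleBasis C
  obtain ⟨B, hB⟩ := hG
  refine S.isLeftAdjoint G fun Y => ?_
  refine (finite_sigma_fst r (finite_abs_sub_le Y.supp Y.finite B)).subset ?_
  rintro a ⟨f, hf⟩
  obtain ⟨m, h1, h2⟩ := mem_supp_of_ne_zero hf
  obtain ⟨n, h3, h4⟩ := hB _ m h1
  obtain rfl := hS a h3
  exact ⟨m, h2, h4⟩

theorem isRightAdjoint_of_isBounded [G.Linear k] (hG : IsBoundedFunctor G) : G.IsRightAdjoint := by
  obtain ⟨r, S, hS⟩ := exists_simpleBasis C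
  obtain ⟨B, hB⟩ := hG
  refine S.isRightAdjoint G fun Y => ?_
  refine (finite_sigma_fst r (finite_abs_sub_le Y.supp Y.finite B)).subset ?_
  rintro a ⟨f, hf⟩
  obtain ⟨m, h1, h2⟩ := mem_supp_of_ne_zero hf
  obtain ⟨n, h3, h4⟩ := hB _ m h2
  obtain rfl := hS a h3
  exact ⟨m, h1, h4⟩

variable {G} {R : Tot D ⥤ Tot C}

/-- The inclusion of a nonzero homogeneous part `Z` of `R Y` transposes to a nonzero map from `G Z`
to `Y`. Their common degree is within `B` of the degree of `Z`, so `R` has the same bound as `G`. -/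
theorem isBounded_rightAdjoint (adj : CategoryTheory.Adjunction G R) (hG : IsBoundedFunctor G) :
    IsBoundedFunctor R := by
  obtain ⟨B, hB⟩ := hG
  refine ⟨B, fun Y m hm => ?_⟩
  obtain ⟨Z, i, _, h1, h2⟩ := exists_homogeneous (R.obj Y) m
  have h3 : (adj.homEquiv Z Y).symm i ≠ 0 := fun h => (h2 hm).1 <| by
    rw [Equiv.symm_apply_eq] at h
    have := adj.right_adjoint_additive
    rw [h, Adjunction.homEquiv_unit, R.map_zero, Limits.comp_zero]
  obtain ⟨n, h4, h5⟩ := mem_supp_of_ne_zero h3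
  obtain ⟨m', h6, h7⟩ := hB _ n h4
  obtain rfl := h1 h6
  exact ⟨n, h5, abs_sub_comm (n : ℤ) m' ▸ h7⟩

/-- The same argument, with the projection to the homogeneous part in place of its inclusion. -/
theorem isBounded_leftAdjoint (adj : CategoryTheory.Adjunction R G) (hG : IsBoundedFunctor G) :
    IsBoundedFunctor R := by
  obtain ⟨B, hB⟩ := hG
  refine ⟨B, fun Y m hm => ?_⟩
  obtain ⟨Z, _, p, h1, h2⟩ := exists_homogeneous (R.obj Y) m
  have h3 : adj.homEquiv Y Z p ≠ 0 := fun h => (h2 hm).2 <| by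
    rw [← Equiv.eq_symm_apply] at h
    have := adj.left_adjoint_additive
    rw [h, Adjunction.homEquiv_counit, R.map_zero, Limits.zero_comp]
  obtain ⟨n, h4, h5⟩ := mem_supp_of_ne_zero h3
  obtain ⟨m', h6, h7⟩ := hB _ n h5
  obtain rfl := h1 h6
  exact ⟨n, h4, abs_sub_comm (n : ℤ) m' ▸ h7⟩

end Tot

/-! ### Linearity of adjoint functors -/

section AdjointLinear

variable {𝒯 𝒟 : Type*} [Category 𝒯] [Preadditive 𝒯] [Linear k 𝒯] [Category 𝒟] [Preadditive 𝒟]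
  [Linear k 𝒟] {F : 𝒯 ⥤ 𝒟} {G : 𝒟 ⥤ 𝒯}

theorem linear_rightAdjoint (adj : CategoryTheory.Adjunction F G) [F.Additive] [F.Linear k] :
    G.Linear k where
  map_smul {X Y} f c := (adj.homEquiv _ _).symm.injective <| by
    simp only [Adjunction.homEquiv_counit, Functor.map_smul, Linear.smul_comp,
      Adjunction.counit_naturality, Linear.comp_smul]

theorem linear_leftAdjoint (adj : CategoryTheory.Adjunction F G) [G.Additive] [G.Linear k] :
    F.Linear k where
  map_smul {X Y} f c := (adj.homEquiv _ _).injective <| by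
    simp only [Adjunction.homEquiv_unit, Functor.map_smul, Linear.smul_comp,
      Adjunction.unit_naturality, Linear.comp_smul]

end AdjointLinear
end SelfAdjointHopf

namespace SelfAdjointHopf
variable {k : Type u} [Field k]

/-! ### Functors in one variable -/

section OneVariable

variable {ι : Type} {C : ι → TwoVectGr.{u, v, w} k} {D : TwoVectGr.{u, v, w} k}

/-- For an index set with only one element, the identification of its factor with the product. -/
def fromPoint (C : ι → TwoVectGr.{u, v, w} k) (i₀ : ι) (h : ∀ i, i₀ = i) :
    Tot (C i₀) ⥤ ∀ i, Tot (C i) where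
  obj x i := h i ▸ x
  map {x y} f i := Eq.rec (motive := fun i h => (h ▸ x : Tot (C i)) ⟶ (h ▸ y : Tot (C i))) f (h i)
  map_id x := by
    funext i
    obtain rfl := h i
    rfl
  map_comp f g := by
    funext i
    obtain rfl := h i
    rfl

/-- An object of a product with only one factor is determined by its entry. -/
def evalFromPoint (C : ι → TwoVectGr.{u, v, w} k) (i₀ : ι) (h : ∀ i, i₀ = i) :
    Pi.eval (fun i => Tot (C i)) i₀ ⋙ fromPoint C i₀ h ≅ 𝟭 _ :=
  NatIso.ofComponents (fun X =>
    { hom := fun i =>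
        Eq.rec (motive := fun i h => (h ▸ X i₀ : Tot (C i)) ⟶ X i) (𝟙 (X i₀)) (h i)
      inv := fun i =>
        Eq.rec (motive := fun i h => X i ⟶ (h ▸ X i₀ : Tot (C i))) (𝟙 (X i₀)) (h i)
      hom_inv_id := by
        funext i
        obtain rfl := h i
        exact Category.id_comp (𝟙 (X i₀))
      inv_hom_id := by
        funext i
        obtain rfl := h i
        exact Category.id_comp (𝟙 (X i₀)) }) <| by
    intro X Y f
    funext i
    obtain rfl := h i
    exact (Category.comp_id (f i₀)).trans (Category.id_comp (f i₀)).symm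

/-- With only one entry, updating it replaces the whole family. Multilinearity in one variable
thereby becomes linearity of `MultiFun.unary`. -/
theorem fromPoint_map_eq_update [DecidableEq ι] (i₀ : ι) (h : ∀ i, i₀ = i) {x y : Tot (C i₀)}
    (m : ∀ i, (fromPoint C i₀ h).obj x i ⟶ (fromPoint C i₀ h).obj y i) (a : x ⟶ y) :
    (fromPoint C i₀ h).map a = Function.update m i₀ a := by
  funext i
  obtain rfl := h i
  exact (Function.update_self (f := m) i₀ a).symm

namespace MultiFun

/-- A functor in one variable, as a functor. -/
def unary (M : MultiFun C D) (i₀ : ι) (h : ∀ i, i₀ = i) : Tot (C i₀) ⥤ Tot D :=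
  fromPoint C i₀ h ⋙ M.functor

/-- A functor in one variable is recovered from `MultiFun.unary`. -/
def isoUnary (M : MultiFun C D) (i₀ : ι) (h : ∀ i, i₀ = i) :
    M.functor ≅ Pi.eval _ i₀ ⋙ M.unary i₀ h :=
  (Functor.isoWhiskerRight (evalFromPoint C i₀ h) M.functor).symm

instance (M : MultiFun C D) (i₀ : ι) (h : ∀ i, i₀ = i) : (M.unary i₀ h).Additive where
  map_add {X Y f g} := by
    classical
    obtain ⟨N, hN⟩ := M.multilinear ((fromPoint C i₀ h).obj X) ((fromPoint C i₀ h).obj Y)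
    have h1 := N.map_update_add 0 i₀ f g
    rw [hN, hN, hN] at h1
    change M.functor.map _ = M.functor.map _ + M.functor.map _
    rw [fromPoint_map_eq_update i₀ h 0 (f + g), fromPoint_map_eq_update i₀ h 0 f,
      fromPoint_map_eq_update i₀ h 0 g]
    exact h1

instance (M : MultiFun C D) (i₀ : ι) (h : ∀ i, i₀ = i) : (M.unary i₀ h).Linear k where
  map_smul {X Y} f c := by
    classical
    obtain ⟨N, hN⟩ := M.multilinear ((fromPoint C i₀ h).obj X) ((fromPoint C i₀ h).obj Y)
    have h1 := N.map_update_smul 0 i₀ c f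
    rw [hN, hN] at h1
    change M.functor.map _ = c • M.functor.map _
    rw [fromPoint_map_eq_update i₀ h 0 (c • f), fromPoint_map_eq_update i₀ h 0 f]
    exact h1

theorem finsum_point (i₀ : ι) (h : ∀ i, i₀ = i) (f : ι → ℤ) : ∑ᶠ i, f i = f i₀ := by
  let _ : Unique ι := ⟨⟨i₀⟩, fun i => (h i).symm⟩
  exact finsum_unique f

theorem isBounded_unary (M : MultiFun C D) (i₀ : ι) (h : ∀ i, i₀ = i) :
    Tot.IsBoundedFunctor (M.unary i₀ h) := by
  obtain ⟨B, hB⟩ := M.bounded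
  refine ⟨B, fun X m hm => ?_⟩
  obtain ⟨n, h1, h2⟩ := hB _ m hm
  rw [finsum_point i₀ h] at h2
  exact ⟨n i₀, h1 i₀, h2⟩

/-- A linear functor of bounded degree, as a functor in one variable. -/
def ofUnary (C : ι → TwoVectGr.{u, v, w} k) (i₀ : ι) (h : ∀ i, i₀ = i) (G : Tot (C i₀) ⥤ Tot D)
    (hadd : G.Additive) (hlin : G.Linear k) (hG : Tot.IsBoundedFunctor G) : MultiFun C D where
  functor := Pi.eval _ i₀ ⋙ G
  multilinear X Y := by
    refine ⟨⟨fun f => G.map (f i₀), ?_, ?_⟩, fun f => rfl⟩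
    · intro _ f i a b
      obtain rfl := h i
      simp only [Function.update_self]
      exact hadd.map_add
    · intro _ f i c a
      obtain rfl := h i
      simp only [Function.update_self]
      exact hlin.map_smul a c
  bounded := by
    obtain ⟨B, hB⟩ := hG
    refine ⟨B, fun X m hm => ?_⟩
    obtain ⟨n, h1, h2⟩ := hB _ m hm
    refine ⟨fun _ => n, fun i => ?_, ?_⟩
    · obtain rfl := h i
      exact h1
    · rwa [finsum_point i₀ h]

/-- The functor in no variables given by an object. -/
def ofIsEmpty (C : ι → TwoVectGr.{u, v, w} k) [IsEmpty ι] (X : Tot D) : MultiFun C D where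
  functor := (Functor.const _).obj X
  multilinear Y Z := ⟨MultilinearMap.constOfIsEmpty k _ (𝟙 X), fun f => rfl⟩
  bounded := by
    obtain ⟨B, hB⟩ := X.finite.bddAbove
    refine ⟨B, fun Y m hm => ⟨fun _ => 0, fun i => isEmptyElim i, ?_⟩⟩
    have h : m ≤ B := hB hm
    simpa using h

end MultiFun

end OneVariable

/-! ### Adjoints of 1-morphisms over bijections -/

section Zigzag

variable {𝒞 : Type*} [Bicategory 𝒞] {a b : 𝒞} {f : a ⟶ b} {g : b ⟶ a}

theorem leftZigzag_eq (η : 𝟙 a ⟶ f ≫ g) (κ : g ≫ f ⟶ 𝟙 b) :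
    leftZigzag η κ = η ▷ f ≫ (α_ _ _ _).hom ≫ f ◁ κ := by
  simp [leftZigzag, bicategoricalComp]

theorem rightZigzag_eq (η : 𝟙 a ⟶ f ≫ g) (κ : g ≫ f ⟶ 𝟙 b) :
    rightZigzag η κ = g ◁ η ≫ (α_ _ _ _).inv ≫ κ ▷ g := by
  simp [rightZigzag, bicategoricalComp]

end Zigzag

namespace TwoVectTensor

theorem whiskerLeft_app {A B C : TwoVectTensor.{u, v, w} k} (F : A ⟶ B) {G G' : B ⟶ C} (η : G ⟶ G')
    (l : C.base.Nonbase) (X : ∀ i : FinPt.Fiber (F ≫ G).base l, Tot (A.fam i.1)) :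
    ((F ◁ η).app l).app X = (η.app l).app fun j => (F.comp j.1).functor.obj fun i =>
      X ⟨i.1, (congrArg G.base.toFun i.2).trans j.2⟩ :=
  rfl

variable {A B : TwoVectTensor.{u, v, w} k} (f : A ⟶ B) (hf : Function.Bijective f.base.toFun)

/-- The bijection of elements other than the base point given by a 1-morphism over a bijection. -/
noncomputable def nonbaseEquiv : A.base.Nonbase ≃ B.base.Nonbase :=
  Equiv.ofBijective
    (fun i => ⟨f.base.toFun i.1, fun h => i.2 (hf.1 (h.trans f.base.map_pt.symm))⟩)
    ⟨fun i j h => Subtype.ext (hf.1 (congrArg Subtype.val h)), fun j => by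
      obtain ⟨i, hi⟩ := hf.2 j.1
      exact ⟨⟨i, fun h => j.2 (by rw [← hi, h, f.base.map_pt])⟩, Subtype.ext hi⟩⟩

/-- The inverse of the map of pointed sets underlying a 1-morphism over a bijection. -/
noncomputable def baseInv : B.base ⟶ A.base :=
  ⟨(Equiv.ofBijective _ hf).symm, by
    rw [Equiv.symm_apply_eq]
    exact f.base.map_pt.symm⟩

theorem baseInv_apply (i : A.base.carrier) : (baseInv f hf).toFun (f.base.toFun i) = i :=
  (Equiv.ofBijective _ hf).symm_apply_apply i

theorem base_comp_baseInv : f.base ≫ baseInv f hf = 𝟙 _ :=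
  FinPt.hom_ext fun i => baseInv_apply f hf i

theorem baseInv_comp_base : baseInv f hf ≫ f.base = 𝟙 _ :=
  FinPt.hom_ext fun i => (Equiv.ofBijective _ hf).apply_symm_apply i

/-- The element of the fibre of `f` over the image of `i`. -/
noncomputable abbrev fiberPt (i : A.base.Nonbase) : FinPt.Fiber f.base (nonbaseEquiv f hf i) := ⟨i, rfl⟩

theorem fiberPt_eq (i : A.base.Nonbase) (x : FinPt.Fiber f.base (nonbaseEquiv f hf i)) :
    fiberPt f hf i = x :=
  Subtype.ext (Subtype.ext (hf.1 x.2.symm))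

/-- The element of the fibre of the inverse of `f` over `i`. -/
noncomputable abbrev fiberInvPt (i : A.base.Nonbase) : FinPt.Fiber (baseInv f hf) i :=
  ⟨nonbaseEquiv f hf i, baseInv_apply f hf i.1⟩

theorem fiberInvPt_eq (i : A.base.Nonbase) (x : FinPt.Fiber (baseInv f hf) i) :
    fiberInvPt f hf i = x := by
  refine Subtype.ext (Subtype.ext ?_)
  refine (congrArg f.base.toFun x.2.symm).trans ?_
  exact (Equiv.ofBijective _ hf).apply_symm_apply x.1.1

/-- The component of `f` at the image of `i`, as a functor in one variable. -/
noncomputable abbrev unaryComp (i : A.base.Nonbase) :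
    Tot (A.fam i) ⥤ Tot (B.fam (nonbaseEquiv f hf i)) :=
  (f.comp (nonbaseEquiv f hf i)).unary (fiberPt f hf i) (fiberPt_eq f hf i)

/-- A 1-morphism over the inverse of a bijection, given by functors in one variable. -/
noncomputable def ofUnaryInv (R : ∀ i, Tot (B.fam (nonbaseEquiv f hf i)) ⥤ Tot (A.fam i))
    (h1 : ∀ i, (R i).Additive) (h2 : ∀ i, (R i).Linear k)
    (h3 : ∀ i, Tot.IsBoundedFunctor (R i)) : B ⟶ A :=
  Hom.mk (baseInv f hf) fun i =>
    MultiFun.ofUnary (fun j : FinPt.Fiber (baseInv f hf) i => B.fam j.1) (fiberInvPt f hf i)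
      (fiberInvPt_eq f hf i) (R i) (h1 i) (h2 i) (h3 i)

/-- A 1-morphism over a bijection has a right adjoint. -/
theorem exists_rightAdjoint {A B : TwoVectTensor.{u, v, w} k} (f : A ⟶ B)
    (hf : Function.Bijective f.base.toFun) :
    ∃ r : B ⟶ A, Nonempty (Bicategory.Adjunction f r) := by
  have : ∀ i, (unaryComp f hf i).IsLeftAdjoint := fun i =>
    Tot.isLeftAdjoint_of_isBounded _ (MultiFun.isBounded_unary _ _ _)
  choose R hR using fun i => (this i).exists_rightAdjoint
  let adj (i) : CategoryTheory.Adjunction (unaryComp f hf i) (R i) := (hR i).some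
  -- A component of `f` takes a family over a one-point fibre, which is only isomorphic to the
  -- family rebuilt from its entry. The unit and the counit of the functor adjunctions have to be
  -- corrected by this isomorphism.
  let E (i) := evalFromPoint (fun j : FinPt.Fiber f.base (nonbaseEquiv f hf i) => A.fam j.1)
    (fiberPt f hf i) (fiberPt_eq f hf i)
  let φ (i) := (f.comp (nonbaseEquiv f hf i)).functor
  let r : B ⟶ A := ofUnaryInv f hf R (fun i => (adj i).right_adjoint_additive)
    (fun i => linear_rightAdjoint (adj i))
    (fun i => Tot.isBounded_rightAdjoint (adj i) (MultiFun.isBounded_unary _ _ _))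
  let unit : 𝟙 A ⟶ f ≫ r := Hom₂.mk (F := 𝟙 A) (G := f ≫ r) (base_comp_baseInv f hf).symm fun i =>
    { app := fun X => (adj i).unit.app (X ⟨i, rfl⟩) ≫
        (R i).map ((φ i).map ((E i).hom.app fun j => X ⟨j.1, hf.1 j.2⟩))
      naturality := fun X Y a => by
        have h1 := (adj i).unit.naturality (a ⟨i, rfl⟩)
        have h2 := congrArg (fun x => (R i).map ((φ i).map x))
          ((E i).hom.naturality (X := fun j => X ⟨j.1, hf.1 j.2⟩)
            (Y := fun j => Y ⟨j.1, hf.1 j.2⟩) (fun j => a ⟨j.1, hf.1 j.2⟩))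
        simp only [Functor.map_comp] at h2
        refine ((Category.assoc _ _ _).symm.trans (congrArg (· ≫ _) h1)).trans
          ((Category.assoc _ _ _).trans ((congrArg (_ ≫ ·) h2).trans ?_))
        exact (Category.assoc _ _ _).symm }
  let κ (i) : ((r ≫ f).comp (nonbaseEquiv f hf i)).functor ⟶
      reindex B (baseInv_comp_base f hf) _ ⋙ ((𝟙 B : B ⟶ B).comp _).functor :=
    { app := fun Y => (φ i).map ((E i).inv.app fun j =>
        (r.comp j.1).functor.obj fun l => Y ⟨l.1, (congrArg f.base.toFun l.2).trans j.2⟩) ≫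
          (adj i).counit.app (Y ⟨nonbaseEquiv f hf i,
            congrArg f.base.toFun (baseInv_apply f hf i.1)⟩)
      naturality := fun X Y a => by
        have h1 := (adj i).counit.naturality (a ⟨nonbaseEquiv f hf i,
            congrArg f.base.toFun (baseInv_apply f hf i.1)⟩)
        have h2 := congrArg (fun x => (φ i).map x) ((E i).inv.naturality
          (X := fun j => (r.comp j.1).functor.obj fun l =>
            X ⟨l.1, (congrArg f.base.toFun l.2).trans j.2⟩)
          (Y := fun j => (r.comp j.1).functor.obj fun l =>
            Y ⟨l.1, (congrArg f.base.toFun l.2).trans j.2⟩)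
          (fun j => (r.comp j.1).functor.map fun l =>
            a ⟨l.1, (congrArg f.base.toFun l.2).trans j.2⟩))
        simp only [Functor.map_comp] at h2
        refine ((Category.assoc _ _ _).symm.trans (congrArg (· ≫ _) h2)).trans
          ((Category.assoc _ _ _).trans ((congrArg (_ ≫ ·) h1).trans ?_))
        exact (Category.assoc _ _ _).symm }
  -- The family `κ` is indexed by the source; `piCongrLeft` transports it along the bijection to the
  -- elements of the base of `B`.
  let counit : r ≫ f ⟶ 𝟙 B := Hom₂.mk (F := r ≫ f) (G := 𝟙 B) (baseInv_comp_base f hf) <|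
    Equiv.piCongrLeft (fun j => ((r ≫ f).comp j).functor ⟶
      reindex B (baseInv_comp_base f hf) j ⋙ ((𝟙 B : B ⟶ B).comp j).functor)
      (nonbaseEquiv f hf) κ
  have hcounit : ∀ i, counit.app (nonbaseEquiv f hf i) = κ i := fun i =>
    Equiv.piCongrLeft_apply_apply (fun j => ((r ≫ f).comp j).functor ⟶
      reindex B (baseInv_comp_base f hf) j ⋙ ((𝟙 B : B ⟶ B).comp j).functor)
      (nonbaseEquiv f hf) κ i
  refine ⟨r, ⟨⟨unit, counit, ?_, ?_⟩⟩⟩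
  · rw [leftZigzag_eq]
    ext j X : 2
    obtain ⟨i, rfl⟩ := (nonbaseEquiv f hf).surjective j
    let X' : ∀ j : FinPt.Fiber f.base (nonbaseEquiv f hf i), Tot (A.fam j.1) :=
      fun j => X ⟨j.1, j.2⟩
    have h1 := congrArg (fun x => (φ i).map x) ((E i).inv.naturality (X := X')
      (Y := fun j => (r.comp j.1).functor.obj fun l => (f.comp l.1).functor.obj fun m =>
        X ⟨m.1, m.2.trans ((fiberInvPt_eq f hf j.1 l) ▸ j.2)⟩)
      (fun j => (unit.app j.1).app fun m => X ⟨m.1, (congrArg f.base.toFun m.2).trans j.2⟩))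
    simp only [Functor.map_comp] at h1
    have h2 := (adj i).counit.naturality ((φ i).map ((E i).hom.app X'))
    have h3 := (adj i).left_triangle_components (X' (fiberPt f hf i))
    have h4 : (φ i).map ((E i).inv.app X') ≫ (φ i).map ((E i).hom.app X') = 𝟙 _ := by
      rw [← Functor.map_comp, Iso.inv_hom_id_app]
      exact (φ i).map_id _
    refine (congrArg (_ ≫ ·) (Category.id_comp _)).trans (Eq.trans ?_ (Category.id_comp _).symm)
    rw [whiskerLeft_app, hcounit]
    refine (Category.assoc _ _ _).symm.trans ((congrArg (· ≫ _) h1).trans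
      ((Category.assoc _ _ _).trans ((congrArg (_ ≫ ·) ?_).trans h4)))
    change (unaryComp f hf i).map ((adj i).unit.app (X ⟨i, _⟩) ≫
      (R i).map ((φ i).map ((E i).hom.app X'))) ≫ _ = _
    rw [Functor.map_comp]
    refine (Category.assoc _ _ _).trans ((congrArg (_ ≫ ·) h2).trans
      ((Category.assoc _ _ _).symm.trans ((congrArg (· ≫ _) h3).trans (Category.id_comp _))))
  · rw [rightZigzag_eq]
    ext i Y : 2
    let Y' : ∀ j : FinPt.Fiber f.base (nonbaseEquiv f hf i), Tot (A.fam j.1) := fun j =>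
      (r.comp j.1).functor.obj fun l => Y ⟨l.1, l.2.trans (hf.1 j.2)⟩
    have h1 : (R i).map ((φ i).map ((E i).hom.app Y')) ≫
        (R i).map ((φ i).map ((E i).inv.app Y')) = 𝟙 _ := by
      rw [← Functor.map_comp, ← Functor.map_comp, Iso.hom_inv_id_app]
      exact (congrArg _ ((φ i).map_id _)).trans ((R i).map_id _)
    have h2 := (adj i).right_triangle_components (Y (fiberInvPt f hf i))
    refine (congrArg (_ ≫ ·) (Category.id_comp _)).trans (Eq.trans ?_ (Category.id_comp _).symm)
    have h3 : ∀ Z, ((counit ▷ r).app i).app Z =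
        (R i).map ((κ i).app fun l => Z ⟨l.1, (congrArg (baseInv f hf).toFun l.2).trans
          (baseInv_apply f hf i.1)⟩) := by
      intro Z
      rw [← hcounit]
      rfl
    refine (congrArg (_ ≫ ·) (h3 _)).trans ?_
    refine (congrArg (_ ≫ ·) ((R i).map_comp _ _)).trans ?_
    refine (Category.assoc _ _ _).trans ((congrArg (_ ≫ ·) ((Category.assoc _ _ _).symm.trans
      ((congrArg (· ≫ _) h1).trans (Category.id_comp _)))).trans h2)

/-- A 1-morphism over a bijection has a left adjoint. -/
theorem exists_leftAdjoint {A B : TwoVectTensor.{u, v, w} k} (f : A ⟶ B)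
    (hf : Function.Bijective f.base.toFun) :
    ∃ l : B ⟶ A, Nonempty (Bicategory.Adjunction l f) := by
  have : ∀ i, (unaryComp f hf i).IsRightAdjoint := fun i =>
    Tot.isRightAdjoint_of_isBounded _ (MultiFun.isBounded_unary _ _ _)
  choose L hL using fun i => (this i).exists_leftAdjoint
  let adj (i) : CategoryTheory.Adjunction (L i) (unaryComp f hf i) := (hL i).some
  let E (i) := evalFromPoint (fun j : FinPt.Fiber f.base (nonbaseEquiv f hf i) => A.fam j.1)
    (fiberPt f hf i) (fiberPt_eq f hf i)
  let φ (i) := (f.comp (nonbaseEquiv f hf i)).functor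
  let l : B ⟶ A := ofUnaryInv f hf L (fun i => (adj i).left_adjoint_additive)
    (fun i => linear_leftAdjoint (adj i))
    (fun i => Tot.isBounded_leftAdjoint (adj i) (MultiFun.isBounded_unary _ _ _))
  let counit : f ≫ l ⟶ 𝟙 A := Hom₂.mk (F := f ≫ l) (G := 𝟙 A) (base_comp_baseInv f hf) fun i =>
    { app := fun X => (L i).map ((φ i).map ((E i).inv.app fun j =>
        X ⟨j.1, (congrArg (baseInv f hf).toFun j.2).trans (baseInv_apply f hf i.1)⟩)) ≫
          (adj i).counit.app (X ⟨i, baseInv_apply f hf i.1⟩)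
      naturality := fun X Y a => by
        have h1 := (adj i).counit.naturality (a ⟨i, baseInv_apply f hf i.1⟩)
        have h2 := congrArg (fun x => (L i).map ((φ i).map x)) ((E i).inv.naturality
          (X := fun j => X ⟨j.1, (congrArg (baseInv f hf).toFun j.2).trans
            (baseInv_apply f hf i.1)⟩)
          (Y := fun j => Y ⟨j.1, (congrArg (baseInv f hf).toFun j.2).trans
            (baseInv_apply f hf i.1)⟩)
          (fun j => a ⟨j.1, (congrArg (baseInv f hf).toFun j.2).trans (baseInv_apply f hf i.1)⟩))
        simp only [Functor.map_comp] at h2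
        refine ((Category.assoc _ _ _).symm.trans (congrArg (· ≫ _) h2)).trans
          ((Category.assoc _ _ _).trans ((congrArg (_ ≫ ·) h1).trans ?_))
        exact (Category.assoc _ _ _).symm }
  have hfib : ∀ {i} (j : FinPt.Fiber f.base (nonbaseEquiv f hf i))
      (m : FinPt.Fiber (baseInv f hf) j.1), m.1.1 = (nonbaseEquiv f hf i).1 := fun j m => by
    rw [← fiberInvPt_eq f hf j.1 m]
    exact j.2
  let κ (i) : ((𝟙 B : B ⟶ B).comp (nonbaseEquiv f hf i)).functor ⟶
      reindex B (baseInv_comp_base f hf).symm _ ⋙ ((l ≫ f).comp (nonbaseEquiv f hf i)).functor :=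
    { app := fun Y => (adj i).unit.app (Y ⟨nonbaseEquiv f hf i, rfl⟩) ≫
        (φ i).map ((E i).hom.app fun j => (l.comp j.1).functor.obj fun m => Y ⟨m.1, hfib j m⟩)
      naturality := fun X Y a => by
        have h1 := (adj i).unit.naturality (a ⟨nonbaseEquiv f hf i, rfl⟩)
        have h2 := congrArg (fun x => (φ i).map x) ((E i).hom.naturality
          (X := fun j => (l.comp j.1).functor.obj fun m => X ⟨m.1, hfib j m⟩)
          (Y := fun j => (l.comp j.1).functor.obj fun m => Y ⟨m.1, hfib j m⟩)
          (fun j => (l.comp j.1).functor.map fun m => a ⟨m.1, hfib j m⟩))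
        simp only [Functor.map_comp] at h2
        refine ((Category.assoc _ _ _).symm.trans (congrArg (· ≫ _) h1)).trans
          ((Category.assoc _ _ _).trans ((congrArg (_ ≫ ·) h2).trans ?_))
        exact (Category.assoc _ _ _).symm }
  let unit : 𝟙 B ⟶ l ≫ f := Hom₂.mk (F := 𝟙 B) (G := l ≫ f) (baseInv_comp_base f hf).symm <|
    Equiv.piCongrLeft (fun j => ((𝟙 B : B ⟶ B).comp j).functor ⟶
      reindex B (baseInv_comp_base f hf).symm j ⋙ ((l ≫ f).comp j).functor)
      (nonbaseEquiv f hf) κ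
  have hunit : ∀ i, unit.app (nonbaseEquiv f hf i) = κ i := fun i =>
    Equiv.piCongrLeft_apply_apply (fun j => ((𝟙 B : B ⟶ B).comp j).functor ⟶
      reindex B (baseInv_comp_base f hf).symm j ⋙ ((l ≫ f).comp j).functor)
      (nonbaseEquiv f hf) κ i
  refine ⟨l, ⟨⟨unit, counit, ?_, ?_⟩⟩⟩
  · rw [leftZigzag_eq]
    ext i Y : 2
    let Y' : ∀ j : FinPt.Fiber f.base (nonbaseEquiv f hf i), Tot (A.fam j.1) := fun j =>
      (l.comp j.1).functor.obj fun m => Y ⟨m.1, m.2.trans (hf.1 j.2)⟩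
    have h1 : (L i).map ((φ i).map ((E i).hom.app Y')) ≫
        (L i).map ((φ i).map ((E i).inv.app Y')) = 𝟙 _ := by
      rw [← Functor.map_comp, ← Functor.map_comp, Iso.hom_inv_id_app]
      exact (congrArg _ ((φ i).map_id _)).trans ((L i).map_id _)
    have h2 := (adj i).left_triangle_components (Y (fiberInvPt f hf i))
    refine (congrArg (_ ≫ ·) (Category.id_comp _)).trans (Eq.trans ?_ (Category.id_comp _).symm)
    have h3 : ((unit ▷ l).app i).app Y = (L i).map ((κ i).app fun m =>
        Y ⟨m.1, (congrArg (baseInv f hf).toFun m.2).trans (baseInv_apply f hf i.1)⟩) := by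
      rw [← hunit]
      rfl
    refine (congrArg (· ≫ _) (h3.trans ((L i).map_comp _ _))).trans ?_
    refine (Category.assoc _ _ _).trans ((congrArg (_ ≫ ·) ((Category.assoc _ _ _).symm.trans
      ((congrArg (· ≫ _) h1).trans (Category.id_comp _)))).trans h2)
  · rw [rightZigzag_eq]
    ext j X : 2
    obtain ⟨i, rfl⟩ := (nonbaseEquiv f hf).surjective j
    let X' : ∀ j : FinPt.Fiber f.base (nonbaseEquiv f hf i), Tot (A.fam j.1) :=
      fun j => X ⟨j.1, j.2⟩
    have hX : ∀ (j : FinPt.Fiber f.base (nonbaseEquiv f hf i)) (m : FinPt.Fiber (f ≫ l).base j.1),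
        (f ≫ 𝟙 B).base.toFun m.1.1 = (nonbaseEquiv f hf i).1 := fun j m =>
      (congrArg f.base.toFun ((baseInv_apply f hf m.1.1).symm.trans m.2)).trans j.2
    have h1 := congrArg (fun x => (φ i).map x) ((E i).hom.naturality
      (X := fun j => ((f ≫ l).comp j.1).functor.obj fun m => X ⟨m.1, hX j m⟩)
      (Y := X') (fun j => (counit.app j.1).app fun m => X ⟨m.1, hX j m⟩))
    simp only [Functor.map_comp] at h1
    have h2 := (adj i).unit.naturality ((φ i).map ((E i).inv.app X'))
    have h3 := (adj i).right_triangle_components (X' (fiberPt f hf i))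
    have h4 : (φ i).map ((E i).inv.app X') ≫ (φ i).map ((E i).hom.app X') = 𝟙 _ := by
      rw [← Functor.map_comp, Iso.inv_hom_id_app]
      exact (φ i).map_id _
    refine (congrArg (_ ≫ ·) (Category.id_comp _)).trans (Eq.trans ?_ (Category.id_comp _).symm)
    rw [whiskerLeft_app, hunit]
    refine (Category.assoc _ _ _).trans ?_
    refine (congrArg (_ ≫ ·) h1.symm).trans ?_
    refine (Category.assoc _ _ _).symm.trans (Eq.trans (congrArg (· ≫ _) ?_) h4)
    refine (congrArg (_ ≫ ·) ((unaryComp f hf i).map_comp _ _)).trans ?_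
    refine (Category.assoc _ _ _).symm.trans ((congrArg (· ≫ _) h2.symm).trans
      ((Category.assoc _ _ _).trans ((congrArg (_ ≫ ·) h3).trans (Category.comp_id _))))

end TwoVectTensor
end SelfAdjointHopf

namespace SelfAdjointHopf
variable {k : Type u} [Field k]

namespace TwoVectTensor

/-! ### Consequences of the universal property of coCartesian 1-morphisms -/

section CoCartesian

variable {A B : TwoVectTensor.{u, v, w} k} {F : A ⟶ B}

/-- Whiskering with a coCartesian 1-morphism over a surjection is bijective on 2-morphisms. -/
theorem IsCoCartesian.whiskerLeft_bijective (hF : IsCoCartesian F)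
    (hs : Function.Surjective F.base.toFun) {Z : TwoVectTensor.{u, v, w} k} (G G' : B ⟶ Z) :
    Function.Bijective fun α : G ⟶ G' => F ◁ α := by
  have := hF Z
  refine ⟨fun α β h => (comparison F Z).map_injective ?_, fun θ => ?_⟩
  · exact Limits.CategoricalPullback.hom_ext h (Subsingleton.elim _ _)
  · have h : G.base = G'.base := FinPt.hom_ext fun j => by
      obtain ⟨i, rfl⟩ := hs j
      exact congrArg (fun φ => φ.toFun i) θ.base_eq
    let θ' : (comparison F Z).obj G ⟶ (comparison F Z).obj G' :=
      ⟨θ, Discrete.eqToHom h, Subsingleton.elim _ _⟩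
    obtain ⟨α, hα⟩ := (comparison F Z).map_surjective θ'
    exact ⟨α, congrArg Limits.CategoricalPullback.Hom.fst hα⟩

theorem IsCoCartesian.exists_iso_of_whiskerLeft (hF : IsCoCartesian F)
    (hs : Function.Surjective F.base.toFun) {Z : TwoVectTensor.{u, v, w} k} {G G' : B ⟶ Z}
    (e : F ≫ G ≅ F ≫ G') : Nonempty (G ≅ G') := by
  obtain ⟨α, hα⟩ := (hF.whiskerLeft_bijective hs G G').2 e.hom
  obtain ⟨β, hβ⟩ := (hF.whiskerLeft_bijective hs G' G).2 e.inv
  refine ⟨⟨α, β, (hF.whiskerLeft_bijective hs G G).1 ?_, (hF.whiskerLeft_bijective hs G' G').1 ?_⟩⟩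
  all_goals
    dsimp only at hα hβ ⊢
    rw [whiskerLeft_comp, hα, hβ, whiskerLeft_id]
    simp

/-- Essential surjectivity of `comparison`. Since maps of pointed sets form a discrete category, the
factorization lies over `ψ` strictly. -/
theorem IsCoCartesian.exists_factorization (hF : IsCoCartesian F)
    {Z : TwoVectTensor.{u, v, w} k} (G : A ⟶ Z) (ψ : B.base ⟶ Z.base)
    (h : G.base = F.base ≫ ψ) : ∃ P : B ⟶ Z, P.base = ψ ∧ Nonempty (F ≫ P ≅ G) := by
  have := hF Z
  let Y : Limits.CategoricalPullback (projHom A Z) (precompBase F.base Z.base) :=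
    ⟨G, ⟨ψ⟩, Discrete.eqToIso h⟩
  let e := (comparison F Z).objObjPreimageIso Y
  exact ⟨_, Discrete.eq_of_hom ((Limits.CategoricalPullback.π₂ _ _).map e.hom),
    ⟨(Limits.CategoricalPullback.π₁ _ _).mapIso e⟩⟩

/-- A square formed by coCartesian 1-morphisms over surjections and two right adjoints has an
invertible left mate. -/
theorem isIso_leftMate_of_isCoCartesian {A B C D : TwoVectTensor.{u, v, w} k} {L : A ⟶ B} {R : B ⟶ A}
    (adj : Bicategory.Adjunction L R) {L' : C ⟶ D} {R' : D ⟶ C} (adj' : Bicategory.Adjunction L' R')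
    {q : A ⟶ C} {p : B ⟶ D} (σ : R ≫ q ⟶ p ≫ R') [IsIso σ]
    (hq : IsCoCartesian q) (hq' : Function.Surjective q.base.toFun)
    (hp : IsCoCartesian p) (hp' : Function.Surjective p.base.toFun) :
    IsIso ((Bicategory.mateEquiv adj adj').symm σ) := by
  -- That `L ≫ p` lies over a map factoring through `q.base` is read off from the left mate itself,
  -- as 2-morphisms exist only over equal maps.
  obtain ⟨P, -, ⟨θ⟩⟩ := hq.exists_factorization (L ≫ p) L'.base
    ((Bicategory.mateEquiv adj adj').symm σ).base_eq.symm
  exact isIso_leftMate adj adj' σ (hq.whiskerLeft_bijective hq') (hp.whiskerLeft_bijective hp') P θ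

end CoCartesian

/-! ### Components of compositions and of isomorphisms -/

section Components

variable {A B C : TwoVectTensor.{u, v, w} k}

/-- The components of an isomorphism of 1-morphisms. -/
def isoApp {F G : A ⟶ B} (e : F ≅ G) (j : B.base.Nonbase) :
    (F.comp j).functor ≅ reindex A e.hom.base_eq j ⋙ (G.comp j).functor :=
  NatIso.ofComponents (fun X =>
    { hom := (e.hom.app j).app X
      inv := (e.inv.app j).app ((reindex A e.hom.base_eq j).obj X)
      hom_inv_id :=
        congrArg (fun α : Hom₂ F F => show (F.comp j).functor.obj X ⟶ (F.comp j).functor.obj X from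
          (α.app j).app X) e.hom_inv_id
      inv_hom_id :=
        let Y := (reindex A e.hom.base_eq j).obj X
        congrArg (fun α : Hom₂ G G => show (G.comp j).functor.obj Y ⟶ (G.comp j).functor.obj Y from
          (α.app j).app Y) e.inv_hom_id }) fun f => (e.hom.app j).naturality f

/-- Isomorphic 1-morphisms have isomorphic components in one variable. -/
def unaryIsoOfIso {F G : A ⟶ B} (e : F ≅ G) (j : B.base.Nonbase) (i : A.base.Nonbase)
    (hi : F.base.toFun i.1 = j.1) (hi' : G.base.toFun i.1 = j.1)
    (h : ∀ x : FinPt.Fiber F.base j, ⟨i, hi⟩ = x) (h' : ∀ x : FinPt.Fiber G.base j, ⟨i, hi'⟩ = x) :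
    (F.comp j).unary ⟨i, hi⟩ h ≅ (G.comp j).unary ⟨i, hi'⟩ h' :=
  Functor.isoWhiskerLeft (fromPoint _ _ h) (isoApp e j) ≪≫
    Functor.isoWhiskerLeft (fromPoint _ _ h ⋙ reindex A e.hom.base_eq j)
      ((G.comp j).isoUnary ⟨i, hi'⟩ h')

/-- The product of the components of `F` which is substituted into a component of `G`. -/
def compInner (F : A ⟶ B) (G : B ⟶ C) (l : C.base.Nonbase) :
    (∀ i : FinPt.Fiber (F ≫ G).base l, Tot (A.fam i.1)) ⥤
      ∀ j : FinPt.Fiber G.base l, Tot (B.fam j.1) where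
  obj X j := (F.comp j.1).functor.obj fun i => X ⟨i.1, (congrArg G.base.toFun i.2).trans j.2⟩
  map f j := (F.comp j.1).functor.map fun i => f ⟨i.1, (congrArg G.base.toFun i.2).trans j.2⟩
  map_id _ := funext fun j => (F.comp j.1).functor.map_id _
  map_comp _ _ := funext fun j => (F.comp j.1).functor.map_comp _ _

/-- The restriction from the fibre of a composition to a fibre of the first map. -/
def restrict (F : A ⟶ B) (G : B ⟶ C) (l : C.base.Nonbase) (j : FinPt.Fiber G.base l) :
    (∀ i : FinPt.Fiber (F ≫ G).base l, Tot (A.fam i.1)) ⥤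
      ∀ i : FinPt.Fiber F.base j.1, Tot (A.fam i.1) where
  obj X i := X ⟨i.1, (congrArg G.base.toFun i.2).trans j.2⟩
  map f i := f ⟨i.1, (congrArg G.base.toFun i.2).trans j.2⟩

/-- A component of a composition, if the component of the second 1-morphism has one variable. -/
def compIso (F : A ⟶ B) (G : B ⟶ C) (l : C.base.Nonbase) (j : FinPt.Fiber G.base l)
    (h : ∀ x, j = x) :
    ((F ≫ G).comp l).functor ≅
      restrict F G l j ⋙ (F.comp j.1).functor ⋙ (G.comp l).unary j h :=
  Functor.isoWhiskerLeft (compInner F G l) ((G.comp l).isoUnary j h)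

/-- The components in one variable of a composition. -/
def compUnaryIso (F : A ⟶ B) (G : B ⟶ C) (l : C.base.Nonbase) (j : FinPt.Fiber G.base l)
    (h : ∀ x, j = x) (i : FinPt.Fiber F.base j.1) (h' : ∀ x, i = x)
    (hi : (F ≫ G).base.toFun i.1.1 = l.1) (h'' : ∀ x : FinPt.Fiber (F ≫ G).base l, ⟨i.1, hi⟩ = x) :
    ((F ≫ G).comp l).unary ⟨i.1, hi⟩ h'' ≅ (F.comp j.1).unary i h' ⋙ (G.comp l).unary j h :=
  Functor.isoWhiskerLeft (fromPoint _ _ h'') (compIso F G l j h) ≪≫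
    Functor.isoWhiskerLeft (fromPoint _ _ h'' ⋙ restrict F G l j)
      (Functor.isoWhiskerRight ((F.comp j.1).isoUnary i h') ((G.comp l).unary j h))

end Components

/-! ### Inert 1-morphisms -/

/-- A map of pointed sets is inert if it is bijective over the complement of the base point. -/
structure Inert {A X : TwoVectTensor.{u, v, w} k} (p : A ⟶ X) where
  sec : X.base.Nonbase → A.base.Nonbase
  fiber : ∀ l, p.base.toFun (sec l).1 = l.1
  unique : ∀ l (x : FinPt.Fiber p.base l), ⟨sec l, fiber l⟩ = x

namespace Inert

variable {A X : TwoVectTensor.{u, v, w} k} {p : A ⟶ X} (I : Inert p)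

theorem surjective (I : Inert p) : Function.Surjective p.base.toFun := fun x => by
  by_cases h : x = X.base.pt
  · exact ⟨A.base.pt, h ▸ p.base.map_pt⟩
  · exact ⟨(I.sec ⟨x, h⟩).1, I.fiber ⟨x, h⟩⟩

/-- The components of a 1-morphism over an inert map, as functors in one variable. -/
def unaryComp (l : X.base.Nonbase) : Tot (A.fam (I.sec l)) ⥤ Tot (X.fam l) :=
  (p.comp l).unary ⟨I.sec l, I.fiber l⟩ (I.unique l)

/-- The list `Z` of surviving entries of `A` receives a projection `π`, and `π` factors as `p ≫ G`
with `G` over the identity. The components of `p` form `Q : Z ⟶ X` with `π ≫ Q ≅ p`, so `p ≫ G ≫ Q ≅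
p`, and cancelling `p` gives `G ≫ Q ≅ 𝟙`. Thus the components of `G` and `p` are mutually inverse.
-/
theorem exists_inverse (hp : IsCoCartesian p) (l : X.base.Nonbase) :
    ∃ G : Tot (X.fam l) ⥤ Tot (A.fam (I.sec l)), G.Additive ∧ G.Linear k ∧
      Tot.IsBoundedFunctor G ∧ Nonempty (I.unaryComp l ⋙ G ≅ 𝟭 _) ∧
      Nonempty (G ⋙ I.unaryComp l ≅ 𝟭 _) := by
  let Z : TwoVectTensor.{u, v, w} k := ⟨X.base, fun l => A.fam (I.sec l)⟩
  let π : A ⟶ Z := Hom.mk (B := Z) p.base fun l =>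
    MultiFun.ofUnary (fun i : FinPt.Fiber p.base l => A.fam i.1) ⟨I.sec l, I.fiber l⟩ (I.unique l)
      (𝟭 _) inferInstance inferInstance ⟨0, fun X m hm => ⟨m, hm, by simp⟩⟩
  let Q : Z ⟶ X := Hom.mk (A := Z) (𝟙 X.base) fun l =>
    MultiFun.ofUnary (fun i : FinPt.Fiber (𝟙 X.base) l => Z.fam i.1) ⟨l, rfl⟩
      (fun x => (fiber_id_eq x).symm) (I.unaryComp l)
      (inferInstanceAs ((p.comp l).unary _ _).Additive)
      (inferInstanceAs (((p.comp l).unary _ _).Linear k)) (MultiFun.isBounded_unary _ _ _)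
  obtain ⟨G, hG, ⟨θ⟩⟩ := hp.exists_factorization π (𝟙 X.base) rfl
  let χ : π ≫ Q ≅ p := isoMk (F := π ≫ Q) (G := p) rfl fun l =>
    ((p.comp l).isoUnary ⟨I.sec l, I.fiber l⟩ (I.unique l)).symm
  obtain ⟨ω⟩ := hp.exists_iso_of_whiskerLeft I.surjective (G := G ≫ Q) (G' := 𝟙 X)
    ((α_ _ _ _).symm ≪≫ whiskerRightIso θ Q ≪≫ χ ≪≫ (ρ_ p).symm)
  have hG' : ∀ a, G.base.toFun a = a := fun a => by
    rw [hG]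
    rfl
  have hl : G.base.toFun l.1 = l.1 := hG' l.1
  have hl' : ∀ x : FinPt.Fiber G.base l, ⟨l, hl⟩ = x := fun x =>
    Subtype.ext (Subtype.ext (x.2.symm.trans (hG' x.1.1)))
  let G' : Tot (X.fam l) ⥤ Tot (A.fam (I.sec l)) := (G.comp l).unary ⟨l, hl⟩ hl'
  refine ⟨G', inferInstanceAs ((G.comp l).unary _ _).Additive,
    inferInstanceAs (((G.comp l).unary _ _).Linear k), MultiFun.isBounded_unary _ _ _, ⟨?_⟩, ⟨?_⟩⟩
  · have h1 : (p ≫ G).base.toFun (I.sec l).1 = l.1 := (congrArg G.base.toFun (I.fiber l)).trans hl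
    have h2 : ∀ x : FinPt.Fiber (p ≫ G).base l, ⟨I.sec l, h1⟩ = x := fun x =>
      Subtype.ext (congrArg (fun y : FinPt.Fiber p.base l => y.1)
        (I.unique l ⟨x.1, (hG' _).symm.trans x.2⟩))
    exact (compUnaryIso p G l ⟨l, hl⟩ hl' ⟨I.sec l, I.fiber l⟩ (I.unique l) h1 h2).symm ≪≫
      unaryIsoOfIso θ l (I.sec l) h1 (I.fiber l) h2 (I.unique l)
  · have h1 : (G ≫ Q).base.toFun l.1 = l.1 := hl
    have h2 : ∀ x : FinPt.Fiber (G ≫ Q).base l, ⟨l, h1⟩ = x := hl'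
    exact (compUnaryIso G Q l ⟨l, rfl⟩ (fun x => (fiber_id_eq x).symm) ⟨l, hl⟩ hl' h1 h2).symm ≪≫
      unaryIsoOfIso ω l l h1 rfl h2 (fun x => (fiber_id_eq x).symm)

theorem isEquivalence_unaryComp (hp : IsCoCartesian p) (l : X.base.Nonbase) :
    (I.unaryComp l).IsEquivalence := by
  obtain ⟨G, -, -, -, ⟨e⟩, ⟨e'⟩⟩ := I.exists_inverse hp l
  exact (CategoryTheory.Equivalence.mk _ _ e.symm e').isEquivalence_functor

end Inert

end TwoVectTensor

section

variable {ι : Type} (C : ι → TwoVectGr.{u, v, w} k)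

theorem isEquivalence_eval (i₀ : ι) (h : ∀ i, i₀ = i) :
    (Pi.eval (fun i => Tot (C i)) i₀).IsEquivalence :=
  (CategoryTheory.Equivalence.mk (Pi.eval (fun i => Tot (C i)) i₀) (fromPoint C i₀ h)
    (evalFromPoint C i₀ h).symm (Iso.refl _)).isEquivalence_functor

end

namespace TwoVectTensor

theorem Inert.isEquivalence_comp {A X : TwoVectTensor.{u, v, w} k} {p : A ⟶ X} (I : Inert p)
    (hp : IsCoCartesian p) (l : X.base.Nonbase) : (p.comp l).functor.IsEquivalence := by
  have := I.isEquivalence_unaryComp hp l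
  have := isEquivalence_eval (fun i : FinPt.Fiber p.base l => A.fam i.1) _ (I.unique l)
  have : (Pi.eval (fun i : FinPt.Fiber p.base l => Tot (A.fam i.1)) ⟨I.sec l, I.fiber l⟩ ⋙
    I.unaryComp l).IsEquivalence := inferInstance
  exact @Functor.isEquivalence_of_iso _ _ _ _ _ _ ((p.comp l).isoUnary _ (I.unique l)).symm this

end TwoVectTensor
end SelfAdjointHopf

namespace SelfAdjointHopf
variable {k : Type u} [Field k]

namespace TwoVectTensor

/-! ### Pairs of complementary inert 1-morphisms -/

namespace Inert

variable {A X : TwoVectTensor.{u, v, w} k} {p : A ⟶ X} (I : Inert p)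

theorem eq_sec {l : X.base.Nonbase} {j : A.base.Nonbase} (h : p.base.toFun j.1 = l.1) :
    I.sec l = j :=
  congrArg (fun x : FinPt.Fiber p.base l => x.1) (I.unique l ⟨j, h⟩)

variable {Z : TwoVectTensor.{u, v, w} k} {G G' : Z ⟶ A}

theorem comp_base_eq {l : X.base.Nonbase} (i : FinPt.Fiber (G ≫ p).base l) :
    G.base.toFun i.1.1 = (I.sec l).1 := by
  have h : G.base.toFun i.1.1 ≠ A.base.pt := fun e => l.2 <| by
    rw [← i.2]
    exact (congrArg p.base.toFun e).trans p.base.map_pt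
  exact congrArg Subtype.val (I.eq_sec (j := ⟨_, h⟩) i.2).symm

/-- The component of a 2-morphism `G ⟶ G'` determined by a 2-morphism `G ≫ p ⟶ G' ≫ p`. -/
theorem exists_app (hp : IsCoCartesian p) (h : G.base = G'.base) (τ : G ≫ p ⟶ G' ≫ p)
    (l : X.base.Nonbase) :
    ∃ t : (G.comp (I.sec l)).functor ⟶ reindex Z h (I.sec l) ⋙ (G'.comp (I.sec l)).functor,
      ∀ (Y : ∀ i : FinPt.Fiber (G ≫ p).base l, Tot (Z.fam i.1))
        (m : ∀ j : FinPt.Fiber p.base l, (compInner G p l).obj Y j ⟶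
          (compInner G' p l).obj ((reindex Z τ.base_eq l).obj Y) j),
        (p.comp l).functor.map m = (τ.app l).app Y →
        m ⟨I.sec l, I.fiber l⟩ =
          t.app fun i => Y ⟨i.1, (congrArg p.base.toFun i.2).trans (I.fiber l)⟩ := by
  have := I.isEquivalence_comp hp l
  -- The fibre of `G` over `I.sec l` is that of `G ≫ p` over `l`, so `t` can be defined by lifting
  -- `τ` through the equivalence `(p.comp l).functor`.
  let ext (Y : ∀ i : FinPt.Fiber G.base (I.sec l), Tot (Z.fam i.1)) :
    ∀ i : FinPt.Fiber (G ≫ p).base l, Tot (Z.fam i.1) := fun i => Y ⟨i.1, I.comp_base_eq i⟩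
  let pre (Y : ∀ i : FinPt.Fiber (G ≫ p).base l, Tot (Z.fam i.1)) :
      (compInner G p l).obj Y ⟶ (compInner G' p l).obj ((reindex Z τ.base_eq l).obj Y) :=
    (p.comp l).functor.preimage ((τ.app l).app Y)
  have hpre : ∀ Y, (p.comp l).functor.map (pre Y) = (τ.app l).app Y := fun Y =>
    (p.comp l).functor.map_preimage _
  refine ⟨{ app := fun Y => pre (ext Y) ⟨I.sec l, I.fiber l⟩
            naturality := fun Y Y' f => ?_ }, fun Y m hm => ?_⟩
  · let f' : ext Y ⟶ ext Y' := fun i => f ⟨i.1, I.comp_base_eq i⟩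
    have h1 : (compInner G p l).map f' ≫ pre (ext Y') =
        pre (ext Y) ≫ (compInner G' p l).map ((reindex Z τ.base_eq l).map f') := by
      refine (p.comp l).functor.map_injective ?_
      rw [Functor.map_comp, Functor.map_comp, hpre, hpre]
      exact (τ.app l).naturality f'
    exact congrFun h1 ⟨I.sec l, I.fiber l⟩
  · have h1 : m = pre Y := (p.comp l).functor.map_injective (hm.trans (hpre Y).symm)
    rw [h1]

end Inert

section Pair

variable {A X Y : TwoVectTensor.{u, v, w} k} {p : A ⟶ X} {q : A ⟶ Y} (I : Inert p) (J : Inert q)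

/-- Two inert 1-morphisms such that every element other than the base point survives in exactly one
of the targets. -/
structure Complementary : Prop where
  cover : ∀ j, (∃ l, I.sec l = j) ∨ ∃ l, J.sec l = j
  snd_fst : ∀ l, q.base.toFun (I.sec l).1 = Y.base.pt
  fst_snd : ∀ l, p.base.toFun (J.sec l).1 = X.base.pt

variable {I J}

theorem Complementary.sec_ne (H : Complementary I J) (l : X.base.Nonbase) (l' : Y.base.Nonbase) :
    I.sec l ≠ J.sec l' := fun h =>
  l'.2 <| by
    rw [← J.fiber l', ← h]
    exact H.snd_fst l

/-- Every element other than the base point survives under one of the two maps, and there it is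
determined by its image. -/
theorem Complementary.hom_ext (H : Complementary I J) {K : FinPt} {f g : K ⟶ A.base}
    (h1 : f ≫ p.base = g ≫ p.base) (h2 : f ≫ q.base = g ≫ q.base) : f = g := by
  have key : ∀ a b : A.base.carrier, p.base.toFun a = p.base.toFun b →
      q.base.toFun a = q.base.toFun b → a ≠ A.base.pt → a = b := by
    intro a b h1 h2 ha
    have hsurv : ∀ {W : TwoVectTensor.{u, v, w} k} {r : A ⟶ W} (K : Inert r) (l : W.base.Nonbase),
        K.sec l = ⟨a, ha⟩ → r.base.toFun a = r.base.toFun b → a = b := by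
      intro W r K l hl h
      have h3 : r.base.toFun a = l.1 := by
        rw [← K.fiber l, hl]
      have hb : b ≠ A.base.pt := fun e => l.2 <| by
        rw [← h3, h, e, r.base.map_pt]
      have h4 := K.eq_sec (l := l) (j := ⟨b, hb⟩) (h.symm.trans h3)
      rw [hl] at h4
      exact congrArg Subtype.val h4
    obtain ⟨l, hl⟩ | ⟨l, hl⟩ := H.cover ⟨a, ha⟩
    · exact hsurv I l hl h1
    · exact hsurv J l hl h2
  refine FinPt.hom_ext fun i => ?_
  have h1 := congrArg (fun φ => φ.toFun i) h1
  have h2 := congrArg (fun φ => φ.toFun i) h2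
  by_cases ha : f.toFun i = A.base.pt
  · by_cases hb : g.toFun i = A.base.pt
    · rw [ha, hb]
    · exact (key _ _ h1.symm h2.symm hb).symm
  · exact key _ _ h1 h2 ha

/-- A 2-morphism is the same as a pair of 2-morphisms between the images of its source and target
under two complementary inert 1-morphisms. -/
theorem Complementary.existsUnique (H : Complementary I J) (hp : IsCoCartesian p)
    (hq : IsCoCartesian q) {Z : TwoVectTensor.{u, v, w} k} {G G' : Z ⟶ A}
    (τ₁ : G ≫ p ⟶ G' ≫ p) (τ₂ : G ≫ q ⟶ G' ≫ q) :
    ∃! τ : G ⟶ G', τ ▷ p = τ₁ ∧ τ ▷ q = τ₂ := by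
  have h : G.base = G'.base := H.hom_ext τ₁.base_eq τ₂.base_eq
  choose t₁ ht₁ using I.exists_app hp h τ₁
  choose t₂ ht₂ using J.exists_app hq h τ₂
  -- Each `j` is hit by exactly one of the two sections, so the prescriptions never conflict;
  -- stating them with casts allows a choice for all `j` at once.
  have key : ∀ j, ∃ t : (G.comp j).functor ⟶ reindex Z h j ⋙ (G'.comp j).functor,
      (∀ l (e : I.sec l = j), e ▸ t₁ l = t) ∧ ∀ l (e : J.sec l = j), e ▸ t₂ l = t := by
    intro j
    obtain ⟨l, rfl⟩ | ⟨l, rfl⟩ := H.cover j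
    · refine ⟨t₁ l, fun l' e => ?_, fun l' e => (H.sec_ne l l' e.symm).elim⟩
      obtain rfl : l' = l := Subtype.ext (by rw [← I.fiber l', e, I.fiber l])
      rfl
    · refine ⟨t₂ l, fun l' e => (H.sec_ne l' l e).elim, fun l' e => ?_⟩
      obtain rfl : l' = l := Subtype.ext (by rw [← J.fiber l', e, J.fiber l])
      rfl
  choose t ht₁' ht₂' using key
  have e₁ : ∀ l, t (I.sec l) = t₁ l := fun l => (ht₁' _ l rfl).symm
  have e₂ : ∀ l, t (J.sec l) = t₂ l := fun l => (ht₂' _ l rfl).symm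
  refine ⟨Hom₂.mk h t, ⟨?_, ?_⟩, ?_⟩
  · ext l W : 2
    have := I.isEquivalence_comp hp l
    obtain ⟨m, hm⟩ := (p.comp l).functor.map_surjective ((τ₁.app l).app W)
    rw [← hm]
    refine congrArg (p.comp l).functor.map (funext fun j => ?_)
    obtain rfl := I.unique l j
    refine Eq.trans ?_ (ht₁ l W m hm).symm
    rw [← e₁]
  · ext l W : 2
    have := J.isEquivalence_comp hq l
    obtain ⟨m, hm⟩ := (q.comp l).functor.map_surjective ((τ₂.app l).app W)
    rw [← hm]
    refine congrArg (q.comp l).functor.map (funext fun j => ?_)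
    obtain rfl := J.unique l j
    refine Eq.trans ?_ (ht₂ l W m hm).symm
    rw [← e₂]
  · rintro τ ⟨rfl, rfl⟩
    ext j W : 2
    obtain ⟨l, rfl⟩ | ⟨l, rfl⟩ := H.cover j
    · refine Eq.trans ?_ (congrArg (fun x => NatTrans.app x W) (e₁ l).symm)
      exact ht₁ l (fun i => W ⟨i.1, I.comp_base_eq i⟩) (fun j => (τ.app j.1).app _) rfl
    · refine Eq.trans ?_ (congrArg (fun x => NatTrans.app x W) (e₂ l).symm)
      exact ht₂ l (fun i => W ⟨i.1, J.comp_base_eq i⟩) (fun j => (τ.app j.1).app _) rfl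

/-- Invertibility of 2-morphisms can be checked after composition with two complementary inert
1-morphisms. -/
theorem Complementary.isIso (H : Complementary I J) (hp : IsCoCartesian p)
    (hq : IsCoCartesian q) {Z : TwoVectTensor.{u, v, w} k} {G G' : Z ⟶ A} (τ : G ⟶ G')
    [IsIso (τ ▷ p)] [IsIso (τ ▷ q)] : IsIso τ := by
  obtain ⟨σ, ⟨h1, h2⟩, -⟩ := H.existsUnique hp hq (inv (τ ▷ p)) (inv (τ ▷ q))
  refine ⟨σ, (H.existsUnique hp hq (𝟙 _) (𝟙 _)).unique ⟨?_, ?_⟩ ⟨id_whiskerRight _ _,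
    id_whiskerRight _ _⟩, (H.existsUnique hp hq (𝟙 _) (𝟙 _)).unique ⟨?_, ?_⟩ ⟨id_whiskerRight _ _,
    id_whiskerRight _ _⟩⟩
  all_goals simp [h1, h2]

end Pair

/-- The entries of `f` are inverses of the components of `p` and `q`, applied to the constant `Φ`
and to the variable respectively. -/
theorem Complementary.exists_insertion {A X : TwoVectTensor.{u, v, w} k} {p q : A ⟶ X}
    {I : Inert p} {J : Inert q} (H : Complementary I J) (hp : IsCoCartesian p)
    (hq : IsCoCartesian q) (o : X.base.Nonbase) (ho : ∀ l, l = o) (Φ : nil ⟶ X) :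
    ∃ f : X ⟶ A, Nonempty (f ≫ p ≅ toNil X ≫ Φ) ∧ Nonempty (f ≫ q ≅ 𝟙 X) := by
  classical
  obtain ⟨G, -, -, -, -, ⟨eG⟩⟩ := I.exists_inverse hp o
  obtain ⟨K, hK1, hK2, hK3, -, ⟨eK⟩⟩ := J.exists_inverse hq o
  have hΦ : ∀ o, IsEmpty (FinPt.Fiber Φ.base o) := fun o => ⟨fun i => nil_false i.1⟩
  -- The only variable is used by the second entry, so the fibre over `I.sec o` is empty and the
  -- first entry is a functor in no variables.
  let b : X.base ⟶ A.base :=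
    ⟨fun x => if x = X.base.pt then A.base.pt else (J.sec o).1, if_pos rfl⟩
  have hb : ∀ x : X.base.Nonbase, b.toFun x.1 = (J.sec o).1 := fun x => if_neg x.2
  have : IsEmpty (FinPt.Fiber b (I.sec o)) :=
    ⟨fun i => H.sec_ne o o (Subtype.ext (i.2.symm.trans (hb i.1)))⟩
  have hu : ∀ x : FinPt.Fiber b (J.sec o), ⟨o, hb o⟩ = x := fun x => Subtype.ext (ho x.1).symm
  let M₁ : MultiFun (fun i : FinPt.Fiber b (I.sec o) => X.fam i.1) (A.fam (I.sec o)) :=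
    MultiFun.ofIsEmpty _ (G.obj ((Φ.comp o).functor.obj fun i => ((hΦ o).false i).elim))
  let M₂ : MultiFun (fun i : FinPt.Fiber b (J.sec o) => X.fam i.1) (A.fam (J.sec o)) :=
    MultiFun.ofUnary _ ⟨o, hb o⟩ hu K hK1 hK2 hK3
  have key : ∀ j, ∃ M : MultiFun (fun i : FinPt.Fiber b j => X.fam i.1) (A.fam j),
      (∀ e : I.sec o = j, e ▸ M₁ = M) ∧ ∀ e : J.sec o = j, e ▸ M₂ = M := by
    intro j
    obtain ⟨l, rfl⟩ | ⟨l, rfl⟩ := H.cover j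
    · obtain rfl := ho l
      exact ⟨M₁, fun _ => rfl, fun e => (H.sec_ne _ _ e.symm).elim⟩
    · obtain rfl := ho l
      exact ⟨M₂, fun e => (H.sec_ne _ _ e).elim, fun _ => rfl⟩
  choose M hM₁ hM₂ using key
  have e₁ : (M (I.sec o)).functor = M₁.functor := congrArg _ (hM₁ _ rfl).symm
  have e₂ : (M (J.sec o)).functor = M₂.functor := congrArg _ (hM₂ _ rfl).symm
  let f : X ⟶ A := Hom.mk b M
  have hbase₁ : (f ≫ p).base = (toNil X ≫ Φ).base := by
    refine FinPt.hom_ext fun x => Eq.trans ?_ Φ.base.map_pt.symm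
    by_cases hx : x = X.base.pt
    · subst hx
      exact (f ≫ p).base.map_pt
    · exact (congrArg p.base.toFun (hb ⟨x, hx⟩)).trans (H.fst_snd o)
  have hbase₂ : (f ≫ q).base = (𝟙 X : X ⟶ X).base := by
    refine FinPt.hom_ext fun x => ?_
    by_cases hx : x = X.base.pt
    · subst hx
      exact (f ≫ q).base.map_pt
    · refine (congrArg q.base.toFun (hb ⟨x, hx⟩)).trans ((J.fiber o).trans ?_)
      exact congrArg Subtype.val (ho ⟨x, hx⟩).symm
  refine ⟨f, ⟨isoMk (F := f ≫ p) (G := toNil X ≫ Φ) hbase₁ fun l => Classical.choice ?_⟩,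
    ⟨isoMk (F := f ≫ q) (G := 𝟙 X) hbase₂ fun l => Classical.choice ?_⟩⟩
  · obtain rfl := ho l
    have := hΦ l
    let Φ' := (Φ.comp l).functor.obj isEmptyElim
    have e₃ : Nonempty (restrict f p l ⟨I.sec l, I.fiber l⟩ ⋙ M₁.functor ⋙ I.unaryComp l ≅
        (Functor.const _).obj Φ') :=
      ⟨NatIso.ofComponents (fun Y => eG.app Φ') fun g =>
        ((congrArg (· ≫ _) ((I.unaryComp l).map_id _)).trans
          (Category.id_comp _)).trans (Category.comp_id _).symm⟩
    have e₄ : Nonempty ((Functor.const _).obj Φ' ≅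
        reindex X hbase₁ l ⋙ ((toNil X ≫ Φ).comp l).functor) :=
      ⟨NatIso.ofComponents (fun Y => (Φ.comp l).functor.mapIso
              (Y := (compInner (toNil X) Φ l).obj ((reindex X hbase₁ l).obj Y))
              { hom := fun i => isEmptyElim i
                inv := fun i => isEmptyElim i
                hom_inv_id := funext fun i => isEmptyElim i
                inv_hom_id := funext fun i => isEmptyElim i }) fun {Y Y'} g => by
        refine (Category.id_comp _).trans (Eq.trans ?_ ((Φ.comp l).functor.map_comp
          (Z := (compInner (toNil X) Φ l).obj ((reindex X hbase₁ l).obj Y')) _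
            ((compInner (toNil X) Φ l).map ((reindex X hbase₁ l).map g))))
        exact congrArg (Φ.comp l).functor.map (funext fun i => isEmptyElim i)⟩
    exact ⟨compIso f p _ ⟨I.sec l, I.fiber l⟩ (I.unique l) ≪≫
      Functor.isoWhiskerLeft (restrict f p l ⟨I.sec l, I.fiber l⟩)
        (Functor.isoWhiskerRight (eqToIso e₁) _) ≪≫ e₃.some ≪≫ e₄.some⟩
  · obtain rfl := ho l
    have e₃ : Nonempty (restrict f q l ⟨J.sec l, J.fiber l⟩ ⋙ M₂.functor ⋙ J.unaryComp l ≅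
        reindex X hbase₂ l ⋙ ((𝟙 X : X ⟶ X).comp l).functor) :=
      ⟨NatIso.ofComponents (fun Y => eK.app (Y ⟨l, congrArg (fun b => b.toFun l.1) hbase₂⟩))
        fun g => eK.hom.naturality (g ⟨l, congrArg (fun b => b.toFun l.1) hbase₂⟩)⟩
    exact ⟨compIso f q _ ⟨J.sec l, J.fiber l⟩ (J.unique l) ≪≫
      Functor.isoWhiskerLeft (restrict f q l ⟨J.sec l, J.fiber l⟩)
        (Functor.isoWhiskerRight (eqToIso e₂) _) ≪≫ e₃.some⟩

end TwoVectTensor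

/-! ### Strongly coCartesian morphisms of families of finite sets -/

namespace FinSetSqcup

/-- The map induced by a morphism of families on the disjoint unions of their members, defined on
the members over elements which do not go to the base point. -/
def total {X Y : FinSetSqcup} (f : X ⟶ Y) :
    (Σ i : {i : X.base.Nonbase // f.base.toFun i.1 ≠ Y.base.pt}, (X.fam i.1 : Type)) →
      Σ j : Y.base.Nonbase, (Y.fam j : Type) :=
  fun x => ⟨⟨f.base.toFun x.1.1.1, x.1.2⟩, f.map x.1.1 x.1.2 x.2⟩

theorem base_eq_of_isHomLift {X Y : FinSetSqcup} {b : X.base ⟶ Y.base} {f : X ⟶ Y}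
    (h : proj.IsHomLift b f) : f.base = b :=
  (IsHomLift.fac' proj b f).trans ((Category.id_comp _).trans (Category.comp_id _))

/-- A morphism out of `Y` is given on single elements of the members of `Y`, and by bijectivity of
`total f` each comes from exactly one element of `X`. Members of `X` sent to the base point impose
nothing, as `g` preserves base points. -/
theorem isStronglyCocartesian_of_bijective {X Y : FinSetSqcup} (f : X ⟶ Y)
    (hf : Function.Bijective (total f)) : proj.IsStronglyCocartesian f.base f where
  toIsHomLift := .map f
  universal_property' := by
    intro Z g φ' hφ
    have hb : φ'.base = f.base ≫ g := base_eq_of_isHomLift hφ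
    obtain ⟨b, μ⟩ := φ'
    dsimp only at hb
    subst hb
    have key : ∀ z : Σ j : Y.base.Nonbase, (Y.fam j : Type),
        ∃ w : ∀ h : g.toFun z.1.1 ≠ Z.base.pt, (Z.fam ⟨g.toFun z.1.1, h⟩ : Type),
          ∀ x (e : total f x = z), e ▸ (fun h => μ x.1.1 h x.2) = w := by
      intro z
      obtain ⟨x, rfl⟩ := hf.2 z
      refine ⟨fun h => μ x.1.1 h x.2, fun y e => ?_⟩
      obtain rfl := hf.1 e
      rfl
    choose W hW using key
    let χ : Y ⟶ Z := Hom.mk g fun j h => FintypeCat.homMk fun y => W ⟨j, y⟩ h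
    refine ⟨χ, ⟨Functor.IsHomLift.map (p := proj) χ, ?_⟩, ?_⟩
    · refine Hom.ext rfl (heq_of_eq ?_)
      funext i h
      refine FintypeCat.hom_ext _ _ fun x => ?_
      exact congrFun (hW _ ⟨⟨i, fun e => h ((congrArg g.toFun e).trans g.map_pt)⟩, x⟩ rfl).symm h
    · rintro ⟨g', ν⟩ ⟨hg, hν⟩
      have hb : g' = g := base_eq_of_isHomLift hg
      subst hb
      refine Hom.ext rfl (heq_of_eq ?_)
      funext j h
      refine FintypeCat.hom_ext _ _ fun y => ?_
      obtain ⟨x, hx⟩ := hf.2 ⟨j, y⟩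
      have h1 : ∀ (h : g'.toFun (f.base.toFun x.1.1.1) ≠ Z.base.pt),
          ν ⟨f.base.toFun x.1.1.1, x.1.2⟩ h (f.map x.1.1 x.1.2 x.2) = μ x.1.1 h x.2 := fun h => by
        have h2 := eq_of_heq (Hom.mk.inj hν).2
        exact congrArg (fun t => t x.2) (congrFun (congrFun h2 x.1.1) h)
      have h3 : ∀ z (hz : total f x = z) (h : g'.toFun z.1.1 ≠ Z.base.pt),
          ν z.1 h z.2 = W z h := by
        rintro _ rfl h
        exact (h1 h).trans (congrFun (hW _ x rfl) h)
      exact h3 _ hx h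

/-- The hypotheses say that `T` is the disjoint union of the images of two injections. -/
theorem isStronglyCocartesian_cop {S T : FintypeCat.{0}} (f₁ f₂ : S ⟶ T)
    (h₁ : Function.Injective f₁) (h₂ : Function.Injective f₂) (h₃ : ∀ x y, f₁ x ≠ f₂ y)
    (h₄ : ∀ z, (∃ x, f₁ x = z) ∨ ∃ x, f₂ x = z) :
    proj.IsStronglyCocartesian (cop f₁ f₂).base (cop f₁ f₂) := by
  refine isStronglyCocartesian_of_bijective _ ⟨?_, ?_⟩
  · rintro ⟨⟨⟨i, hi⟩, hi'⟩, x⟩ ⟨⟨⟨j, hj⟩, hj'⟩, y⟩ h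
    have h' := congrArg (fun z : Σ j : (list 1 T).base.Nonbase, (T : Type) => z.2) h
    change Fin 3 at i j
    fin_cases i <;> fin_cases j
    any_goals exact (hi rfl).elim
    any_goals exact (hj rfl).elim
    · obtain rfl := h₁ h'
      rfl
    · exact (h₃ _ _ h').elim
    · exact (h₃ _ _ h'.symm).elim
    · obtain rfl := h₂ h'
      rfl
  · rintro ⟨⟨j, hj⟩, z⟩
    change Fin 2 at j
    fin_cases j
    · exact (hj rfl).elim
    · obtain ⟨x, rfl⟩ | ⟨x, rfl⟩ := h₄ z
      · exact ⟨⟨⟨⟨(1 : Fin 3), (by decide : (1 : Fin 3) ≠ 0)⟩, hj⟩, x⟩, rfl⟩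
      · exact ⟨⟨⟨⟨(2 : Fin 3), (by decide : (2 : Fin 3) ≠ 0)⟩, hj⟩, x⟩, rfl⟩

theorem isStronglyCocartesian_fstEntry (S : FintypeCat.{0}) :
    proj.IsStronglyCocartesian (fstEntry S).base (fstEntry S) := by
  refine isStronglyCocartesian_of_bijective _ ⟨?_, ?_⟩
  · rintro ⟨⟨⟨i, hi⟩, hi'⟩, x⟩ ⟨⟨⟨j, hj⟩, hj'⟩, y⟩ h
    obtain rfl : x = y := congrArg (fun z : Σ j : (list 1 S).base.Nonbase, (S : Type) => z.2) h
    change Fin 3 at i j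
    fin_cases i <;> fin_cases j
    any_goals exact (hi rfl).elim
    any_goals exact (hj rfl).elim
    any_goals exact (hi' rfl).elim
    any_goals exact (hj' rfl).elim
    rfl
  · rintro ⟨⟨j, hj⟩, z⟩
    change Fin 2 at j
    fin_cases j
    · exact (hj rfl).elim
    · exact ⟨⟨⟨⟨(1 : Fin 3), (by decide : (1 : Fin 3) ≠ 0)⟩, hj⟩, z⟩, rfl⟩

theorem isStronglyCocartesian_sndEntry (S : FintypeCat.{0}) :
    proj.IsStronglyCocartesian (sndEntry S).base (sndEntry S) := by
  refine isStronglyCocartesian_of_bijective _ ⟨?_, ?_⟩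
  · rintro ⟨⟨⟨i, hi⟩, hi'⟩, x⟩ ⟨⟨⟨j, hj⟩, hj'⟩, y⟩ h
    obtain rfl : x = y := congrArg (fun z : Σ j : (list 1 S).base.Nonbase, (S : Type) => z.2) h
    change Fin 3 at i j
    fin_cases i <;> fin_cases j
    any_goals exact (hi rfl).elim
    any_goals exact (hj rfl).elim
    any_goals exact (hi' rfl).elim
    any_goals exact (hj' rfl).elim
    rfl
  · rintro ⟨⟨j, hj⟩, z⟩
    change Fin 2 at j
    fin_cases j
    · exact (hj rfl).elim
    · exact ⟨⟨⟨⟨(2 : Fin 3), (by decide : (2 : Fin 3) ≠ 0)⟩, hj⟩, z⟩, rfl⟩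

end FinSetSqcup

/-! ### The particular coCartesian morphisms and the Cartesian square -/

namespace SSH

open FinSetSqcup TwoVectTensor

theorem isStronglyCocartesian_c : proj.IsStronglyCocartesian c.base c :=
  isStronglyCocartesian_cop _ _ (by decide : Function.Injective fun _ : Fin 1 => (0 : Fin 2))
    (by decide : Function.Injective fun _ : Fin 1 => (1 : Fin 2))
    (by decide : ∀ _ _ : Fin 1, (0 : Fin 2) ≠ 1)
    (by decide : ∀ z : Fin 2, (∃ _ : Fin 1, 0 = z) ∨ ∃ _ : Fin 1, 1 = z)

theorem isStronglyCocartesian_cBar : proj.IsStronglyCocartesian cBar.base cBar :=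
  isStronglyCocartesian_cop _ _ (by decide : Function.Injective (![0, 2] : Fin 2 → Fin 4))
    (by decide : Function.Injective (![1, 3] : Fin 2 → Fin 4))
    (by decide : ∀ x y, (![0, 2] : Fin 2 → Fin 4) x ≠ (![1, 3] : Fin 2 → Fin 4) y)
    (by decide : ∀ z, (∃ x, (![0, 2] : Fin 2 → Fin 4) x = z) ∨
      ∃ x, (![1, 3] : Fin 2 → Fin 4) x = z)

/-- The pair `(foldBar, foldSq)` identifies `fset 4` with `fset 2 × fset 2`; the table `![![0, 2],
![1, 3]]` is the inverse. -/
theorem isPullback_fold : IsPullback foldBar foldSq fold fold := by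
  refine ⟨⟨rfl⟩, ⟨Limits.PullbackCone.IsLimit.mk _
    (fun s => FintypeCat.homMk fun x =>
      (![![0, 2], ![1, 3]] : Fin 2 → Fin 2 → Fin 4) (s.fst x) (s.snd x)) ?_ ?_ ?_⟩⟩
  · intro s
    refine FintypeCat.hom_ext _ _ fun x => ?_
    exact (by decide : ∀ a b : Fin 2, (![0, 1, 0, 1] : Fin 4 → Fin 2)
      ((![![0, 2], ![1, 3]] : Fin 2 → Fin 2 → Fin 4) a b) = a) (s.fst x) (s.snd x)
  · intro s
    refine FintypeCat.hom_ext _ _ fun x => ?_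
    exact (by decide : ∀ a b : Fin 2, (![0, 0, 1, 1] : Fin 4 → Fin 2)
      ((![![0, 2], ![1, 3]] : Fin 2 → Fin 2 → Fin 4) a b) = b) (s.fst x) (s.snd x)
  · intro s m h1 h2
    refine FintypeCat.hom_ext _ _ fun x => ?_
    have h1 : foldBar (m x) = s.fst x := congrArg (fun t => t x) h1
    have h2 : foldSq (m x) = s.snd x := congrArg (fun t => t x) h2
    refine Eq.trans ?_ (congrArg₂ (![![0, 2], ![1, 3]] : Fin 2 → Fin 2 → Fin 4) h1 h2)
    exact (by decide : ∀ a : Fin 4, a = (![![0, 2], ![1, 3]] : Fin 2 → Fin 2 → Fin 4)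
      ((![0, 1, 0, 1] : Fin 4 → Fin 2) a) ((![0, 0, 1, 1] : Fin 4 → Fin 2) a)) (m x)

end SSH
end SelfAdjointHopf

namespace SelfAdjointHopf
variable {k : Type u} [Field k]

namespace SSH

open FinSetSqcup TwoVectTensor

/-! ### The maps of pointed sets which underlie the images of morphisms -/

section Base

variable (𝓗 : SSH.{u, v, w} k)

/-- The identification of the base of the image of `X` with the base of `X`. -/
def baseEquiv (X : FinSetSqcup) : (𝓗.H.obj ⟨X⟩).base.carrier ≃ X.base.carrier where
  toFun := (𝓗.baseIso X).hom.toFun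
  invFun := (𝓗.baseIso X).inv.toFun
  left_inv a := congrArg (fun f => f.toFun a) (𝓗.baseIso X).hom_inv_id
  right_inv a := congrArg (fun f => f.toFun a) (𝓗.baseIso X).inv_hom_id

variable {X Y : FinSetSqcup} (f : X ⟶ Y)

theorem baseEquiv_map (a : (𝓗.H.obj ⟨X⟩).base.carrier) :
    𝓗.baseEquiv Y ((𝓗.H.map f.toLoc).base.toFun a) = f.base.toFun (𝓗.baseEquiv X a) :=
  congrArg (fun f => f.toFun a) (𝓗.baseIso_naturality f)

theorem map_base : (𝓗.H.map f.toLoc).base.toFun =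
    (𝓗.baseEquiv Y).symm ∘ f.base.toFun ∘ 𝓗.baseEquiv X :=
  funext fun a => ((𝓗.baseEquiv Y).symm_apply_eq.2 (𝓗.baseEquiv_map f a).symm).symm

theorem bijective_map_base (h : Function.Bijective f.base.toFun) :
    Function.Bijective (𝓗.H.map f.toLoc).base.toFun := by
  rw [map_base]
  exact (Equiv.bijective _).comp (h.comp (Equiv.bijective _))

theorem surjective_map_base (h : Function.Surjective f.base.toFun) :
    Function.Surjective (𝓗.H.map f.toLoc).base.toFun := by
  rw [map_base]
  exact (Equiv.surjective _).comp (h.comp (Equiv.surjective _))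

theorem baseEquiv_eq_pt_iff {a : (𝓗.H.obj ⟨X⟩).base.carrier} :
    𝓗.baseEquiv X a = X.base.pt ↔ a = (𝓗.H.obj ⟨X⟩).base.pt := by
  rw [← (𝓗.baseIso X).hom.map_pt]
  exact (𝓗.baseEquiv X).apply_eq_iff_eq

/-- The identification of the complements of the base points. -/
def nonbaseEquiv (X : FinSetSqcup) : (𝓗.H.obj ⟨X⟩).base.Nonbase ≃ X.base.Nonbase :=
  (𝓗.baseEquiv X).subtypeEquiv fun _ => 𝓗.baseEquiv_eq_pt_iff.not.symm

/-- The image of a morphism over an inert map is inert. -/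
def inertMap (s : Y.base.Nonbase → X.base.Nonbase)
    (hs : ∀ l i, f.base.toFun i.1 = l.1 ↔ s l = i) : Inert (𝓗.H.map f.toLoc) where
  sec l := (𝓗.nonbaseEquiv X).symm (s (𝓗.nonbaseEquiv Y l))
  fiber l := by
    refine (𝓗.baseEquiv Y).injective ((𝓗.baseEquiv_map f _).trans ?_)
    refine (congrArg (fun i => f.base.toFun (Subtype.val i))
      ((𝓗.nonbaseEquiv X).apply_symm_apply (s (𝓗.nonbaseEquiv Y l)))).trans ?_
    exact (hs (𝓗.nonbaseEquiv Y l) _).2 rfl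
  unique l x := by
    refine Subtype.ext ((Equiv.symm_apply_eq _).2 ((hs _ _).1 ?_))
    exact (𝓗.baseEquiv_map f _).symm.trans (congrArg (𝓗.baseEquiv Y) x.2)

theorem fstEntry_base_iff (S : FintypeCat.{0}) (l : (list 1 S).base.Nonbase)
    (i : (list 2 S).base.Nonbase) :
    (fstEntry S).base.toFun i.1 = l.1 ↔
      (⟨(1 : Fin 3), (by decide : (1 : Fin 3) ≠ 0)⟩ : (list 2 S).base.Nonbase) = i := by
  rw [Subtype.ext_iff]
  exact (by decide : ∀ (l : Fin 2) (i : Fin 3), l ≠ 0 → i ≠ 0 →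
    ((![0, 1, 0] : Fin 3 → Fin 2) i = l ↔ 1 = i)) l.1 i.1 l.2 i.2

theorem sndEntry_base_iff (S : FintypeCat.{0}) (l : (list 1 S).base.Nonbase)
    (i : (list 2 S).base.Nonbase) :
    (sndEntry S).base.toFun i.1 = l.1 ↔
      (⟨(2 : Fin 3), (by decide : (2 : Fin 3) ≠ 0)⟩ : (list 2 S).base.Nonbase) = i := by
  rw [Subtype.ext_iff]
  exact (by decide : ∀ (l : Fin 2) (i : Fin 3), l ≠ 0 → i ≠ 0 →
    ((![0, 0, 1] : Fin 3 → Fin 2) i = l ↔ 2 = i)) l.1 i.1 l.2 i.2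

/-! ### Projections to entries, insertions and the existence of the data -/

variable (S T : FintypeCat.{0})

/-- The 1-morphism which forgets the second entry is inert. -/
def inertFst : Inert (𝓗.H.map (fstEntry S).toLoc) :=
  𝓗.inertMap (fstEntry S) (fun _ => ⟨(1 : Fin 3), (by decide : (1 : Fin 3) ≠ 0)⟩)
    (fstEntry_base_iff S)

/-- The 1-morphism which forgets the first entry is inert. -/
def inertSnd : Inert (𝓗.H.map (sndEntry S).toLoc) :=
  𝓗.inertMap (sndEntry S) (fun _ => ⟨(2 : Fin 3), (by decide : (2 : Fin 3) ≠ 0)⟩)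
    (sndEntry_base_iff S)

theorem complementary_entries : Complementary (𝓗.inertFst S) (𝓗.inertSnd S) where
  cover j := by
    have h := (by decide : ∀ i : Fin 3, i ≠ 0 → 1 = i ∨ 2 = i) _ (𝓗.nonbaseEquiv (list 2 S) j).2
    refine h.imp (fun h => ⟨𝓗.one S, ?_⟩) (fun h => ⟨𝓗.one S, ?_⟩)
    all_goals exact (Equiv.symm_apply_eq _).2 (Subtype.ext h)
  snd_fst l := by
    refine 𝓗.baseEquiv_eq_pt_iff.1 ((𝓗.baseEquiv_map (sndEntry S) _).trans ?_)
    exact congrArg (sndEntry S).base.toFun ((𝓗.baseEquiv (list 2 S)).apply_symm_apply (1 : Fin 3))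
  fst_snd l := by
    refine 𝓗.baseEquiv_eq_pt_iff.1 ((𝓗.baseEquiv_map (fstEntry S) _).trans ?_)
    exact congrArg (fstEntry S).base.toFun ((𝓗.baseEquiv (list 2 S)).apply_symm_apply (2 : Fin 3))

theorem isCoCartesian_fst : IsCoCartesian (𝓗.H.map (fstEntry S).toLoc) :=
  𝓗.coCartesian _ (isStronglyCocartesian_fstEntry S)

theorem isCoCartesian_snd : IsCoCartesian (𝓗.H.map (sndEntry S).toLoc) :=
  𝓗.coCartesian _ (isStronglyCocartesian_sndEntry S)

theorem nonempty_insertion (Φ : nil ⟶ 𝓗.ob 1 S) : Nonempty (𝓗.Insertion Φ) := by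
  obtain ⟨f, ⟨e₁⟩, ⟨e₂⟩⟩ := (𝓗.complementary_entries S).exists_insertion (𝓗.isCoCartesian_fst S)
    (𝓗.isCoCartesian_snd S) (𝓗.one S) (𝓗.eq_one S) Φ
  exact ⟨f, e₁, e₂⟩

variable {S T}

theorem surjective_map_cop_base (f₁ f₂ : S ⟶ T) :
    Function.Surjective (𝓗.H.map (cop f₁ f₂).toLoc).base.toFun :=
  𝓗.surjective_map_base _ (by decide : Function.Surjective (![0, 1, 1] : Fin 3 → Fin 2))

theorem bijective_map_diag_base (n : ℕ) (f : S ⟶ T) :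
    Function.Bijective (𝓗.H.map (diag n f).toLoc).base.toFun :=
  𝓗.bijective_map_base _ Function.bijective_id

/-- A 1-morphism between lists of length one is over a bijection unless it is over a constant
map. -/
theorem bijective_base_of_ne {g : 𝓗.ob 1 S ⟶ 𝓗.ob 1 T}
    (h : g.base.toFun (𝓗.one S).1 ≠ (𝓗.ob 1 T).base.pt) : Function.Bijective g.base.toFun := by
  have key : ∀ a, g.base.toFun a = (𝓗.ob 1 T).base.pt ↔ a = (𝓗.ob 1 S).base.pt := fun a =>
    ⟨fun e => by_contra fun ha => h (by rwa [← 𝓗.eq_one S ⟨a, ha⟩]),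
      fun e => e ▸ g.base.map_pt⟩
  refine ⟨fun a b e => ?_, fun y => ?_⟩
  · by_cases ha : a = (𝓗.ob 1 S).base.pt
    · rw [ha, eq_comm, ← key, ← e, key, ha]
    · have hb : b ≠ (𝓗.ob 1 S).base.pt := fun hb => ha (by rwa [← key, e, key])
      exact congrArg Subtype.val ((𝓗.eq_one S ⟨a, ha⟩).trans (𝓗.eq_one S ⟨b, hb⟩).symm)
  · by_cases hy : y = (𝓗.ob 1 T).base.pt
    · exact ⟨(𝓗.ob 1 S).base.pt, hy ▸ g.base.map_pt⟩
    · exact ⟨(𝓗.one S).1, congrArg Subtype.val ((𝓗.eq_one T ⟨_, h⟩).trans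
        (𝓗.eq_one T ⟨y, hy⟩).symm)⟩

/-- The second entry being the identity, the insertion does not send `one` to the base point; the
map under `cop` sends nothing else to the base point. -/
theorem Insertion.bijective_base {Φ : nil ⟶ 𝓗.ob 1 S} (i : 𝓗.Insertion Φ) (f₁ f₂ : S ⟶ T) :
    Function.Bijective (i.hom ≫ 𝓗.H.map (cop f₁ f₂).toLoc).base.toFun := by
  refine 𝓗.bijective_base_of_ne fun h => ?_
  have h1 : (𝓗.H.map (sndEntry S).toLoc).base.toFun (i.hom.base.toFun (𝓗.one S).1) =
      (𝓗.one S).1 := congrArg (fun φ => φ.toFun (𝓗.one S).1) i.snd.hom.base_eq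
  have h2 : 𝓗.baseEquiv _ (i.hom.base.toFun (𝓗.one S).1) = (0 : Fin 3) :=
    (by decide : ∀ a : Fin 3, (![0, 1, 1] : Fin 3 → Fin 2) a = 0 → a = 0) _
      ((𝓗.baseEquiv_map (cop f₁ f₂) _).symm.trans (𝓗.baseEquiv_eq_pt_iff.2 h))
  have h3 := 𝓗.baseEquiv_eq_pt_iff.1 h2
  rw [h3] at h1
  exact (𝓗.one S).2 (h1.symm.trans (𝓗.H.map (sndEntry S).toLoc).base.map_pt)

theorem nonempty_heisenbergData (F : Tot 𝓗.C) : Nonempty (𝓗.HeisenbergData F) := by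
  obtain ⟨Δl, ⟨adjl⟩⟩ := exists_leftAdjoint 𝓗.m (𝓗.bijective_map_diag_base 1 fold)
  obtain ⟨Δr, ⟨adjr⟩⟩ := exists_rightAdjoint 𝓗.m (𝓗.bijective_map_diag_base 1 fold)
  obtain ⟨ΔrSq, ⟨adjrSq⟩⟩ := exists_rightAdjoint 𝓗.mSq (𝓗.bijective_map_diag_base 1 foldSq)
  obtain ⟨ins⟩ := 𝓗.nonempty_insertion _ (𝓗.pt F)
  obtain ⟨insΔ⟩ := 𝓗.nonempty_insertion _ (𝓗.pt F ≫ Δl)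
  obtain ⟨j, ⟨adjj⟩⟩ := exists_rightAdjoint (ins.hom ≫ 𝓗.H.map c.toLoc) (ins.bijective_base 𝓗 _ _)
  obtain ⟨jΔ, ⟨adjjΔ⟩⟩ := exists_rightAdjoint (insΔ.hom ≫ 𝓗.H.map cBar.toLoc)
    (insΔ.bijective_base 𝓗 _ _)
  exact ⟨⟨Δl, adjl, Δr, adjr, ΔrSq, adjrSq, ins, insΔ, j, adjj, jΔ, adjjΔ⟩⟩

end Base

end SSH
end SelfAdjointHopf

namespace SelfAdjointHopf
variable {k : Type u} [Field k]

/-! ### Pasting of squares -/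

section Pasting

variable {𝒞 : Type*} [Bicategory 𝒞] {a b c d e f : 𝒞} {g₁ : a ⟶ c} {g₂ : c ⟶ e} {h₁ : b ⟶ d}
  {h₂ : d ⟶ f} {r₁ : b ⟶ a} {r₂ : d ⟶ c} {r₃ : f ⟶ e}

/-- Solves each clause of `IsUnitSquare` for the whiskering of `τ`, everything else in it being
invertible. -/
theorem pasting_eq_iff (σ : r₂ ≫ g₂ ≅ h₂ ≫ r₃) {h : b ⟶ f} (v : h₁ ≫ h₂ ≅ h)
    (τ : (r₁ ≫ g₁) ≫ g₂ ⟶ (h₁ ≫ r₂) ≫ g₂) (ρ : (r₁ ≫ g₁) ≫ g₂ ⟶ h ≫ r₃) :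
    τ ⊗≫ h₁ ◁ σ.hom ⊗≫ v.hom ▷ r₃ = ρ ↔
      τ = ρ ≫ v.inv ▷ r₃ ≫ (α_ _ _ _).hom ≫ h₁ ◁ σ.inv ≫ (α_ _ _ _).inv := by
  have : τ ⊗≫ h₁ ◁ σ.hom ⊗≫ v.hom ▷ r₃ =
      τ ≫ ((α_ _ _ _) ≪≫ whiskerLeftIso h₁ σ ≪≫ (α_ _ _ _).symm ≪≫ whiskerRightIso v r₃).hom := by
    simp [bicategoricalComp]
  rw [this, ← Iso.eq_comp_inv]
  simp

/-- Brings a clause of `IsUnitSquare` into the shape to which `leftMate_comp` applies. -/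
theorem vcomp_eq_of_pasting_eq (σ : r₂ ≫ g₂ ⟶ h₂ ≫ r₃) {h : b ⟶ f} (v : h₁ ≫ h₂ ≅ h)
    (τ : r₁ ≫ g₁ ⟶ h₁ ≫ r₂) {g : a ⟶ e} (u : g₁ ≫ g₂ ⟶ g) (ρ : r₁ ≫ g ⟶ h ≫ r₃)
    (H : τ ▷ g₂ ⊗≫ h₁ ◁ σ ⊗≫ v.hom ▷ r₃ = 𝟙 _ ⊗≫ r₁ ◁ u ⊗≫ ρ) :
    rightAdjointSquare.vcomp τ σ = r₁ ◁ u ≫ ρ ≫ v.inv ▷ r₃ := by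
  calc
    _ = (𝟙 (r₁ ≫ g₁ ≫ g₂) ⊗≫ (τ ▷ g₂ ⊗≫ h₁ ◁ σ ⊗≫ v.hom ▷ r₃)) ≫ v.inv ▷ r₃ := by
      simp [bicategoricalComp, rightAdjointSquare.vcomp]
    _ = _ := by
      rw [H]
      simp [bicategoricalComp]

/-- The mate of a pasting of two squares with the Beck–Chevalley condition is invertible. -/
theorem RightBeckChevalley.isIso_mateEquiv_hcomp {g : a ⟶ c} {h : b ⟶ d} {k : e ⟶ f} {l₁ : a ⟶ b} {r₁ : b ⟶ a}
    {l₂ : c ⟶ d} {r₂ : d ⟶ c} {l₃ : b ⟶ e} {r₃ : e ⟶ b} {l₄ : d ⟶ f} {r₄ : f ⟶ d}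
    (adj₁ : l₁ ⊣ r₁) (adj₂ : l₂ ⊣ r₂) (adj₃ : l₃ ⊣ r₃) (adj₄ : l₄ ⊣ r₄)
    {σ : g ≫ l₂ ⟶ l₁ ≫ h} {τ : h ≫ l₄ ⟶ l₃ ≫ k} (hσ : RightBeckChevalley σ)
    (hτ : RightBeckChevalley τ) :
    IsIso (mateEquiv (adj₁.comp adj₃) (adj₂.comp adj₄) (leftAdjointSquare.hcomp σ τ)) := by
  have := hσ _ _ adj₁ adj₂
  have := hτ _ _ adj₃ adj₄
  rw [Bicategory.mateEquiv_hcomp, rightAdjointSquare.hcomp]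
  infer_instance

end Pasting

namespace TwoVectTensor

theorem isIso_of_nil {A : TwoVectTensor.{u, v, w} k} {f g : A ⟶ nil} (θ : f ⟶ g) : IsIso θ :=
  ⟨Hom₂.mk θ.base_eq.symm fun j => (nil_false j).elim, by
    ext j : 2
    exact (nil_false j).elim, by
    ext j : 2
    exact (nil_false j).elim⟩

end TwoVectTensor

/-! ### The Beck–Chevalley condition for `β` and `α` -/

namespace SSH

open FinSetSqcup TwoVectTensor

namespace HeisenbergData

variable {𝓗 : SSH.{u, v, w} k} {F : Tot 𝓗.C} (D : 𝓗.HeisenbergData F)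
  {τ : 𝓗.m ≫ D.ins.hom ⟶ D.insΔ.hom ≫ 𝓗.mm}

/-- The two clauses prescribe the whiskerings of `τ` with the two projections, and complementary
inert coCartesian 1-morphisms allow exactly one such `τ`. -/
theorem existsUnique_isUnitSquare : ∃! τ, D.IsUnitSquare τ := by
  simp only [IsUnitSquare, pasting_eq_iff]
  exact (𝓗.complementary_entries _).existsUnique (𝓗.isCoCartesian_fst _) (𝓗.isCoCartesian_snd _) _ _

/-- The left mate of `τ` is invertible. -/
theorem isIso_leftMate_of_isUnitSquare (hτ : D.IsUnitSquare τ)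
    {L : 𝓗.ob 2 (fset 1) ⟶ 𝓗.ob 2 (fset 2)} (adj : Bicategory.Adjunction L 𝓗.mm) :
    IsIso ((Bicategory.mateEquiv D.adjl adj).symm τ) := by
  obtain ⟨h₁, h₂⟩ := hτ
  have h₁ := vcomp_eq_of_pasting_eq _ D.insΔ.fst τ D.ins.fst.hom (𝟙 _ ⊗≫
    (toNilIso 𝓗.m).hom ▷ 𝓗.pt F ⊗≫ (toNil _ ≫ 𝓗.pt F) ◁ D.adjl.unit ⊗≫ 𝟙 _)
    (h₁.trans (by simp [bicategoricalComp]))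
  have h₂ := vcomp_eq_of_pasting_eq _ D.insΔ.snd τ D.ins.snd.hom ((ρ_ _).hom ≫ (λ_ _).inv)
    (h₂.trans (by simp [bicategoricalComp]))
  have : IsIso ((Bicategory.mateEquiv D.adjl adj).symm τ ▷ 𝓗.H.map (fstEntry (fset 2)).toLoc) := by
    refine isIso_whiskerRight_leftMate D.adjl adj D.adjl τ
      (𝓗.H.isoMapOfCommSq (commSq_fstEntry fold).toLoc).hom ?_ ?_
    · exact isIso_leftMate_of_isCoCartesian _ _ _ (𝓗.isCoCartesian_fst _) (𝓗.inertFst _).surjective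
        (𝓗.isCoCartesian_fst _) (𝓗.inertFst _).surjective
    · rw [h₁, leftMate_comp]
      -- The transpose of `toNilIso` is a 2-morphism between 1-morphisms to the empty list, hence
      -- invertible.
      have := isIso_leftMate_unit D.adjl (toNilIso 𝓗.m).hom (𝓗.pt F) (isIso_of_nil _)
      infer_instance
  have : IsIso ((Bicategory.mateEquiv D.adjl adj).symm τ ▷ 𝓗.H.map (sndEntry (fset 2)).toLoc) := by
    refine isIso_whiskerRight_leftMate D.adjl adj D.adjl τ
      (𝓗.H.isoMapOfCommSq (commSq_sndEntry fold).toLoc).hom ?_ ?_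
    · exact isIso_leftMate_of_isCoCartesian _ _ _ (𝓗.isCoCartesian_snd _) (𝓗.inertSnd _).surjective
        (𝓗.isCoCartesian_snd _) (𝓗.inertSnd _).surjective
    · rw [h₂, leftMate_comp]
      have := isIso_leftMate_unitors D.adjl
      infer_instance
  exact (𝓗.complementary_entries _).isIso (𝓗.isCoCartesian_fst _) (𝓗.isCoCartesian_snd _) _

theorem β_eq_vcomp : D.β τ =
    rightAdjointSquare.vcomp τ (𝓗.H.isoMapOfCommSq commSq_c.toLoc).hom := by
  simp [β, rightAdjointSquare.vcomp, bicategoricalComp]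

theorem α_eq_hcomp : D.α τ =
    leftAdjointSquare.hcomp (D.β τ) (𝓗.H.isoMapOfCommSq commSq_fold.toLoc).hom := by
  simp [α, leftAdjointSquare.hcomp, bicategoricalComp]

theorem rightBeckChevalley_β (hτ : D.IsUnitSquare τ) : RightBeckChevalley (D.β τ) := by
  obtain ⟨L, ⟨adj⟩⟩ := exists_leftAdjoint 𝓗.mm (𝓗.bijective_map_diag_base 2 fold)
  obtain ⟨L', ⟨adj'⟩⟩ := exists_leftAdjoint 𝓗.mBar (𝓗.bijective_map_diag_base 1 foldBar)
  refine rightBeckChevalley_of_isIso_leftMate _ D.adjl adj' ?_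
  rw [β_eq_vcomp, leftMate_vcomp D.adjl adj adj', leftAdjointSquare.vcomp]
  have := D.isIso_leftMate_of_isUnitSquare hτ adj
  have := isIso_leftMate_of_isCoCartesian adj adj' (𝓗.H.isoMapOfCommSq commSq_c.toLoc).hom
    (𝓗.coCartesian _ isStronglyCocartesian_c) (𝓗.surjective_map_cop_base _ _)
    (𝓗.coCartesian _ isStronglyCocartesian_cBar) (𝓗.surjective_map_cop_base _ _)
  infer_instance

/-- The right adjoints in `mate` come from composite adjunctions, so the mate of the horizontal
pasting `α` is composed of those of `β` and of the image of the Cartesian square. -/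
theorem isIso_mate (hτ : D.IsUnitSquare τ) : IsIso (D.mate τ) := by
  have h := RightBeckChevalley.isIso_mateEquiv_hcomp (h := 𝓗.mBar) (l₁ := D.iΔ) (l₂ := D.i)
    (l₃ := 𝓗.mSq) (l₄ := 𝓗.m) D.adjjΔ D.adjj D.adjrSq D.adjr (D.rightBeckChevalley_β hτ)
    (𝓗.beckChevalley isPullback_fold commSq_fold)
  rw [mate, α_eq_hcomp]
  with_reducible exact h

theorem rightBeckChevalley_α (hτ : D.IsUnitSquare τ) : RightBeckChevalley (D.α τ) := by
  have h := D.isIso_mate hτ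
  rw [mate] at h
  with_reducible exact rightBeckChevalley_of_isIso_mateEquiv _ _ _ h

end HeisenbergData

end SSH
end SelfAdjointHopf

theorem theorem5p2 {k : Type u} [Field k] (𝓗 : SelfAdjointHopf.SSH.{u, v, w} k)
    (F : SelfAdjointHopf.Tot 𝓗.C) :
    Nonempty (𝓗.HeisenbergData F) ∧
    ∀ D : 𝓗.HeisenbergData F, ∃ τ : 𝓗.m ≫ D.ins.hom ⟶ D.insΔ.hom ≫ 𝓗.mm,
      D.IsUnitSquare τ ∧ (∀ τ', D.IsUnitSquare τ' → τ' = τ) ∧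
      SelfAdjointHopf.RightBeckChevalley (D.β τ) ∧
      SelfAdjointHopf.RightBeckChevalley (D.α τ) ∧
      ∃ e : 𝓗.m ≫ D.ΔrF ≅ D.ΔrSqΔ ≫ 𝓗.m, e.inv = D.mate τ := by
  refine ⟨𝓗.nonempty_heisenbergData F, fun D => ?_⟩
  obtain ⟨τ, hτ, huniq⟩ := D.existsUnique_isUnitSquare
  have := D.isIso_mate hτ
  exact ⟨τ, hτ, huniq, D.rightBeckChevalley_β hτ, D.rightBeckChevalley_α hτ,
    (asIso (D.mate τ)).symm, rfl⟩
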